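/- All manifolds are smooth, finite-dimensional, without boundary, Hausdorff and second countable. A conformal structure $c$ on $M$ is a class of Riemannian metrics modulo multiplication by positive smooth functions. A Weyl structure on $(M,c)$ is a torsion-free connection $D$ on $TM$ which preserves $c$, i.e. for every $g\in c$ there is a $1$-form $\theta$ with $Dg=-2\theta\otimes g$. It has reducible holonomy if its holonomy group at a point $x$, acting on $T_xM$, has an invariant subspace different from $0$ and $T_xM$. A submersion $p:(M,c)\to (N,c')$ is conformal if $dp$ maps $(\ker dp_x)^\perp$ conformally onto $T_{p(x)}N$ for every $x\in M$. A conformal structure on $M_1\times M_2$, where $\dim M_1,\dim M_2\ge 1$, is a conformal product of $(M_1,c_1)$ and $(M_2,c_2)$ if the canonical projections $p_1,p_2$ are orthogonal conformal submersions, i.e. they are conformal submersions and $\ker dp_1\perp\ker dp_2$. A local conformal product structure on $(M,c)$ is a splitting $TM=H_1\oplus H_2$ such that each point of $M$ has an open neighbourhood $U$ and a diffeomorphism $(p_1,p_2):U\to M_1\times M_2$ which makes $c|_U$ a conformal product of some conformal manifolds $(M_1,c_1)$, $(M_2,c_2)$ of positive dimension, with $H_1=\ker dp_2$ and $H_2=\ker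 dp_1$ on $U$. Theorem. Let $(M,c)$ be a connected conformal manifold and let $x_0\in M$. (1) $(M,c)$ admits a local conformal product structure if and only if it carries a Weyl structure with reducible holonomy. (2) For every local conformal product structure $TM=H_1\oplus H_2$ on $(M,c)$ there is a unique Weyl structure on $(M,c)$ that preserves $H_1$ and $H_2$ (the adapted Weyl structure). (3) There is a one-to-one correspondence between the pairs $(D,V)$, where $D$ is a Weyl structure on $(M,c)$ and $V$ is a subspace of $T_{x_0}M$, different from $0$ and $T_{x_0}M$, which is invariant under the holonomy group of $D$ at $x_0$, and the local conformal product structures $TM=H_1\oplus H_2$ on $(M,c)$; if $(D,V)$ corresponds to $(H_1,H_2)$, then $D$ preserves $H_1$ and $H_2$, and $(H_1)_{x_0}=V$. (4) If a conformal structure $c$ on $M_1\times M_2$ is a conformal product of $(M_1,c_1)$ and $(M_2,c_2)$, where $\dim M_1,\dim M_2\ge 1$, then there is a unique Weyl structure on $(M_1\times M_2,c)$ that preserves the splitting $T(M_1\times M_2)=\ker dp_2\oplus\ker dp_1$, and it has reducible holonomy at every point. -/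

import Mathlib

open scoped Manifold ContDiff
open Bundle

noncomputable section

namespace ConformalProducts

section Basic

variable {E : Type*} [NormedAddCommGroup E] [NormedSpace ℝ E]
  {H : Type*} [TopologicalSpace H] (I : ModelWithCorners ℝ E H)
  (M : Type*) [TopologicalSpace M] [ChartedSpace H M] [IsManifold I ∞ M]

/-- Smooth Riemannian metrics on `M`. -/
abbrev Metric : Type _ :=
  ContMDiffRiemannianMetric I ∞ E (TangentSpace I : M → Type _)

/-- Two metrics are conformally related if they differ by a positive smooth function. -/
def conformalSetoid : Setoid (Metric I M) where
  r g g' := ∃ f : M → ℝ, ContMDiff I 𝓘(ℝ, ℝ) ∞ f ∧ (∀ x, 0 < f x) ∧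
    ∀ (x : M) (v w : TangentSpace I x), g'.inner x v w = f x * g.inner x v w
  iseqv :=
    { refl := fun g => ⟨fun _ => 1, contMDiff_const, fun _ => one_pos, by simp⟩
      symm := by
        rintro g g' ⟨f, hf, hpos, h⟩
        refine ⟨fun x => (f x)⁻¹, hf.inv₀ fun x => (hpos x).ne', fun x => inv_pos.2 (hpos x), ?_⟩
        intro x v w
        rw [h, inv_mul_cancel_left₀ (hpos x).ne']
      trans := by
        rintro g g' g'' ⟨f, hf, hpos, h⟩ ⟨f', hf', hpos', h'⟩
        refine ⟨fun x => f' x * f x, hf'.mul hf, fun x => mul_pos (hpos' x) (hpos x), ?_⟩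
        intro x v w
        rw [h', h, mul_assoc] }

/-- A conformal structure: a class of Riemannian metrics modulo positive smooth functions. -/
def ConformalStructure : Type _ := Quotient (conformalSetoid I M)

end Basic

section Conformal

variable {E : Type*} [NormedAddCommGroup E] [NormedSpace ℝ E]
  {H : Type*} [TopologicalSpace H] {I : ModelWithCorners ℝ E H}
  {M : Type*} [TopologicalSpace M] [ChartedSpace H M] [IsManifold I ∞ M]
  {E' : Type*} [NormedAddCommGroup E'] [NormedSpace ℝ E']
  {H' : Type*} [TopologicalSpace H'] {I' : ModelWithCorners ℝ E' H'}
  {M' : Type*} [TopologicalSpace M'] [ChartedSpace H' M'] [IsManifold I' ∞ M']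

/-- The metric `g` belongs to the conformal class `c`. -/
def ConformalStructure.HasMetric (c : ConformalStructure I M) (g : Metric I M) : Prop :=
  Quotient.mk (conformalSetoid I M) g = c

/-- Orthogonality of two tangent vectors with respect to a conformal structure. -/
def ConformalStructure.Orthogonal (c : ConformalStructure I M) (x : M)
    (v w : TangentSpace I x) : Prop :=
  ∀ g : Metric I M, c.HasMetric g → g.inner x v w = 0

/-- The kernel of the differential of `f` at `x`. -/
def kerD (I : ModelWithCorners ℝ E H) (I' : ModelWithCorners ℝ E' H') (f : M → M') (x : M) :
    Submodule ℝ (TangentSpace I x) :=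
  LinearMap.ker (mfderiv I I' f x).toLinearMap

/-- `f` restricts to a conformal submersion from the open set `s` of `(M, c)` to `(M', c')`: it is
a smooth submersion on `s`, and its differential at each point of `s` maps the orthogonal
complement of its kernel conformally to the tangent space of `M'`. -/
def IsConformalSubmersionOn (c : ConformalStructure I M) (c' : ConformalStructure I' M')
    (f : M → M') (s : Set M) : Prop :=
  ContMDiffOn I I' ∞ f s ∧ ∀ x ∈ s,
    Function.Surjective (mfderiv I I' f x) ∧
    ∀ (g : Metric I M) (g' : Metric I' M'), c.HasMetric g → c'.HasMetric g' →
      ∃ r : ℝ, 0 < r ∧ ∀ v w : TangentSpace I x,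
        (∀ u ∈ kerD I I' f x, c.Orthogonal x v u) →
        (∀ u ∈ kerD I I' f x, c.Orthogonal x w u) →
        g'.inner (f x) (mfderiv I I' f x v) (mfderiv I I' f x w) = r * g.inner x v w

end Conformal

section Product

variable {E₁ : Type*} [NormedAddCommGroup E₁] [NormedSpace ℝ E₁]
  {H₁ : Type*} [TopologicalSpace H₁] {I₁ : ModelWithCorners ℝ E₁ H₁}
  {M₁ : Type*} [TopologicalSpace M₁] [ChartedSpace H₁ M₁] [IsManifold I₁ ∞ M₁]
  {E₂ : Type*} [NormedAddCommGroup E₂] [NormedSpace ℝ E₂]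
  {H₂ : Type*} [TopologicalSpace H₂] {I₂ : ModelWithCorners ℝ E₂ H₂}
  {M₂ : Type*} [TopologicalSpace M₂] [ChartedSpace H₂ M₂] [IsManifold I₂ ∞ M₂]

/-- The conformal structure `c` on `M₁ × M₂` is a conformal product of `(M₁, c₁)` and `(M₂, c₂)`:
the canonical projections are orthogonal conformal submersions. -/
def IsConformalProduct (c₁ : ConformalStructure I₁ M₁) (c₂ : ConformalStructure I₂ M₂)
    (c : ConformalStructure (I₁.prod I₂) (M₁ × M₂)) : Prop :=
  IsConformalSubmersionOn c c₁ Prod.fst Set.univ ∧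
  IsConformalSubmersionOn c c₂ Prod.snd Set.univ ∧
  ∀ x : M₁ × M₂, ∀ v ∈ kerD (I₁.prod I₂) I₁ (Prod.fst : M₁ × M₂ → M₁) x,
    ∀ w ∈ kerD (I₁.prod I₂) I₂ (Prod.snd : M₁ × M₂ → M₂) x, c.Orthogonal x v w

end Product

section LocalProduct

variable {E : Type*} [NormedAddCommGroup E] [NormedSpace ℝ E]
  {H : Type*} [TopologicalSpace H] {I : ModelWithCorners ℝ E H}
  {M : Type*} [TopologicalSpace M] [ChartedSpace H M] [IsManifold I ∞ M]

/-- An open neighbourhood of `x` in `M`, identified through a diffeomorphism `Φ = (p₁, p₂)` with a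
product of conformal manifolds of positive dimension, on which `c` is a conformal product: `p₁` and
`p₂` are orthogonal conformal submersions. The tangent spaces of the factors are the given
subspaces: `D₁ = ker dp₂` and `D₂ = ker dp₁`. -/
structure ConformalProductNeighborhood (c : ConformalStructure I M)
    (D₁ D₂ : (x : M) → Submodule ℝ (TangentSpace I x)) (x : M) where
  n₁ : ℕ
  n₂ : ℕ
  n₁_pos : 0 < n₁
  n₂_pos : 0 < n₂
  M₁ : Type
  M₂ : Type
  [top₁ : TopologicalSpace M₁]
  [top₂ : TopologicalSpace M₂]
  [charted₁ : ChartedSpace (EuclideanSpace ℝ (Fin n₁)) M₁]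
  [charted₂ : ChartedSpace (EuclideanSpace ℝ (Fin n₂)) M₂]
  [mfd₁ : IsManifold (𝓡 n₁) ∞ M₁]
  [mfd₂ : IsManifold (𝓡 n₂) ∞ M₂]
  [t2₁ : T2Space M₁]
  [t2₂ : T2Space M₂]
  [sc₁ : SecondCountableTopology M₁]
  [sc₂ : SecondCountableTopology M₂]
  c₁ : ConformalStructure (𝓡 n₁) M₁
  c₂ : ConformalStructure (𝓡 n₂) M₂
  Φ : OpenPartialHomeomorph M (M₁ × M₂)
  mem_source : x ∈ Φ.source
  target_eq : Φ.target = Set.univ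
  smooth : ContMDiffOn I ((𝓡 n₁).prod (𝓡 n₂)) ∞ Φ Φ.source
  smooth_symm : ContMDiff ((𝓡 n₁).prod (𝓡 n₂)) I ∞ Φ.symm
  conformal₁ : IsConformalSubmersionOn c c₁ (fun y => (Φ y).1) Φ.source
  conformal₂ : IsConformalSubmersionOn c c₂ (fun y => (Φ y).2) Φ.source
  orthogonal : ∀ y ∈ Φ.source, ∀ v ∈ kerD I (𝓡 n₁) (fun y => (Φ y).1) y,
    ∀ w ∈ kerD I (𝓡 n₂) (fun y => (Φ y).2) y, c.Orthogonal y v w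
  ker₂_eq : ∀ y ∈ Φ.source, kerD I (𝓡 n₂) (fun y => (Φ y).2) y = D₁ y
  ker₁_eq : ∀ y ∈ Φ.source, kerD I (𝓡 n₁) (fun y => (Φ y).1) y = D₂ y

/-- A local conformal product structure on `(M, c)`: a splitting `TM = D₁ ⊕ D₂` which, near each
point, is the splitting `TM₁ ⊕ TM₂` of an identification of an open set of `(M, c)` with a conformal
product of conformal manifolds `(M₁, c₁)` and `(M₂, c₂)` of positive dimension. Equivalently, an
atlas of such identifications, with transition maps that preserve both factors. -/
@[ext]
structure LocalConformalProductStructure (c : ConformalStructure I M) where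
  D₁ : (x : M) → Submodule ℝ (TangentSpace I x)
  D₂ : (x : M) → Submodule ℝ (TangentSpace I x)
  isLocalProduct : ∀ x, Nonempty (ConformalProductNeighborhood c D₁ D₂ x)

end LocalProduct

section Weyl

variable {E : Type*} [NormedAddCommGroup E] [NormedSpace ℝ E] [FiniteDimensional ℝ E]
  {H : Type*} [TopologicalSpace H] {I : ModelWithCorners ℝ E H}
  {M : Type*} [TopologicalSpace M] [ChartedSpace H M] [IsManifold I ∞ M]

/-- A Weyl structure on `(M, c)`: a smooth torsion-free connection `∇` on `TM` that preserves `c`,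
which means that for `g` in `c` there is a 1-form `θ` with `∇ g = -2 θ ⊗ g` (such a `θ` is
automatically smooth). Mathlib's covariant derivatives are also evaluated on vector fields that are
not differentiable; we fix the meaningless value there to be `0`, so that two Weyl structures are
equal as soon as they agree on differentiable vector fields. `∇ Y x v` is `∇_v Y` at `x`. -/
structure WeylStructure (c : ConformalStructure I M) where
  nabla : CovariantDerivative I E (TangentSpace I : M → Type _)
  smooth : CovariantDerivative.ContMDiffCovariantDerivative nabla ∞
  torsion_free : ∀ (Y Z : (x : M) → TangentSpace I x) (x : M),
    MDiffAt (T% Y) x → MDiffAt (T% Z) x →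
      nabla Z x (Y x) - nabla Y x (Z x) = VectorField.mlieBracket I Y Z x
  preserves_conformal : ∀ g : Metric I M, c.HasMetric g →
    ∃ θ : (x : M) → TangentSpace I x →L[ℝ] ℝ,
      ∀ (Y Z : (x : M) → TangentSpace I x) (x : M) (v : TangentSpace I x),
        MDiffAt (T% Y) x → MDiffAt (T% Z) x →
          mfderiv I 𝓘(ℝ, ℝ) (fun y => g.inner y (Y y) (Z y)) x v =
            g.inner x (nabla Y x v) (Z x) + g.inner x (Y x) (nabla Z x v)
              - 2 * θ x v * g.inner x (Y x) (Z x)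
  eq_zero_of_not_mdifferentiableAt : ∀ (Y : (x : M) → TangentSpace I x) (x : M),
    ¬ MDiffAt (T% Y) x → nabla Y x = 0

/-- The covariant derivative at time `t` of a vector field along a curve. The field and the curve
are given together as a curve `W` in the tangent bundle. In the trivialization of `TM` at the base
point `p` of `W t`, the field has a coordinate vector `a s`, and its covariant derivative is
`a'(t) + ∇_{γ'(t)} Y`, with `Y` the vector field with constant coordinate vector `a t`. -/
def covDerivAlong (nabla : CovariantDerivative I E (TangentSpace I : M → Type _))
    (W : ℝ → TangentBundle I M) (t : ℝ) : TangentSpace I (W t).proj :=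
  let e := trivializationAt E (TangentSpace I : M → Type _) (W t).proj
  e.symm (W t).proj (deriv (fun s => (e (W s)).2) t) +
    nabla (fun y => e.symm y (e (W t)).2) (W t).proj
      (mfderiv 𝓘(ℝ, ℝ) I (fun s => (W s).proj) t (1 : ℝ))

/-- `IsParallelTransport nabla x y A`: the map `A : T_x M → T_y M` is the parallel transport along
some piecewise smooth curve from `x` to `y`, a finite concatenation of smooth segments. -/
inductive IsParallelTransport (nabla : CovariantDerivative I E (TangentSpace I : M → Type _)) :
    (x y : M) → (TangentSpace I x ≃ₗ[ℝ] TangentSpace I y) → Prop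
  | segment (x y : M) (γ : ℝ → M) (A : TangentSpace I x ≃ₗ[ℝ] TangentSpace I y)
      (start : γ 0 = x) (finish : γ 1 = y) (smooth : ContMDiff 𝓘(ℝ, ℝ) I ∞ γ)
      (parallel : ∀ v : TangentSpace I x, ∃ W : ℝ → TangentBundle I M,
        ContMDiff 𝓘(ℝ, ℝ) I.tangent ∞ W ∧ (∀ t, (W t).proj = γ t) ∧
        (∀ t, covDerivAlong nabla W t = 0) ∧ W 0 = ⟨x, v⟩ ∧ W 1 = ⟨y, A v⟩) :
      IsParallelTransport nabla x y A
  | trans (x y z : M) (A : TangentSpace I x ≃ₗ[ℝ] TangentSpace I y)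
      (B : TangentSpace I y ≃ₗ[ℝ] TangentSpace I z)
      (hA : IsParallelTransport nabla x y A) (hB : IsParallelTransport nabla y z B) :
      IsParallelTransport nabla x z (A.trans B)

/-- The holonomy group at `x`: the parallel transports along the piecewise smooth loops at `x`. -/
def holonomyGroup (nabla : CovariantDerivative I E (TangentSpace I : M → Type _)) (x : M) :
    Subgroup (TangentSpace I x ≃ₗ[ℝ] TangentSpace I x) :=
  Subgroup.closure {A | IsParallelTransport nabla x x A}

/-- `U` is an invariant subspace of the holonomy representation at `x`, different from `0` and from
the tangent space. -/
def IsReducingSubspace (nabla : CovariantDerivative I E (TangentSpace I : M → Type _)) (x : M)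
    (U : Submodule ℝ (TangentSpace I x)) : Prop :=
  U ≠ ⊥ ∧ U ≠ ⊤ ∧ ∀ A ∈ holonomyGroup nabla x, ∀ v ∈ U, A v ∈ U

/-- The holonomy representation at `x` is reducible. -/
def HasReducibleHolonomyAt (nabla : CovariantDerivative I E (TangentSpace I : M → Type _))
    (x : M) : Prop :=
  ∃ U : Submodule ℝ (TangentSpace I x), IsReducingSubspace nabla x U

/-- The connection preserves the distribution `D`: if the vector field `Y` takes its values in `D`
near `x`, then so does `∇_v Y` at `x`. -/
def PreservesDistribution (nabla : CovariantDerivative I E (TangentSpace I : M → Type _))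
    (D : (x : M) → Submodule ℝ (TangentSpace I x)) : Prop :=
  ∀ (Y : (x : M) → TangentSpace I x) (x : M) (v : TangentSpace I x),
    MDiffAt (T% Y) x → (∀ᶠ y in nhds x, Y y ∈ D y) → nabla Y x v ∈ D x

/-- The Weyl structure `W` preserves the splitting `TM = D₁ ⊕ D₂`. -/
def WeylStructure.PreservesSplitting {c : ConformalStructure I M} (W : WeylStructure c)
    (D₁ D₂ : (x : M) → Submodule ℝ (TangentSpace I x)) : Prop :=
  PreservesDistribution W.nabla D₁ ∧ PreservesDistribution W.nabla D₂

end Weyl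

end ConformalProducts

end

/-!
A covariant derivative is studied through its Christoffel symbols `Γ` in charts with values in
arbitrary vector spaces (`SmoothChart`). For a splitting `(D₁, D₂)` the useful charts are the split
ones (`SmoothChart.IsSplit`), with values in a product `E₁ × E₂`, in which `D₁` and `D₂` are the
tangent spaces of the factors.

*The adapted Weyl structure.* If a Weyl connection preserves `D₁` and `D₂`, its symbols in a split
chart are symmetric and map each factor to itself, so the mixed terms `Γ (a, 0) (0, b)` vanish. In
`∇ g = -2 θ ⊗ g` this means that `θ`, in the direction of one factor, is `-1/2` times the
logarithmic derivative of the metric of the other one. Hence `θ` is determined, and so is `Γ`, since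
a symmetric bilinear map which is skew-symmetric for a scalar product is zero (`eq_of_isBlock`).
Conversely, if the metric is that of a conformal product, the metric of each factor changes only by
a scalar factor in the direction of the other one; with this `θ` the Koszul formula gives symmetric
symbols which respect the factors (`IsConformalBlock.exists_christoffel`). By uniqueness the local
adapted connections agree on overlaps and define a Weyl structure (`existsUnique_adapted`). Its
holonomy leaves `D₁` invariant, because in a split chart the component in `E₂` of a parallel vector
field satisfies a homogeneous linear differential equation (`SmoothChart.IsSplit.parallel_mem`).

*From an invariant subspace to a splitting.* A subspace `V` invariant under the holonomy group
spreads, by parallel transport, to a distribution `D` that all parallel transports respect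
(`exists_parallel_distribution`). Parallel transport of a Weyl connection is conformal, so it
respects the orthogonal complement of `D` as well (`IsRadialTransport.conformal`,
`exists_isRadiallyParallel`). Parallel transport along the rays of a chart depends smoothly on the
end point, which makes both distributions smooth and shows that the connection preserves them
(`preservesDistribution_of_isRadiallyParallel`). As the connection is torsion-free, both are
integrable, and first integrals of the two provide a split chart (`exists_first_integral`,
`exists_isSplit_of_isRadiallyParallel`). There the mixed symbols vanish, so the vectors of one
factor are parallel along the other one, and the metric of a factor changes only by a scalar factor
along the other (`exists_ratio_of_parallel`): the chart is a conformal product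
(`SmoothChart.IsSplit.nonempty_conformalProductNeighborhood`).

*The correspondence.* The two constructions are inverse to each other: the Weyl structure is
recovered as the adapted one, and a local conformal product structure is determined by its adapted
Weyl structure and its first distribution at one point, as parallel transport reaches every point
and `D₂` is the orthogonal complement of `D₁` (`LocalConformalProductStructure.eq_of_apply_eq`).

*Analysis.* Both the smoothness of radial parallel transport and the Frobenius theorem rest on one
fact about the differential equation `x' = B(x, t v) v`, namely that its solution at time `1`
depends smoothly on the initial value and on `v` for small `v` (`exists_radial_solution`). It
follows from the inverse function theorem in the Banach space of continuous curves, since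
composition with a smooth map is a smooth operation there (`contDiff_superposition`) and for `v = 0`
the solutions are constant. The Frobenius theorem is needed only for the graph of a family of linear
maps (`exists_frobenius`): its leaves are the solutions along rays, and integrability forces them to
be tangent to the distribution (`fderiv_radial_solution`).
-/

section Development

set_option linter.unusedSectionVars false
set_option maxSynthPendingDepth 3

open Set Filter
open scoped Topology

noncomputable section

namespace ConformalProducts

/-! ### Smoothness of superposition operators -/

section Superposition

universe u

variable {J : Type} [TopologicalSpace J] [CompactSpace J]

/-- A continuous bilinear map acts pointwise on pairs of continuous curves. -/
def curveBilin {Y Z X : Type*} [NormedAddCommGroup Y] [NormedSpace ℝ Y]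
    [NormedAddCommGroup Z] [NormedSpace ℝ Z] [NormedAddCommGroup X] [NormedSpace ℝ X]
    (b : Y →L[ℝ] Z →L[ℝ] X) : C(J, Y) →L[ℝ] C(J, Z) →L[ℝ] C(J, X) :=
  LinearMap.mkContinuous₂
    (LinearMap.mk₂ ℝ (fun (A : C(J, Y)) (h : C(J, Z)) =>
        (⟨fun t => b (A t) (h t), by fun_prop⟩ : C(J, X)))
      (fun _ _ _ => by ext; simp) (fun _ _ _ => by ext; simp)
      (fun _ _ _ => by ext; simp) (fun _ _ _ => by ext; simp)) ‖b‖
    (fun A h => by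
      rw [ContinuousMap.norm_le _ (by positivity)]
      intro t
      refine (b.le_opNorm₂ (A t) (h t)).trans ?_
      gcongr
      exacts [A.norm_coe_le_norm t, h.norm_coe_le_norm t])

set_option synthInstance.maxHeartbeats 200000 in
/-- If `f` is `C¹`, so is the superposition operator `u ↦ f ∘ u`: its derivative at `u` is the
pointwise application of `f' ∘ u`. The estimate is uniform in time because `f'` is uniformly
continuous at the points of the compact range of `u`. -/
lemma hasFDerivAt_superposition {Z X : Type*} [NormedAddCommGroup Z] [NormedSpace ℝ Z]
    [NormedAddCommGroup X] [NormedSpace ℝ X] {f : Z → X} {f' : Z → Z →L[ℝ] X}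
    (hf : Continuous f) (hf' : Continuous f') (hd : ∀ z, HasFDerivAt f (f' z) z) (u : C(J, Z)) :
    HasFDerivAt (fun u : C(J, Z) => (ContinuousMap.comp ⟨f, hf⟩ u : C(J, X)))
      (curveBilin (ContinuousLinearMap.id ℝ (Z →L[ℝ] X)) (ContinuousMap.comp ⟨f', hf'⟩ u)) u := by
  rw [hasFDerivAt_iff_isLittleO_nhds_zero, Asymptotics.isLittleO_iff]
  intro ε hε
  have hK : IsCompact (range u) := isCompact_range u.continuous
  have h1 := hK.uniformContinuousAt_of_continuousAt f' (fun a _ => hf'.continuousAt)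
    (Metric.dist_mem_uniformity hε)
  obtain ⟨δ, hδ, h2⟩ := Metric.mem_uniformity_dist.1 h1
  filter_upwards [Metric.ball_mem_nhds (0 : C(J, Z)) hδ] with h hh
  rw [mem_ball_zero_iff] at hh
  rw [ContinuousMap.norm_le _ (by positivity)]
  intro t
  have hht : ‖h t‖ < δ := (h.norm_coe_le_norm t).trans_lt hh
  have key := (convex_ball (u t) δ).norm_image_sub_le_of_norm_hasFDerivWithin_le' (𝕜 := ℝ)
    (f := f) (f' := f') (φ := f' (u t)) (C := ε) (x := u t) (y := u t + h t)
    (fun x _ => (hd x).hasFDerivWithinAt)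
    (fun x hx => by
      have := h2 (a := u t) (b := x) (by rw [dist_comm]; exact hx) (mem_range_self t)
      rw [← dist_eq_norm, dist_comm]
      exact le_of_lt this)
    (Metric.mem_ball_self hδ) (by simpa [mem_ball_iff_norm] using hht)
  simp only [add_sub_cancel_left] at key
  have : ε * ‖h t‖ ≤ ε * ‖h‖ := by gcongr; exact h.norm_coe_le_norm t
  simpa using! key.trans this

set_option synthInstance.maxHeartbeats 200000 in
/-- By induction: the derivative of a superposition operator is, up to a continuous linear map, the
superposition operator of the derivative. -/
lemma contDiff_superposition_nat {Z : Type u} [NormedAddCommGroup Z] [NormedSpace ℝ Z] (n : ℕ) :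
    ∀ {X : Type u} [NormedAddCommGroup X] [NormedSpace ℝ X] {f : Z → X} (hf : ContDiff ℝ n f),
      ContDiff ℝ n (fun u : C(J, Z) => (ContinuousMap.comp ⟨f, hf.continuous⟩ u : C(J, X))) := by
  induction n with
  | zero =>
    intro X _ _ f hf
    simp only [Nat.cast_zero, contDiff_zero] at hf ⊢
    exact ContinuousMap.continuous_postcomp ⟨f, hf⟩
  | succ n ih =>
    intro X _ _ f hf
    push_cast at hf ⊢
    obtain ⟨f', hf', hd⟩ := contDiff_succ_iff_hasFDerivAt.1 hf
    rw [contDiff_succ_iff_hasFDerivAt]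
    exact ⟨_, (curveBilin (ContinuousLinearMap.id ℝ (Z →L[ℝ] X))).contDiff.comp (ih hf'),
      hasFDerivAt_superposition hf.continuous hf'.continuous hd⟩

lemma contDiff_superposition {Z X : Type u} [NormedAddCommGroup Z] [NormedSpace ℝ Z]
    [NormedAddCommGroup X] [NormedSpace ℝ X] {f : Z → X} (hf : ContDiff ℝ ∞ f) :
    ContDiff ℝ ∞ (fun u : C(J, Z) => (ContinuousMap.comp ⟨f, hf.continuous⟩ u : C(J, X))) :=
  contDiff_infty.2 fun n => contDiff_superposition_nat n (contDiff_infty.1 hf n)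

end Superposition

/-! ### Differential equations in radial form -/

section RadialODE

universe u

/-- The Volterra operator `u ↦ ∫₀ᵗ u`. -/
def volterra (X : Type*) [NormedAddCommGroup X] [NormedSpace ℝ X] :
    C(unitInterval, X) →L[ℝ] C(unitInterval, X) :=
  LinearMap.mkContinuous
    { toFun := fun u =>
        ⟨fun t => ∫ s in (0 : ℝ)..t, u (projIcc 0 1 zero_le_one s), by
          have hc : Continuous fun s => u (projIcc 0 1 zero_le_one s) :=
            u.continuous.comp continuous_projIcc
          exact (intervalIntegral.continuous_primitive
            (fun a b => hc.intervalIntegrable a b) 0).comp continuous_subtype_val⟩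
      map_add' := fun u v => by
        ext t
        have hc (u : C(unitInterval, X)) : Continuous fun s => u (projIcc 0 1 zero_le_one s) :=
          u.continuous.comp continuous_projIcc
        simpa using! intervalIntegral.integral_add ((hc u).intervalIntegrable 0 t)
          ((hc v).intervalIntegrable 0 t)
      map_smul' := fun c u => by
        ext t
        simp } 1
    (fun u => by
      rw [ContinuousMap.norm_le _ (by positivity), one_mul]
      intro t
      have := intervalIntegral.norm_integral_le_of_norm_le_const (a := 0) (b := (t : ℝ))
        (f := fun s => u (projIcc 0 1 zero_le_one s)) (C := ‖u‖)
        (fun s _ => u.norm_coe_le_norm _)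
      refine this.trans ?_
      have h1 : |(t : ℝ) - 0| ≤ 1 := by rw [sub_zero, abs_of_nonneg t.2.1]; exact t.2.2
      exact mul_le_of_le_one_right (norm_nonneg _) h1)

lemma volterra_apply {X : Type*} [NormedAddCommGroup X] [NormedSpace ℝ X]
    (u : C(unitInterval, X)) (t : unitInterval) :
    volterra X u t = ∫ s in (0 : ℝ)..t, u (projIcc 0 1 zero_le_one s) := rfl

variable {X V : Type u} [NormedAddCommGroup X] [NormedSpace ℝ X]
  [NormedAddCommGroup V] [NormedSpace ℝ V]

/-- Constant curves, as a continuous linear map. -/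
def constCurve (X : Type*) [NormedAddCommGroup X] [NormedSpace ℝ X] :
    X →L[ℝ] C(unitInterval, X) :=
  LinearMap.mkContinuous
    { toFun := fun x => ContinuousMap.const _ x
      map_add' := fun _ _ => rfl
      map_smul' := fun _ _ => rfl } 1
    (fun x => by
      rw [ContinuousMap.norm_le _ (by positivity), one_mul]
      intro t; exact le_rfl)

@[simp]
lemma constCurve_apply {X : Type*} [NormedAddCommGroup X] [NormedSpace ℝ X] (x : X)
    (t : unitInterval) : constCurve X x t = x := rfl

/-- The curve `t ↦ (q, t, u t)`. -/
def graphCurve {Q X : Type*} [NormedAddCommGroup Q] [NormedSpace ℝ Q]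
    [NormedAddCommGroup X] [NormedSpace ℝ X] (p : Q × C(unitInterval, X)) :
    C(unitInterval, Q × ℝ × X) :=
  ⟨fun t => (p.1, (t : ℝ), p.2 t), by fun_prop⟩

lemma contDiff_graphCurve {Q X : Type*} [NormedAddCommGroup Q] [NormedSpace ℝ Q]
    [NormedAddCommGroup X] [NormedSpace ℝ X] :
    ContDiff ℝ ∞ (graphCurve : Q × C(unitInterval, X) → C(unitInterval, Q × ℝ × X)) := by
  let L : Q × C(unitInterval, X) →L[ℝ] C(unitInterval, Q × ℝ × X) :=
    ((ContinuousLinearMap.inl ℝ Q (ℝ × X)).compLeftContinuous ℝ unitInterval ∘L constCurve Q) ∘L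
      ContinuousLinearMap.fst ℝ Q C(unitInterval, X) +
    (((ContinuousLinearMap.inr ℝ Q (ℝ × X)) ∘L
      (ContinuousLinearMap.inr ℝ ℝ X)).compLeftContinuous ℝ unitInterval) ∘L
      ContinuousLinearMap.snd ℝ Q C(unitInterval, X)
  let c : C(unitInterval, Q × ℝ × X) := ⟨fun t => (0, (t : ℝ), 0), by fun_prop⟩
  have : (graphCurve : Q × C(unitInterval, X) → C(unitInterval, Q × ℝ × X)) =
      fun p => L p + c := by
    ext1 p
    ext t <;> simp [graphCurve, L, c]
  rw [this]
  exact L.contDiff.add contDiff_const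

/-- The right-hand side `B(x, t v) v` of the radial equation, as a function of
`((a, v), t, x)`. -/
def radialField (B : X × V → V →L[ℝ] X) (z : (X × V) × ℝ × X) : X :=
  B (z.2.2, z.2.1 • z.1.2) z.1.2

lemma contDiff_radialField {B : X × V → V →L[ℝ] X} (hB : ContDiff ℝ ∞ B) :
    ContDiff ℝ ∞ (radialField B) := by
  unfold radialField
  exact (hB.comp (by fun_prop : ContDiff ℝ ∞ fun z : (X × V) × ℝ × X =>
    (z.2.2, z.2.1 • z.1.2))).clm_apply (by fun_prop)

/-- The defect of a curve `u` in the integral form of the radial equation with parameters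
`(a, v)`, paired with the parameters. -/
def radialDefect {B : X × V → V →L[ℝ] X} (hB : ContDiff ℝ ∞ B)
    (p : (X × V) × C(unitInterval, X)) : (X × V) × C(unitInterval, X) :=
  (p.1, p.2 - constCurve X p.1.1 - volterra X
    (ContinuousMap.comp ⟨radialField B, (contDiff_radialField hB).continuous⟩ (graphCurve p)))

lemma contDiff_radialDefect {B : X × V → V →L[ℝ] X} (hB : ContDiff ℝ ∞ B) :
    ContDiff ℝ ∞ (radialDefect hB) := by
  have h := (contDiff_superposition (J := unitInterval) (contDiff_radialField hB)).comp
    (contDiff_graphCurve (Q := X × V) (X := X))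
  refine contDiff_fst.prodMk ((contDiff_snd.sub ?_).sub ((volterra X).contDiff.comp h))
  exact (constCurve X).contDiff.comp (contDiff_fst.comp contDiff_fst)

/-- The defect vanishes if and only if the curve solves the radial equation in its integral form. -/
lemma radialDefect_eq_zero_iff {B : X × V → V →L[ℝ] X} (hB : ContDiff ℝ ∞ B) (q : X × V)
    (u : C(unitInterval, X)) :
    radialDefect hB (q, u) = (q, 0) ↔ ∀ t : unitInterval, u t = q.1 +
      ∫ s in (0 : ℝ)..t, B (u (projIcc 0 1 zero_le_one s), s • q.2) q.2 := by
  have key (t : unitInterval) : volterra X (ContinuousMap.comp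
      ⟨radialField B, (contDiff_radialField hB).continuous⟩ (graphCurve (q, u))) t =
      ∫ s in (0 : ℝ)..t, B (u (projIcc 0 1 zero_le_one s), s • q.2) q.2 := by
    rw [volterra_apply]
    refine intervalIntegral.integral_congr fun s hs => ?_
    rw [uIcc_of_le t.2.1] at hs
    have hs' : s ∈ Icc (0 : ℝ) 1 := ⟨hs.1, hs.2.trans t.2.2⟩
    simp [radialField, graphCurve, projIcc_of_mem zero_le_one hs']
  simp only [radialDefect, Prod.mk.injEq, true_and, ContinuousMap.ext_iff]
  refine forall_congr' fun t => ?_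
  simp only [ContinuousMap.sub_apply, ContinuousMap.zero_apply, sub_sub, sub_eq_zero]
  rw [ContinuousMap.add_apply, key, constCurve_apply]

/-- Solving the radial equation `x' = B(x, t v) v`, `x(0) = a`, up to time `1` gives a function
of `(a, v)` which is smooth for small `v`: the inverse function theorem applies in the space of
curves, as the equation is trivial for `v = 0`. Since rescaling time replaces `v` by a multiple,
the solution `F (a, v)` at time `1` satisfies a differential equation along rays. -/
theorem exists_radial_solution [CompleteSpace X] [CompleteSpace V] {B : X × V → V →L[ℝ] X}
    (hB : ContDiff ℝ ∞ B) (x₀ : X) :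
    ∃ F : X × V → X, ∃ r > 0, ContDiffOn ℝ ∞ F (Metric.ball (x₀, 0) r) ∧
      (∀ a, (a, (0 : V)) ∈ Metric.ball (x₀, (0 : V)) r → F (a, 0) = a) ∧
      ∀ a v, (a, v) ∈ Metric.ball (x₀, (0 : V)) r →
        fderiv ℝ F (a, v) (0, v) = B (F (a, v), v) v := by
  set Ψ := radialDefect hB with hΨ
  have hsm : ContDiff ℝ ∞ Ψ := contDiff_radialDefect hB
  set q₀ : X × V := (x₀, 0)
  set u₀ : C(unitInterval, X) := constCurve X x₀
  have hp₀ : Ψ (q₀, u₀) = (q₀, 0) := by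
    rw [hΨ, radialDefect_eq_zero_iff]
    intro t; simp [q₀, u₀]
  -- the derivative of the defect at the trivial solution is triangular
  obtain ⟨K, hK⟩ : ∃ K : X × V →L[ℝ] C(unitInterval, X), HasFDerivAt Ψ
      (((ContinuousLinearEquiv.refl ℝ (X × V)).skewProd
        (ContinuousLinearEquiv.refl ℝ C(unitInterval, X)) K : _ ≃L[ℝ] _) :
        (X × V) × C(unitInterval, X) →L[ℝ] (X × V) × C(unitInterval, X)) (q₀, u₀) := by
    have hd : HasFDerivAt Ψ (fderiv ℝ Ψ (q₀, u₀)) (q₀, u₀) :=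
      (hsm.differentiable (by simp) _).hasFDerivAt
    refine ⟨(ContinuousLinearMap.snd ℝ _ _ ∘L fderiv ℝ Ψ (q₀, u₀)) ∘L
      ContinuousLinearMap.inl ℝ _ _, ?_⟩
    convert hd using 1
    have h1 : ContinuousLinearMap.fst ℝ (X × V) C(unitInterval, X) ∘L fderiv ℝ Ψ (q₀, u₀) =
        ContinuousLinearMap.fst ℝ _ _ := by
      have h2 := hd.fst
      exact h2.unique (hasFDerivAt_fst)
    have h3 : fderiv ℝ Ψ (q₀, u₀) ∘L ContinuousLinearMap.inr ℝ _ _ =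
        ContinuousLinearMap.inr ℝ _ _ := by
      have h4 : HasFDerivAt (fun u : C(unitInterval, X) => Ψ (q₀, u))
          (fderiv ℝ Ψ (q₀, u₀) ∘L ContinuousLinearMap.inr ℝ _ _) u₀ :=
        hd.comp u₀ (hasFDerivAt_prodMk_right q₀ u₀)
      have h5 : (fun u : C(unitInterval, X) => Ψ (q₀, u)) = fun u => (q₀, u - constCurve X x₀) := by
        funext u
        refine Prod.ext rfl ?_
        ext t
        simp [hΨ, radialDefect, volterra_apply, radialField, graphCurve, q₀]
      rw [h5] at h4
      refine h4.unique ?_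
      exact (hasFDerivAt_const q₀ u₀).prodMk ((hasFDerivAt_id u₀).sub_const _)
    refine ContinuousLinearMap.ext fun p => ?_
    have h6 : p = (p.1, 0) + (0, p.2) := by simp
    have h7 : fderiv ℝ Ψ (q₀, u₀) (0, p.2) = (0, p.2) := DFunLike.congr_fun h3 p.2
    have h8 : (fderiv ℝ Ψ (q₀, u₀) (p.1, 0)).1 = p.1 := DFunLike.congr_fun h1 (p.1, 0)
    have h9 : fderiv ℝ Ψ (q₀, u₀) p = fderiv ℝ Ψ (q₀, u₀) (p.1, 0) + (0, p.2) := by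
      rw [← h7, ← map_add, Prod.mk_add_mk, add_zero, zero_add]
    rw [h9]
    refine Prod.ext ?_ ?_
    · simp [h8]
    · simp [add_comm]
  set e := hsm.contDiffAt.toOpenPartialHomeomorph Ψ hK (by simp) with he
  have heΨ : ∀ p, e p = Ψ p := fun p => rfl
  have hmem : (q₀, u₀) ∈ e.source := hsm.contDiffAt.mem_toOpenPartialHomeomorph_source hK (by simp)
  set O := fderiv ℝ Ψ ⁻¹' range (ContinuousLinearEquiv.toContinuousLinearMap (σ₁₂ := .id ℝ)) with hO
  have hOo : IsOpen O := ContinuousLinearEquiv.isOpen.preimage (hsm.continuous_fderiv (by simp))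
  have hO0 : (q₀, u₀) ∈ O := by rw [hO, mem_preimage, hK.fderiv]; exact mem_range_self _
  set T := e.target ∩ e.symm ⁻¹' O with hT
  have hTo : IsOpen T := e.isOpen_inter_preimage_symm hOo
  have hTs : ∀ b ∈ T, ContDiffAt ℝ ∞ e.symm b := by
    rintro b ⟨hb, hb'⟩
    obtain ⟨f', hf'⟩ := hb'
    refine e.contDiffAt_symm (f₀' := f') hb ?_ hsm.contDiffAt
    rw [hf']
    exact (hsm.differentiable (by simp) _).hasFDerivAt
  have hsymm0 : e.symm (q₀, 0) = (q₀, u₀) := by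
    rw [← hp₀, ← heΨ]; exact e.left_inv hmem
  have hT0 : (q₀, 0) ∈ T := by
    refine ⟨?_, ?_⟩
    · rw [← hp₀, ← heΨ]; exact e.map_source hmem
    · rw [mem_preimage, hsymm0]; exact hO0
  set u : X × V → C(unitInterval, X) := fun q => (e.symm (q, 0)).2 with hu
  have hu_sm : ∀ q, (q, 0) ∈ T → ContDiffAt ℝ ∞ u q := fun q hq =>
    ((hTs _ hq).comp q (contDiffAt_id.prodMk contDiffAt_const)).snd
  obtain ⟨ρ, hρ, hρs⟩ := Metric.isOpen_iff.1 e.open_source _ hmem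
  have hnear : ∀ᶠ q in 𝓝 q₀, (q, 0) ∈ T ∧ u q ∈ Metric.ball u₀ ρ := by
    refine Filter.Eventually.and ?_ ?_
    · exact (continuous_id.prodMk continuous_const).continuousAt.preimage_mem_nhds
        (hTo.mem_nhds hT0)
    · refine (hu_sm q₀ hT0).continuousAt.preimage_mem_nhds ?_
      have : u q₀ = u₀ := by simp [hu, hsymm0]
      rw [this]
      exact Metric.ball_mem_nhds _ hρ
  obtain ⟨r', hr', hball'⟩ := Metric.eventually_nhds_iff_ball.1 hnear
  set r := min r' ρ
  have hr : 0 < r := lt_min hr' hρ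
  have hball : ∀ q ∈ Metric.ball q₀ r, (q, 0) ∈ T ∧ u q ∈ Metric.ball u₀ ρ := fun q hq =>
    hball' q (Metric.ball_subset_ball (min_le_left _ _) hq)
  have hsym : ∀ q ∈ Metric.ball q₀ r, e.symm (q, 0) = (q, u q) := by
    intro q hq
    have := e.right_inv (hball q hq).1.1
    have h1 : (e (e.symm (q, 0))).1 = q := by rw [this]
    exact Prod.ext h1 rfl
  have hsol : ∀ q ∈ Metric.ball q₀ r, Ψ (q, u q) = (q, 0) := by
    intro q hq
    rw [← hsym q hq]
    exact e.right_inv (hball q hq).1.1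
  have hsmul : ∀ (s : unitInterval) (a : X) (v : V), (a, v) ∈ Metric.ball q₀ r →
      (a, (s : ℝ) • v) ∈ Metric.ball q₀ r := by
    intro s a v h
    rw [mem_ball_iff_norm, Prod.norm_def, max_lt_iff] at h ⊢
    refine ⟨h.1, ?_⟩
    have h2 : ‖v‖ < r := by simpa [q₀] using h.2
    have h3 : ‖(s : ℝ) • v‖ ≤ ‖v‖ := by
      rw [norm_smul, Real.norm_of_nonneg s.2.1]
      exact mul_le_of_le_one_left (norm_nonneg _) s.2.2
    simpa [q₀] using h3.trans_lt h2
  -- rescaling time in a solution gives the solution with rescaled parameter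
  have hscale : ∀ (s : unitInterval) (a : X) (v : V), (a, v) ∈ Metric.ball q₀ r →
      u (a, (s : ℝ) • v) 1 = u (a, v) s := by
    intro s a v h
    set m : C(unitInterval, unitInterval) := ⟨fun t => s * t, by fun_prop⟩
    set w : C(unitInterval, X) := (u (a, v)).comp m
    have hq := hsmul s a v h
    have hw : ((a, (s : ℝ) • v), w) ∈ e.source := by
      apply hρs
      rw [← ball_prod_same]
      refine ⟨Metric.ball_subset_ball (min_le_right _ _) hq, ?_⟩
      have h1 := (hball _ h).2
      rw [Metric.mem_ball, ContinuousMap.dist_lt_iff hρ] at h1 ⊢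
      intro t
      exact h1 (m t)
    have hw' : Ψ ((a, (s : ℝ) • v), w) = ((a, (s : ℝ) • v), 0) := by
      rw [hΨ, radialDefect_eq_zero_iff]
      intro t
      have h1 := (radialDefect_eq_zero_iff hB (a, v) (u (a, v))).1 (hsol _ h) (m t)
      have h2 : w t = u (a, v) (m t) := rfl
      rw [h2, h1]
      congr 1
      simp only
      set f : ℝ → X := fun τ => B (u (a, v) (projIcc 0 1 zero_le_one τ), τ • v) v
      have h3 := intervalIntegral.smul_integral_comp_mul_left (a := 0) (b := (t : ℝ)) f (s : ℝ)
      rw [mul_zero] at h3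
      have h4 : ((m t : unitInterval) : ℝ) = (s : ℝ) * t := rfl
      rw [h4, ← h3, ← intervalIntegral.integral_smul]
      refine intervalIntegral.integral_congr fun τ hτ => ?_
      rw [uIcc_of_le t.2.1] at hτ
      have hτ' : τ ∈ Icc (0 : ℝ) 1 := ⟨hτ.1, hτ.2.trans t.2.2⟩
      have h5 : (s : ℝ) * τ ∈ Icc (0 : ℝ) 1 :=
        ⟨mul_nonneg s.2.1 hτ'.1, mul_le_one₀ s.2.2 hτ'.1 hτ'.2⟩
      have h6 : w (projIcc 0 1 zero_le_one τ) = u (a, v) (projIcc 0 1 zero_le_one (s * τ)) := by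
        rw [projIcc_of_mem _ hτ', projIcc_of_mem _ h5]; rfl
      simp only [f, h6, map_smul, smul_smul, mul_comm τ]
    have hinj := e.injOn hw (by
      have := e.map_target (hball _ hq).1.1
      rwa [hsym _ hq] at this) (hw'.trans (hsol _ hq).symm)
    have h7 : w = u (a, (s : ℝ) • v) := congrArg Prod.snd hinj
    rw [← h7]
    change u (a, v) (s * 1) = _
    rw [mul_one]
  have hFd : ∀ q ∈ Metric.ball q₀ r, ContDiffAt ℝ ∞ (fun q => u q 1) q := fun q hq =>
    (ContinuousMap.evalCLM ℝ (M := X) (1 : unitInterval)).contDiff.contDiffAt.comp q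
      (hu_sm q (hball q hq).1)
  refine ⟨fun q => u q 1, r, hr, fun q hq => (hFd q hq).contDiffWithinAt, ?_, ?_⟩
  · intro a ha
    have h1 := (radialDefect_eq_zero_iff hB (a, 0) (u (a, 0))).1 (hsol _ ha) 1
    simpa using h1
  · intro a v h
    -- the equality holds on `[0, 1]`, which determines the derivative at the end point `1`
    have h1 : HasDerivAt (fun s : ℝ => u (a, s • v) 1)
        (fderiv ℝ (fun q => u q 1) (a, v) (0, v)) 1 := by
      have h2 : HasDerivAt (fun s : ℝ => (a, s • v)) (0, v) 1 := by
        have := (hasDerivAt_const (1 : ℝ) a).prodMk ((hasDerivAt_id (1 : ℝ)).smul_const v)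
        simpa using this
      have h3 : HasFDerivAt (fun q => u q 1) (fderiv ℝ (fun q => u q 1) (a, v))
          (a, (1 : ℝ) • v) := by
        rw [one_smul]
        exact ((hFd _ h).differentiableAt (by simp)).hasFDerivAt
      exact h3.comp_hasDerivAt (1 : ℝ) h2
    set f : ℝ → X := fun τ => B (u (a, v) (projIcc 0 1 zero_le_one τ), τ • v) v with hf
    have hfc : Continuous f := by
      have h4 : Continuous fun τ => u (a, v) (projIcc 0 1 zero_le_one τ) :=
        (u (a, v)).continuous.comp continuous_projIcc
      exact (hB.continuous.comp (h4.prodMk (by fun_prop))).clm_apply continuous_const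
    have h5 : HasDerivAt (fun t : ℝ => a + ∫ s in (0 : ℝ)..t, f s) (f 1) 1 :=
      (intervalIntegral.integral_hasDerivAt_right (hfc.intervalIntegrable _ _)
        (hfc.stronglyMeasurableAtFilter _ _) hfc.continuousAt).const_add a
    have h6 : EqOn (fun s : ℝ => u (a, s • v) 1) (fun t : ℝ => a + ∫ s in (0 : ℝ)..t, f s)
        (Icc 0 1) := by
      intro s hs
      have h7 := (radialDefect_eq_zero_iff hB (a, v) (u (a, v))).1 (hsol _ h) ⟨s, hs⟩
      exact (hscale ⟨s, hs⟩ a v h).trans h7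
    have h8 := (h5.hasDerivWithinAt (s := Icc 0 1)).congr h6 (h6 (by simp))
    have h9 := (uniqueDiffOn_Icc (zero_lt_one' ℝ)) 1 (by simp)
    have h10 := h9.eq_deriv _ (h1.hasDerivWithinAt (s := Icc 0 1)) h8
    rw [h10]
    simp [hf]

end RadialODE

/-! ### Integrable distributions given as graphs -/

section Frobenius

universe u

/-- The germ of a smooth function on an open set extends to the whole space, by a bump function. -/
lemma exists_contDiff_eventuallyEq {E F : Type*} [NormedAddCommGroup E] [NormedSpace ℝ E]
    [FiniteDimensional ℝ E] [NormedAddCommGroup F] [NormedSpace ℝ F] {f : E → F} {U : Set E}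
    (hU : IsOpen U) (hf : ContDiffOn ℝ ∞ f U) {x : E} (hx : x ∈ U) :
    ∃ g : E → F, ContDiff ℝ ∞ g ∧ g =ᶠ[𝓝 x] f := by
  obtain ⟨ε, hε, hεU⟩ := Metric.isOpen_iff.1 hU x hx
  let φ : ContDiffBump x := ⟨ε / 4, ε / 2, by positivity, by linarith⟩
  refine ⟨fun y => φ y • f y, ?_, ?_⟩
  · rw [contDiff_iff_contDiffAt]
    intro y
    by_cases hy : y ∈ Metric.ball x ε
    · exact φ.contDiff.contDiffAt.smul (hf.contDiffAt (hU.mem_nhds (hεU hy)))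
    · have hy' : y ∈ (tsupport φ)ᶜ := by
        rw [φ.tsupport_eq, mem_compl_iff, Metric.mem_closedBall]
        rw [Metric.mem_ball] at hy
        have : φ.rOut = ε / 2 := rfl
        linarith
      have h0 : (fun y => φ y • f y) =ᶠ[𝓝 y] fun _ => 0 := by
        filter_upwards [(isClosed_tsupport φ).isOpen_compl.mem_nhds hy'] with z hz
        rw [image_eq_zero_of_notMem_tsupport hz, zero_smul]
      exact contDiffAt_const.congr_of_eventuallyEq h0
  · filter_upwards [φ.eventuallyEq_one] with y hy
    simp [hy]

/-- A smooth version of the inverse function theorem, in which the inverse is known to be smooth on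
a whole neighbourhood. -/
lemma exists_smooth_localInverse {E F : Type*} [NormedAddCommGroup E] [NormedSpace ℝ E]
    [CompleteSpace E] [NormedAddCommGroup F] [NormedSpace ℝ F] {f : E → F} {U : Set E}
    (hU : IsOpen U) (hf : ContDiffOn ℝ ∞ f U) {a : E} (ha : a ∈ U) (f' : E ≃L[ℝ] F)
    (hf' : HasFDerivAt f (f' : E →L[ℝ] F) a) :
    ∃ e : OpenPartialHomeomorph E F, a ∈ e.source ∧ e.source ⊆ U ∧ (∀ x, e x = f x) ∧
      ContDiffOn ℝ ∞ e.symm e.target := by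
  have hfa : ContDiffAt ℝ ∞ f a := hf.contDiffAt (hU.mem_nhds ha)
  set e₀ := hfa.toOpenPartialHomeomorph f hf' (by simp)
  have he₀ : ∀ x, e₀ x = f x := fun x => rfl
  have hmem : a ∈ e₀.source := hfa.mem_toOpenPartialHomeomorph_source hf' (by simp)
  set O := U ∩ fderiv ℝ f ⁻¹' range (ContinuousLinearEquiv.toContinuousLinearMap
    (σ₁₂ := .id ℝ)) with hO
  have hOo : IsOpen O := (hf.continuousOn_fderiv_of_isOpen hU (by simp)).isOpen_inter_preimage hU
    ContinuousLinearEquiv.isOpen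
  have haO : a ∈ O := ⟨ha, by rw [mem_preimage, hf'.fderiv]; exact mem_range_self _⟩
  refine ⟨e₀.restrOpen O hOo, ⟨hmem, haO⟩, fun x hx => hx.2.1, fun x => rfl, ?_⟩
  intro b hb
  rw [OpenPartialHomeomorph.restrOpen_toPartialEquiv, PartialEquiv.restr_target] at hb
  obtain ⟨hb1, hb2, g', hg'⟩ := hb
  have hc : ContDiffAt ℝ ∞ f (e₀.symm b) := hf.contDiffAt (hU.mem_nhds hb2)
  refine (e₀.contDiffAt_symm (f₀' := g') hb1 ?_ hc).contDiffWithinAt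
  rw [hg']
  exact (hc.differentiableAt (by simp)).hasFDerivAt

/-- A solution of a linear differential equation which vanishes at the left end of an interval
vanishes on the interval. -/
lemma eq_zero_of_linear_ode {X : Type*} [NormedAddCommGroup X] [NormedSpace ℝ X]
    {L : ℝ → X →L[ℝ] X} {ξ : ℝ → X} {a b : ℝ} (hL : ContinuousOn L (Icc a b))
    (hξ : ∀ t ∈ Icc a b, HasDerivAt ξ (L t (ξ t)) t) (h0 : ξ a = 0) :
    ∀ t ∈ Icc a b, ξ t = 0 := by
  obtain ⟨K, hK⟩ := isCompact_Icc.exists_bound_of_continuousOn hL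
  exact eq_zero_of_abs_deriv_le_mul_abs_self_of_eq_zero_right (f' := fun t => L t (ξ t)) (K := K)
    (fun t ht => (hξ t ht).continuousAt.continuousWithinAt)
    (fun t ht => (hξ t ⟨ht.1, ht.2.le⟩).hasDerivWithinAt) h0
    (fun t ht => ((L t).le_opNorm _).trans
      (mul_le_mul_of_nonneg_right (hK t ⟨ht.1, ht.2.le⟩) (norm_nonneg _)))

variable {X W : Type u} [NormedAddCommGroup X] [NormedSpace ℝ X]
  [NormedAddCommGroup W] [NormedSpace ℝ W]

/-- The leaf through `(a, 0)`, obtained by solving the radial equation, is tangent to the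
distribution: by integrability, the defect satisfies a linear differential equation along rays. -/
lemma fderiv_radial_solution {B : X × W → W →L[ℝ] X} (hB : ContDiff ℝ ∞ B) {F : X × W → X}
    {a : X} {O : Set W} (hF : ∀ v ∈ O, ContDiffAt ℝ ∞ F (a, v)) (hO : IsOpen O)
    (hrad : ∀ v ∈ O, fderiv ℝ F (a, v) (0, v) = B (F (a, v), v) v)
    (hint : ∀ v ∈ O, ∀ w₁ w₂, fderiv ℝ B (F (a, v), v) (B (F (a, v), v) w₁, w₁) w₂ =
      fderiv ℝ B (F (a, v), v) (B (F (a, v), v) w₂, w₂) w₁)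
    {v : W} (hv : ∀ s ∈ Icc (0 : ℝ) 1, s • v ∈ O) (k : W) :
    fderiv ℝ F (a, v) (0, k) = B (F (a, v), v) k := by
  set j : W →L[ℝ] X × W := ContinuousLinearMap.inr ℝ X W
  set f : W → X := fun v => F (a, v) with hf
  have hfs : ∀ v ∈ O, ContDiffAt ℝ ∞ f v := fun v hv =>
    (hF v hv).comp v (contDiffAt_const.prodMk contDiffAt_id)
  have hfd : ∀ v ∈ O, ∀ k, fderiv ℝ F (a, v) (0, k) = fderiv ℝ f v k := by
    intro v hv k
    have h1 : HasFDerivAt f (fderiv ℝ F (a, v) ∘L j) v :=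
      ((hF v hv).differentiableAt (by simp)).hasFDerivAt.comp v (hasFDerivAt_prodMk_right a v)
    rw [h1.fderiv]; rfl
  have hf2 : ∀ v ∈ O, HasFDerivAt (fderiv ℝ f) (fderiv ℝ (fderiv ℝ f) v) v := fun v hv =>
    (((hfs v hv).fderiv_right (m := 1) (by norm_cast)).differentiableAt (by simp)).hasFDerivAt
  have hBd : ∀ z, HasFDerivAt B (fderiv ℝ B z) z := fun z =>
    (hB.differentiable (by simp) z).hasFDerivAt
  have hgr : ∀ v ∈ O, HasFDerivAt (fun v => (f v, v))
      ((fderiv ℝ f v).prod (ContinuousLinearMap.id ℝ W)) v := fun v hv =>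
    ((hfs v hv).differentiableAt (by simp)).hasFDerivAt.prodMk (hasFDerivAt_id v)
  have hBf : ∀ v ∈ O, HasFDerivAt (fun v => B (f v, v))
      (fderiv ℝ B (f v, v) ∘L ((fderiv ℝ f v).prod (ContinuousLinearMap.id ℝ W))) v :=
    fun v hv => (hBd (f v, v)).comp (f := fun v => (f v, v)) v (hgr v hv)
  -- differentiating the radial equation
  have hrad' : ∀ v ∈ O, ∀ k, fderiv ℝ (fderiv ℝ f) v k v + fderiv ℝ f v k =
      fderiv ℝ B (f v, v) (fderiv ℝ f v k, k) v + B (f v, v) k := by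
    intro v hv k
    have h1 := (hf2 v hv).clm_apply (hasFDerivAt_id v)
    have h2 := (hBf v hv).clm_apply (hasFDerivAt_id v)
    have h3 : (fun v => fderiv ℝ f v (id v)) =ᶠ[𝓝 v] fun v => B (f v, v) (id v) := by
      filter_upwards [hO.mem_nhds hv] with w hw
      rw [id, ← hfd w hw, hrad w hw]
    have h4 := DFunLike.congr_fun (h1.unique (h2.congr_of_eventuallyEq h3)) k
    simp only [add_apply, ContinuousLinearMap.comp_apply,
      ContinuousLinearMap.flip_apply, ContinuousLinearMap.id_apply, id,
      ContinuousLinearMap.prod_apply] at h4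
    rw [add_comm, h4, add_comm]
  have hsymm : ∀ v ∈ O, ∀ k l, fderiv ℝ (fderiv ℝ f) v k l = fderiv ℝ (fderiv ℝ f) v l k :=
    fun v hv k l => ((hfs v hv).isSymmSndFDerivAt (by
      rw [minSmoothness_of_isRCLikeNormedField]; exact WithTop.coe_le_coe.2 le_top)).eq k l
  have hmem1 : v ∈ O := by simpa using hv 1 (by simp)
  -- the defect of tangency along the ray; the factor `s` makes it vanish at the origin
  set ξ : ℝ → X := fun s => s • (fderiv ℝ f (s • v) k - B (f (s • v), s • v) k) with hξ
  set L : ℝ → X →L[ℝ] X := fun s =>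
    (ContinuousLinearMap.apply ℝ X v) ∘L fderiv ℝ B (f (s • v), s • v) ∘L
      ContinuousLinearMap.inl ℝ X W with hL
  have hline : ∀ s : ℝ, HasDerivAt (fun s : ℝ => s • v) v s := fun s => by
    simpa using (hasDerivAt_id s).smul_const v
  have hzero := eq_zero_of_linear_ode (L := L) (ξ := ξ) (a := 0) (b := 1) ?_ ?_ (by simp [hξ])
    1 (by simp)
  · rw [hfd v hmem1]
    simpa [hξ, sub_eq_zero] using hzero
  · intro s hs
    have hc : ContinuousAt (fun s : ℝ => fderiv ℝ B (f (s • v), s • v)) s := by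
      have h1 : ContinuousAt (fun s : ℝ => (f (s • v), s • v)) s :=
        ((hgr _ (hv s hs)).continuousAt).comp (f := fun s : ℝ => s • v) (hline s).continuousAt
      exact (hB.continuous_fderiv (by simp)).continuousAt.comp
        (f := fun s : ℝ => (f (s • v), s • v)) h1
    have : ContinuousAt L s := by
      refine continuousAt_const.clm_comp (hc.clm_comp continuousAt_const)
    exact this.continuousWithinAt
  · intro s hs
    have hm := hv s hs
    have h1 : HasDerivAt (fun s : ℝ => fderiv ℝ f (s • v) k)
        (fderiv ℝ (fderiv ℝ f) (s • v) v k) s :=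
      (ContinuousLinearMap.apply ℝ X k).hasFDerivAt.comp_hasDerivAt s
        ((hf2 _ hm).comp_hasDerivAt s (hline s))
    have h2 : HasDerivAt (fun s : ℝ => B (f (s • v), s • v) k)
        (fderiv ℝ B (f (s • v), s • v) (fderiv ℝ f (s • v) v, v) k) s :=
      (ContinuousLinearMap.apply ℝ X k).hasFDerivAt.comp_hasDerivAt s
        (HasFDerivAt.comp_hasDerivAt (l := fun v => B (f v, v)) s (hBf _ hm) (hline s))
    have h3 := (hasDerivAt_id s).smul (h1.sub h2)
    refine (h3.congr_deriv ?_)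
    set w := s • v with hw
    have e1 : s • fderiv ℝ (fderiv ℝ f) w v k =
        fderiv ℝ B (f w, w) (fderiv ℝ f w k, k) w + B (f w, w) k - fderiv ℝ f w k := by
      rw [← hrad' w hm k, add_sub_cancel_right, hsymm w hm v k, hw, map_smul]
    have e2 : s • fderiv ℝ B (f w, w) (fderiv ℝ f w v, v) k =
        fderiv ℝ B (f w, w) (B (f w, w) k, k) w := by
      rw [hint w hm k w, ← hrad w hm, hfd w hm w, ← smul_apply, ← map_smul]
      congr 2
      simp [hw]
    have e3 : L s (ξ s) = fderiv ℝ B (f w, w) (fderiv ℝ f w k, k) w -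
        fderiv ℝ B (f w, w) (B (f w, w) k, k) w := by
      have : L s (ξ s) = fderiv ℝ B (f w, w) (fderiv ℝ f w k - B (f w, w) k, 0) w := by
        simp only [hL, hξ, ContinuousLinearMap.comp_apply, ContinuousLinearMap.apply_apply,
          ContinuousLinearMap.inl_apply, ← hw]
        rw [hw, map_smul, ← hw, ← smul_apply, ← map_smul, Prod.smul_mk,
          smul_zero]
      have h4 : (fderiv ℝ f w k - B (f w, w) k, (0 : W)) =
          (fderiv ℝ f w k, k) - (B (f w, w) k, k) := by simp
      rw [this, h4, map_sub, sub_apply]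
    simp only [id, one_smul, smul_sub, e1, e2, e3, Pi.sub_apply]
    abel

variable [FiniteDimensional ℝ X] [FiniteDimensional ℝ W]

/-- **Frobenius theorem** for a distribution which is the graph of a family of linear maps
`A z : W → X`: if it is integrable, it is the kernel of the differential of a smooth map. -/
theorem exists_frobenius {A : X × W → W →L[ℝ] X} {U : Set (X × W)} (hU : IsOpen U)
    (hA : ContDiffOn ℝ ∞ A U) {z₀ : X × W} (hz₀ : z₀ ∈ U)
    (hint : ∀ z ∈ U, ∀ w₁ w₂, fderiv ℝ A z (A z w₁, w₁) w₂ = fderiv ℝ A z (A z w₂, w₂) w₁) :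
    ∃ p : X × W → X, ∃ U' ⊆ U, IsOpen U' ∧ z₀ ∈ U' ∧ ContDiffOn ℝ ∞ p U' ∧
      ∀ z ∈ U', ∀ k : X × W, fderiv ℝ p z k = 0 ↔ k.1 = A z k.2 := by
  obtain ⟨x₀, w₀⟩ := z₀
  set τ : X × W → X × W := fun z => (z.1, z.2 + w₀) with hτ
  have hτs : ContDiff ℝ ∞ τ := by fun_prop
  have hτd : ∀ z, HasFDerivAt τ (ContinuousLinearMap.id ℝ (X × W)) z := fun z => by
    have : τ = fun z => z + (0, w₀) := by funext z; simp [hτ, Prod.ext_iff]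
    rw [this]
    exact (hasFDerivAt_id z).add_const _
  obtain ⟨B, hB, hBA⟩ := exists_contDiff_eventuallyEq (hU.preimage hτs.continuous)
    (hA.comp hτs.contDiffOn (fun z hz => hz)) (x := (x₀, (0 : W))) (by simpa [hτ] using hz₀)
  obtain ⟨F, r, hr, hF, hF0, hrad⟩ := exists_radial_solution hB x₀
  have hFat : ∀ z ∈ Metric.ball (x₀, (0 : W)) r, ContDiffAt ℝ ∞ F z := fun z hz =>
    hF.contDiffAt (Metric.isOpen_ball.mem_nhds hz)
  have hc : (x₀, (0 : W)) ∈ Metric.ball (x₀, (0 : W)) r := Metric.mem_ball_self hr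
  -- a ball on which the local solution stays where `B` is the translate of `A`
  have hev : ∀ᶠ z in 𝓝 (x₀, (0 : W)), (B =ᶠ[𝓝 (F z, z.2)] A ∘ τ) ∧ τ (F z, z.2) ∈ U := by
    have h1 : ContinuousAt (fun z : X × W => (F z, z.2)) (x₀, 0) :=
      (hFat _ hc).continuousAt.prodMk continuousAt_snd
    have h2 : (F (x₀, 0), (x₀, (0 : W)).2) = (x₀, (0 : W)) := by rw [hF0 _ hc]
    refine Filter.Eventually.and ?_ ?_
    · refine h1.eventually (p := fun z => B =ᶠ[𝓝 z] A ∘ τ) ?_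
      change ∀ᶠ z in 𝓝 (F (x₀, 0), (x₀, (0 : W)).2), B =ᶠ[𝓝 z] A ∘ τ
      rw [h2]
      exact eventually_eventually_nhds.2 hBA
    · refine h1.eventually (p := fun z => τ z ∈ U) ?_
      change ∀ᶠ z in 𝓝 (F (x₀, 0), (x₀, (0 : W)).2), τ z ∈ U
      rw [h2]
      exact (hU.preimage hτs.continuous).mem_nhds (by simpa [hτ] using hz₀)
  obtain ⟨r₁, hr₁, hball₁⟩ := Metric.eventually_nhds_iff_ball.1 hev
  set r₂ := min r r₁
  have hr₂ : 0 < r₂ := lt_min hr hr₁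
  have hsub : Metric.ball (x₀, (0 : W)) r₂ ⊆ Metric.ball (x₀, (0 : W)) r :=
    Metric.ball_subset_ball (min_le_left _ _)
  have hball : ∀ z ∈ Metric.ball (x₀, (0 : W)) r₂,
      (B =ᶠ[𝓝 (F z, z.2)] A ∘ τ) ∧ τ (F z, z.2) ∈ U := fun z hz =>
    hball₁ z (Metric.ball_subset_ball (min_le_right _ _) hz)
  have hleaf : ∀ a v, (a, v) ∈ Metric.ball (x₀, (0 : W)) r₂ → ∀ k,
      fderiv ℝ F (a, v) (0, k) = B (F (a, v), v) k := by
    intro a v hav k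
    have hO : IsOpen {v : W | (a, v) ∈ Metric.ball (x₀, (0 : W)) r₂} :=
      Metric.isOpen_ball.preimage (by fun_prop)
    refine fderiv_radial_solution hB (O := {v | (a, v) ∈ Metric.ball (x₀, (0 : W)) r₂})
      (fun v hv => hFat _ (hsub hv)) hO (fun v hv => hrad a v (hsub hv)) ?_ ?_ k
    · intro v hv w₁ w₂
      obtain ⟨h1, h2⟩ := hball _ hv
      have h3 : B (F (a, v), v) = A (τ (F (a, v), v)) := h1.self_of_nhds
      have h4 : fderiv ℝ B (F (a, v), v) = fderiv ℝ A (τ (F (a, v), v)) := by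
        rw [h1.fderiv_eq]
        have h5 : HasFDerivAt A (fderiv ℝ A (τ (F (a, v), v))) (τ (F (a, v), v)) :=
          ((hA.contDiffAt (hU.mem_nhds h2)).differentiableAt (by simp)).hasFDerivAt
        exact (h5.comp _ (hτd _)).fderiv
      rw [h3, h4]
      exact hint _ h2 w₁ w₂
    · intro s hs
      rw [mem_ofPred_eq, mem_ball_iff_norm, Prod.norm_def, max_lt_iff] at *
      refine ⟨hav.1, ?_⟩
      have h2 : ‖v‖ < r₂ := by simpa using hav.2
      have h3 : ‖s • v‖ ≤ ‖v‖ := by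
        rw [norm_smul, Real.norm_of_nonneg hs.1]
        exact mul_le_of_le_one_left (norm_nonneg _) hs.2
      simpa using h3.trans_lt h2
  set G : X × W → X × W := fun z => τ (F z, z.2) with hG
  have hGs : ContDiffOn ℝ ∞ G (Metric.ball (x₀, (0 : W)) r₂) :=
    hτs.comp_contDiffOn ((hF.mono hsub).prodMk contDiffOn_snd)
  have hGd : ∀ z ∈ Metric.ball (x₀, (0 : W)) r₂, HasFDerivAt G
      ((fderiv ℝ F z).prod (ContinuousLinearMap.snd ℝ X W)) z := fun z hz => by
    have h1 : HasFDerivAt F (fderiv ℝ F z) z :=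
      ((hFat z (hsub hz)).differentiableAt (by simp)).hasFDerivAt
    exact (hτd _).comp z (h1.prodMk hasFDerivAt_snd)
  have hc₂ : (x₀, (0 : W)) ∈ Metric.ball (x₀, (0 : W)) r₂ := Metric.mem_ball_self hr₂
  -- the differential of `G` at the centre is unipotent
  have hF1 : ∀ α, fderiv ℝ F (x₀, 0) (α, 0) = α := by
    intro α
    have h1 : HasFDerivAt (fun a => F (a, 0))
        (fderiv ℝ F (x₀, 0) ∘L ContinuousLinearMap.inl ℝ X W) x₀ :=
      ((hFat _ hc).differentiableAt (by simp)).hasFDerivAt.comp x₀ (hasFDerivAt_prodMk_left x₀ 0)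
    have h2 : (fun a => F (a, 0)) =ᶠ[𝓝 x₀] id := by
      have : ContinuousAt (fun a : X => (a, (0 : W))) x₀ := by fun_prop
      filter_upwards [this.preimage_mem_nhds (Metric.isOpen_ball.mem_nhds hc)] with a ha
      exact hF0 a ha
    have h3 := h1.unique ((hasFDerivAt_id x₀).congr_of_eventuallyEq h2)
    exact DFunLike.congr_fun h3 α
  set K : W →L[ℝ] X := fderiv ℝ F (x₀, 0) ∘L ContinuousLinearMap.inr ℝ X W
  have hFK : ∀ p : X × W, fderiv ℝ F (x₀, 0) p = p.1 + K p.2 := by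
    intro p
    have : p = (p.1, 0) + (0, p.2) := by simp
    conv_lhs => rw [this, map_add, hF1]
    rfl
  let G' : (X × W) ≃L[ℝ] (X × W) := ContinuousLinearEquiv.equivOfInverse
    ((ContinuousLinearMap.fst ℝ X W + K ∘L ContinuousLinearMap.snd ℝ X W).prod
      (ContinuousLinearMap.snd ℝ X W))
    ((ContinuousLinearMap.fst ℝ X W - K ∘L ContinuousLinearMap.snd ℝ X W).prod
      (ContinuousLinearMap.snd ℝ X W))
    (fun p => by simp) (fun p => by simp)
  have hG' : HasFDerivAt G (G' : (X × W) →L[ℝ] (X × W)) (x₀, 0) := by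
    refine (hGd _ hc₂).congr_fderiv (ContinuousLinearMap.ext fun p => ?_)
    exact Prod.ext (hFK p) rfl
  obtain ⟨e, he0, hes, heG, hesymm⟩ := exists_smooth_localInverse Metric.isOpen_ball hGs hc₂ G' hG'
  refine ⟨fun z => (e.symm z).1, e.target, ?_, e.open_target, ?_, ?_, ?_⟩
  · intro z hz
    have := (hball _ (hes (e.map_target hz))).2
    have h1 : G (e.symm z) = z := by rw [← heG, e.right_inv hz]
    rw [← h1]; exact this
  · have h1 := e.map_source he0
    rw [heG] at h1
    simpa [hG, hτ, hF0 _ hc] using h1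
  · exact contDiff_fst.comp_contDiffOn hesymm
  · intro z hz k
    set y := e.symm z with hy
    have hyb := hes (e.map_target hz)
    have hGy : G y = z := by rw [← heG, e.right_inv hz]
    have h1 : HasFDerivAt e.symm (fderiv ℝ e.symm z) z :=
      ((hesymm.contDiffAt (e.open_target.mem_nhds hz)).differentiableAt (by simp)).hasFDerivAt
    have h2 : fderiv ℝ (fun z => (e.symm z).1) z k = (fderiv ℝ e.symm z k).1 := by
      rw [(h1.fst).fderiv]; rfl
    have h3 := hGd y hyb
    -- the differentials of `e` and of its inverse are inverse to each other
    have h4 : ∀ k, ((fderiv ℝ F y (fderiv ℝ e.symm z k)), (fderiv ℝ e.symm z k).2) = k := by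
      have h5 : HasFDerivAt (fun z => G (e.symm z)) _ z := h3.comp z h1
      have h6 : (fun z => G (e.symm z)) =ᶠ[𝓝 z] id := by
        filter_upwards [e.open_target.mem_nhds hz] with w hw
        rw [← heG, e.right_inv hw]; rfl
      have h7 := h5.unique ((hasFDerivAt_id z).congr_of_eventuallyEq h6)
      exact fun k => DFunLike.congr_fun h7 k
    have h8 : ∀ p, fderiv ℝ e.symm z (fderiv ℝ F y p, p.2) = p := by
      rw [← hGy] at h1
      have h5 : HasFDerivAt (fun y => e.symm (G y)) _ y := h1.comp y h3
      have h6 : (fun y => e.symm (G y)) =ᶠ[𝓝 y] id := by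
        filter_upwards [e.open_source.mem_nhds (e.map_target hz)] with w hw
        rw [← heG, e.left_inv hw]; rfl
      have h7 := h5.unique ((hasFDerivAt_id y).congr_of_eventuallyEq h6)
      rw [hGy] at h7
      exact fun p => DFunLike.congr_fun h7 p
    have hAB : A z = B (F y, y.2) := by
      rw [(hball _ hyb).1.self_of_nhds]
      change A z = A (G y)
      rw [hGy]
    rw [h2, hAB]
    have hl := hleaf y.1 y.2 hyb
    constructor
    · intro h
      have h9 := h4 k
      have h10 : fderiv ℝ e.symm z k = (0, k.2) := Prod.ext h (by rw [← h9]; simp [h9])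
      rw [h10] at h9
      rw [← hl]
      exact (congrArg Prod.fst h9).symm
    · intro h
      have h9 := h8 (0, k.2)
      rw [hl, ← h] at h9
      exact congrArg Prod.fst h9

end Frobenius

/-! ### Vector fields in a chart -/

/-- A chart of `M` with values in an arbitrary normed space `F`: a diffeomorphism of an open subset
of `M` to an open subset of `F`. -/
structure SmoothChart {E : Type*} [NormedAddCommGroup E] [NormedSpace ℝ E]
    {H : Type*} [TopologicalSpace H] (I : ModelWithCorners ℝ E H)
    (M : Type*) [TopologicalSpace M] [ChartedSpace H M]
    (F : Type*) [NormedAddCommGroup F] [NormedSpace ℝ F] extends OpenPartialHomeomorph M F where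
  smooth : ContMDiffOn I 𝓘(ℝ, F) ∞ toOpenPartialHomeomorph toOpenPartialHomeomorph.source
  smooth_symm : ContMDiffOn 𝓘(ℝ, F) I ∞ toOpenPartialHomeomorph.symm
    toOpenPartialHomeomorph.target

namespace SmoothChart

variable {E : Type*} [NormedAddCommGroup E] [NormedSpace ℝ E]
  {H : Type*} [TopologicalSpace H] {I : ModelWithCorners ℝ E H}
  {M : Type*} [TopologicalSpace M] [ChartedSpace H M] [IsManifold I ∞ M]
  {F : Type*} [NormedAddCommGroup F] [NormedSpace ℝ F]

instance : CoeFun (SmoothChart I M F) fun _ => M → F := ⟨fun Φ => Φ.toOpenPartialHomeomorph⟩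

/-- The inverse of a chart. -/
abbrev inv (Φ : SmoothChart I M F) : F → M := Φ.toOpenPartialHomeomorph.symm

variable (Φ : SmoothChart I M F)

/-- The differential of a chart, as a map from the tangent space to the model. -/
def coframe (y : M) : TangentSpace I y →L[ℝ] F := mfderiv I 𝓘(ℝ, F) Φ y

/-- The inverse of the differential of a chart; it is a junk value outside the source. -/
def frame (y : M) : F →L[ℝ] TangentSpace I y := (Φ.coframe y).inverse

/-- The representative in a chart of a vector field. -/
def push (Y : (y : M) → TangentSpace I y) (p : F) : F := Φ.coframe (Φ.inv p) (Y (Φ.inv p))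

/-- The vector field with a given representative in a chart. -/
def pull (V : F → F) (y : M) : TangentSpace I y := Φ.frame y (V (Φ y))

variable {Φ}

lemma contMDiffAt {y : M} (hy : y ∈ Φ.source) : ContMDiffAt I 𝓘(ℝ, F) ∞ Φ y :=
  Φ.smooth.contMDiffAt (Φ.open_source.mem_nhds hy)

lemma contMDiffAt_inv {p : F} (hp : p ∈ Φ.target) : ContMDiffAt 𝓘(ℝ, F) I ∞ Φ.inv p :=
  Φ.smooth_symm.contMDiffAt (Φ.open_target.mem_nhds hp)

lemma mdifferentiable : Φ.toOpenPartialHomeomorph.MDifferentiable I 𝓘(ℝ, F) :=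
  ⟨Φ.smooth.mdifferentiableOn (by simp), Φ.smooth_symm.mdifferentiableOn (by simp)⟩

/-- The differential of a chart as a continuous linear equivalence. -/
def equivAt {y : M} (hy : y ∈ Φ.source) : TangentSpace I y ≃L[ℝ] F :=
  Φ.mdifferentiable.mfderiv hy

lemma coe_equivAt {y : M} (hy : y ∈ Φ.source) :
    (equivAt hy : TangentSpace I y →L[ℝ] F) = Φ.coframe y := rfl

lemma coe_equivAt_symm {y : M} (hy : y ∈ Φ.source) :
    ((equivAt hy).symm : F →L[ℝ] TangentSpace I y) = Φ.frame y := by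
  rw [frame, ← coe_equivAt hy, ContinuousLinearMap.inverse_equiv]

lemma coframe_frame {y : M} (hy : y ∈ Φ.source) (a : F) : Φ.coframe y (Φ.frame y a) = a := by
  rw [← coe_equivAt_symm hy]
  exact (equivAt hy).apply_symm_apply a

lemma frame_coframe {y : M} (hy : y ∈ Φ.source) (v : TangentSpace I y) :
    Φ.frame y (Φ.coframe y v) = v := by
  rw [← coe_equivAt_symm hy]
  exact (equivAt hy).symm_apply_apply v

lemma mfderiv_inv {p : F} (hp : p ∈ Φ.target) :
    (mfderiv 𝓘(ℝ, F) I Φ.inv p : F →L[ℝ] TangentSpace I (Φ.inv p)) = Φ.frame (Φ.inv p) := by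
  ext a
  have h1 := DFunLike.congr_fun (Φ.mdifferentiable.comp_symm_deriv hp) a
  have h2 : Φ.coframe (Φ.inv p) (mfderiv 𝓘(ℝ, F) I Φ.inv p a) = a := h1
  rw [← frame_coframe (Φ.map_target hp) (mfderiv 𝓘(ℝ, F) I Φ.inv p a), h2]
  rfl

lemma push_pull {p : F} (hp : p ∈ Φ.target) (V : F → F) : Φ.push (Φ.pull V) p = V p := by
  rw [push, pull, coframe_frame (Φ.map_target hp), Φ.right_inv hp]

lemma push_apply {y : M} (hy : y ∈ Φ.source) (Y : (y : M) → TangentSpace I y) :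
    Φ.push Y (Φ y) = Φ.coframe y (Y y) := by
  rw [push, show Φ.inv (Φ y) = y from Φ.left_inv hy]

/-- Reading a tangent vector in a chart is a smooth operation. -/
lemma contMDiffOn_coframe :
    ContMDiffOn I.tangent 𝓘(ℝ, F) ∞ (fun v : TangentBundle I M => Φ.coframe v.proj v.2)
      (π E (TangentSpace I) ⁻¹' Φ.source) := by
  have h1 := Φ.smooth.contMDiffOn_tangentMapWithin (m := ∞) (by simp)
    Φ.open_source.uniqueMDiffOn
  have h2 : ContMDiff 𝓘(ℝ, F).tangent 𝓘(ℝ, F) ∞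
      (fun v : TangentBundle 𝓘(ℝ, F) F => (v.2 : F)) :=
    contMDiff_snd_tangentBundle_modelSpace F 𝓘(ℝ, F)
  refine (h2.comp_contMDiffOn h1).congr fun v hv => ?_
  have h4 : mfderivWithin I 𝓘(ℝ, F) Φ Φ.source v.proj = mfderiv I 𝓘(ℝ, F) Φ v.proj :=
    mfderivWithin_of_isOpen Φ.open_source hv
  change Φ.coframe v.proj v.2 = mfderivWithin I 𝓘(ℝ, F) Φ Φ.source v.proj v.2
  rw [h4]
  rfl

/-- The tangent vector with a given representative depends smoothly on the representative. -/
lemma contMDiffOn_frame :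
    ContMDiffOn 𝓘(ℝ, F × F) I.tangent ∞
      (fun q : F × F => (⟨Φ.inv q.1, Φ.frame (Φ.inv q.1) q.2⟩ : TangentBundle I M))
      (Φ.target ×ˢ univ) := by
  have h1 := Φ.smooth_symm.contMDiffOn_tangentMapWithin (m := ∞) (by simp)
    Φ.open_target.uniqueMDiffOn
  have h2 : ContMDiff 𝓘(ℝ, F × F) 𝓘(ℝ, F).tangent ∞
      (fun q : F × F => (⟨q.1, q.2⟩ : TangentBundle 𝓘(ℝ, F) F)) := by
    have h3 := (tangentBundleModelSpaceDiffeomorph 𝓘(ℝ, F) ⊤).symm.contMDiff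
    rw [modelWithCornersSelf_prod]
    exact h3
  refine (h1.comp h2.contMDiffOn (fun q hq => hq.1)).congr fun q hq => ?_
  have h4 : mfderivWithin 𝓘(ℝ, F) I Φ.inv Φ.target q.1 = mfderiv 𝓘(ℝ, F) I Φ.inv q.1 :=
    mfderivWithin_of_isOpen Φ.open_target hq.1
  simp only [Function.comp_apply, tangentMapWithin, h4]
  rw [← mfderiv_inv hq.1]
  rfl

lemma contMDiffAt_coframe {v : TangentBundle I M} (hv : v.proj ∈ Φ.source) :
    ContMDiffAt I.tangent 𝓘(ℝ, F) ∞ (fun v : TangentBundle I M => Φ.coframe v.proj v.2) v :=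
  contMDiffOn_coframe.contMDiffAt
    ((Φ.open_source.preimage (FiberBundle.continuous_proj E _)).mem_nhds hv)

lemma contMDiffAt_frame {q : F × F} (hq : q.1 ∈ Φ.target) :
    ContMDiffAt 𝓘(ℝ, F × F) I.tangent ∞
      (fun q : F × F => (⟨Φ.inv q.1, Φ.frame (Φ.inv q.1) q.2⟩ : TangentBundle I M)) q :=
  contMDiffOn_frame.contMDiffAt ((Φ.open_target.prod isOpen_univ).mem_nhds ⟨hq, mem_univ _⟩)

lemma eventually_source {y : M} (hy : y ∈ Φ.source) : ∀ᶠ z in 𝓝 y, z ∈ Φ.source :=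
  Φ.open_source.mem_nhds hy

lemma eventually_target {p : F} (hp : p ∈ Φ.target) : ∀ᶠ q in 𝓝 p, q ∈ Φ.target :=
  Φ.open_target.mem_nhds hp

lemma pull_eventuallyEq {y : M} (hy : y ∈ Φ.source) (V : F → F) :
    (fun z => (⟨Φ.inv (Φ z), Φ.frame (Φ.inv (Φ z)) (V (Φ z))⟩ : TangentBundle I M)) =ᶠ[𝓝 y]
      fun z => ⟨z, Φ.pull V z⟩ := by
  filter_upwards [eventually_source hy] with z hz
  rw [pull, show Φ.inv (Φ z) = z from Φ.left_inv hz]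

lemma mdifferentiableAt_pull {y : M} (hy : y ∈ Φ.source) {V : F → F}
    (hV : DifferentiableAt ℝ V (Φ y)) : MDiffAt (T% (Φ.pull V)) y := by
  have h1 : MDifferentiableAt I 𝓘(ℝ, F × F) (fun z => (Φ z, V (Φ z))) y := by
    have h2 : MDifferentiableAt I 𝓘(ℝ, F) Φ y := (contMDiffAt hy).mdifferentiableAt (by simp)
    exact h2.prodMk_space (hV.mdifferentiableAt.comp y h2)
  have h3 := ((contMDiffAt_frame (Φ := Φ) (q := (Φ y, V (Φ y))) (Φ.map_source hy)).mdifferentiableAt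
    (by simp)).comp y h1
  exact h3.congr_of_eventuallyEq (pull_eventuallyEq hy V).symm

lemma contMDiffAt_pull {y : M} (hy : y ∈ Φ.source) {V : F → F}
    (hV : ContDiffAt ℝ ∞ V (Φ y)) : CMDiffAt ∞ (T% (Φ.pull V)) y := by
  have h1 : ContMDiffAt I 𝓘(ℝ, F × F) ∞ (fun z => (Φ z, V (Φ z))) y := by
    have h2 : ContMDiffAt I 𝓘(ℝ, F) ∞ Φ y := contMDiffAt hy
    exact h2.prodMk_space (hV.contMDiffAt.comp y h2)
  have h3 := (contMDiffAt_frame (Φ := Φ) (q := (Φ y, V (Φ y))) (Φ.map_source hy)).comp y h1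
  exact h3.congr_of_eventuallyEq (pull_eventuallyEq hy V).symm

lemma differentiableAt_push {y : M} (hy : y ∈ Φ.source) {Y : (y : M) → TangentSpace I y}
    (hY : MDiffAt (T% Y) y) : DifferentiableAt ℝ (Φ.push Y) (Φ y) := by
  have h1 := ((contMDiffAt_coframe (Φ := Φ) (v := ⟨y, Y y⟩) hy).mdifferentiableAt
    (by simp)).comp y hY
  have h2 : MDifferentiableAt 𝓘(ℝ, F) I Φ.inv (Φ y) :=
    (contMDiffAt_inv (Φ.map_source hy)).mdifferentiableAt (by simp)
  have h3 : Φ.inv (Φ y) = y := Φ.left_inv hy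
  rw [← h3] at h1
  exact (h1.comp (Φ y) h2).differentiableAt

lemma contDiffAt_push {y : M} (hy : y ∈ Φ.source) {Y : (y : M) → TangentSpace I y}
    (hY : CMDiffAt ∞ (T% Y) y) : ContDiffAt ℝ ∞ (Φ.push Y) (Φ y) := by
  have h1 := (contMDiffAt_coframe (Φ := Φ) (v := ⟨y, Y y⟩) hy).comp y hY
  have h2 : ContMDiffAt 𝓘(ℝ, F) I ∞ Φ.inv (Φ y) := contMDiffAt_inv (Φ.map_source hy)
  have h3 : Φ.inv (Φ y) = y := Φ.left_inv hy
  rw [← h3] at h1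
  exact (h1.comp (Φ y) h2).contDiffAt

lemma mfderiv_inv_inverse {p : F} (hp : p ∈ Φ.target) :
    (mfderiv 𝓘(ℝ, F) I Φ.inv p : F →L[ℝ] TangentSpace I (Φ.inv p)).inverse =
      Φ.coframe (Φ.inv p) := by
  rw [mfderiv_inv hp, ← coe_equivAt_symm (Φ.map_target hp)]
  exact ContinuousLinearMap.inverse_equiv (equivAt (Φ.map_target hp)).symm

/-- The Lie bracket of vector fields in a chart. -/
lemma coframe_mlieBracket [CompleteSpace E] [CompleteSpace F] {y : M} (hy : y ∈ Φ.source)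
    {Y Z : (y : M) → TangentSpace I y}
    (hY : MDiffAt (T% Y) y) (hZ : MDiffAt (T% Z) y) :
    Φ.coframe y (VectorField.mlieBracket I Y Z y) =
      fderiv ℝ (Φ.push Z) (Φ y) (Φ.coframe y (Y y)) -
        fderiv ℝ (Φ.push Y) (Φ y) (Φ.coframe y (Z y)) := by
  set p := Φ y with hp
  have hpt : p ∈ Φ.target := Φ.map_source hy
  have hinv : Φ.inv p = y := Φ.left_inv hy
  rw [← push_apply hy Y, ← push_apply hy Z, ← hp]
  rw [← hinv] at hY hZ ⊢
  have : IsManifold I (minSmoothness ℝ 2) M := by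
    rw [minSmoothness_of_isRCLikeNormedField]
    exact IsManifold.of_le (n := ∞) (WithTop.coe_le_coe.2 le_top)
  have h1 := VectorField.mpullback_mlieBracket (f := Φ.inv) (x₀ := p) (I := 𝓘(ℝ, F)) (n := ∞)
    hY hZ (contMDiffAt_inv hpt) (by
      rw [minSmoothness_of_isRCLikeNormedField]; exact WithTop.coe_le_coe.2 le_top)
  have h2 : ∀ Y : (y : M) → TangentSpace I y,
      VectorField.mpullback 𝓘(ℝ, F) I Φ.inv Y =ᶠ[𝓝 p] Φ.push Y := by
    intro Y
    filter_upwards [eventually_target hpt] with q hq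
    rw [VectorField.mpullback_apply]
    exact DFunLike.congr_fun (mfderiv_inv_inverse hq) _
  have h3 := (h2 Y).mlieBracket_vectorField_eq (I := 𝓘(ℝ, F)) (h2 Z)
  rw [h3] at h1
  have h4 : Φ.coframe (Φ.inv p) (VectorField.mlieBracket I Y Z (Φ.inv p)) =
      VectorField.mpullback 𝓘(ℝ, F) I Φ.inv (VectorField.mlieBracket I Y Z) p := by
    rw [VectorField.mpullback_apply]
    exact (DFunLike.congr_fun (mfderiv_inv_inverse hpt) _).symm
  have h5 : VectorField.mlieBracket 𝓘(ℝ, F) (Φ.push Y) (Φ.push Z) p =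
      VectorField.lieBracket ℝ (Φ.push Y) (Φ.push Z) p := by
    have := congrFun (VectorField.mlieBracketWithin_eq_lieBracketWithin
      (V := Φ.push Y) (W := Φ.push Z) (s := univ) (𝕜 := ℝ)) p
    rw [VectorField.lieBracketWithin_univ] at this
    exact this
  exact h4.trans (h1.trans h5)

end SmoothChart

/-! ### Connections in a chart -/

section Connections

variable {E : Type*} [NormedAddCommGroup E] [NormedSpace ℝ E] [FiniteDimensional ℝ E]
  {H : Type*} [TopologicalSpace H] {I : ModelWithCorners ℝ E H}
  {M : Type*} [TopologicalSpace M] [ChartedSpace H M] [IsManifold I ∞ M]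
  {F : Type*} [NormedAddCommGroup F] [NormedSpace ℝ F] [FiniteDimensional ℝ F]

variable (I M) in
/-- An operator that maps vector fields to fields of endomorphisms. It is meaningful on the open
subset on which it is assumed to be a covariant derivative. -/
abbrev LocalConnection : Type _ :=
  ((y : M) → TangentSpace I y) → (y : M) → TangentSpace I y →L[ℝ] TangentSpace I y

/-- A vector field which is smooth near a point agrees near that point with a globally smooth
one. -/
lemma exists_smooth_extension [T2Space M] {U : Set M} (hU : IsOpen U)
    {Y : (y : M) → TangentSpace I y} (hY : CMDiff[U] ∞ (T% Y)) {x : M} (hx : x ∈ U) :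
    ∃ Z : (y : M) → TangentSpace I y, CMDiff ∞ (T% Z) ∧ ∀ᶠ y in 𝓝 x, Z y = Y y := by
  obtain ⟨f, -, hf⟩ := (SmoothBumpFunction.nhds_basis_tsupport (I := I) x).mem_iff.1
    (hU.mem_nhds hx)
  refine ⟨(f : M → ℝ) • Y,
    ContMDiffOn.smul_section_of_tsupport f.contMDiff.contMDiffOn hU hf hY, ?_⟩
  filter_upwards [f.eventuallyEq_one] with y hy
  change f y • Y y = Y y
  rw [hy, Pi.one_apply, one_smul]

/-- A family of linear maps depends smoothly on the point if each of its values does. -/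
lemma contMDiffAt_clm_of_apply {h : M → E →L[ℝ] E} {x : M}
    (H : ∀ u, ContMDiffAt I 𝓘(ℝ, E) ∞ (fun y => h y u) x) :
    ContMDiffAt I 𝓘(ℝ, E →L[ℝ] E) ∞ h x := by
  let b := Module.finBasis ℝ E
  let L : (Fin (Module.finrank ℝ E) → E) →L[ℝ] (E →L[ℝ] E) :=
    LinearMap.toContinuousLinearMap
      ((LinearMap.toContinuousLinearMap (𝕜 := ℝ) (E := E) (F' := E)).toLinearMap ∘ₗ
        (b.constr ℝ (M' := E)).toLinearMap)
  have h1 : h = fun y => L (fun i => h y (b i)) := by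
    funext y
    apply ContinuousLinearMap.coe_injective
    apply b.ext
    intro i
    simp [L]
  rw [h1]
  have h2 : ContMDiffAt I 𝓘(ℝ, Fin (Module.finrank ℝ E) → E) ∞ (fun y i => h y (b i)) x :=
    contMDiffAt_pi_space.2 fun i => H (b i)
  exact L.contDiff.contMDiff.contMDiffAt.comp x h2

/-- A field of endomorphisms is smooth if it maps smooth vector fields to smooth vector fields. -/
lemma contMDiffAt_endomorphism {ϕ : (y : M) → TangentSpace I y →L[ℝ] TangentSpace I y} {x : M}
    (H : ∀ Z : (y : M) → TangentSpace I y, CMDiffAt ∞ (T% Z) x →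
      CMDiffAt ∞ (T% (fun y => ϕ y (Z y))) x) :
    ContMDiffAt I (I.prod 𝓘(ℝ, E →L[ℝ] E)) ∞ (fun y => (⟨y, ϕ y⟩ :
      TotalSpace (E →L[ℝ] E) fun y => TangentSpace I y →L[ℝ] TangentSpace I y)) x := by
  rw [contMDiffAt_hom_bundle]
  refine ⟨contMDiffAt_id, contMDiffAt_clm_of_apply fun u => ?_⟩
  set e := trivializationAt E (TangentSpace I : M → Type _) x
  have hx : x ∈ e.baseSet := FiberBundle.mem_baseSet_trivializationAt' x
  have hnear : ∀ᶠ y in 𝓝 x, y ∈ e.baseSet := e.open_baseSet.mem_nhds hx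
  have hZ : CMDiffAt ∞ (T% (fun y => e.symm y u)) x := by
    rw [contMDiffAt_section]
    refine (contMDiffAt_const (c := u)).congr_of_eventuallyEq ?_
    filter_upwards [hnear] with y hy
    rw [e.apply_mk_symm hy]
  have h1 := H _ hZ
  rw [contMDiffAt_section] at h1
  refine h1.congr_of_eventuallyEq ?_
  filter_upwards [hnear] with y hy
  simp only [ContinuousLinearMap.inCoordinates, ContinuousLinearMap.comp_apply]
  rw [Trivialization.symmL_apply, Trivialization.continuousLinearMapAt_apply,
    Trivialization.linearMapAt_apply]
  · rw [if_pos hy]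
  · exact hy

lemma cov_sum {cov : LocalConnection I M} {U : Set M} (hcov : IsCovariantDerivativeOn E cov U)
    {ι : Type*} (s : Finset ι) {h : ι → M → ℝ} {Y : ι → (y : M) → TangentSpace I y} {x : M}
    (hx : x ∈ U)
    (hh : ∀ i, MDiffAt (h i) x) (hY : ∀ i, MDiffAt (T% (Y i)) x) :
    cov (fun y => ∑ i ∈ s, (h i • Y i) y) x =
      ∑ i ∈ s, (h i x • cov (Y i) x + (mvfderiv I (h i) x).smulRight (Y i x)) := by
  classical
  have hd : ∀ i, MDiffAt (T% (h i • Y i)) x := fun i => (hh i).smul_section (hY i)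
  induction s using Finset.induction_on with
  | empty =>
    simp only [Finset.sum_empty]
    exact hcov.zero hx
  | insert i s his ih =>
    have h1 : (fun y => ∑ j ∈ insert i s, (h j • Y j) y) =
        (h i • Y i) + fun y => ∑ j ∈ s, (h j • Y j) y := by
      funext y
      rw [Finset.sum_insert his]; rfl
    rw [h1, hcov.add (hd i)
      (MDifferentiableAt.sum_section fun j _ => hd j) hx, ih, Finset.sum_insert his,
      hcov.leibniz (hY i) (hh i) hx]

namespace SmoothChart

variable (Φ : SmoothChart I M F)

/-- The Christoffel symbols of a connection in a chart: `Γ p a v` is the representative of the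
derivative in the direction `v` of the field with constant representative `a`. The sum over a
basis makes linearity in `a` hold by construction. -/
def christoffel (cov : LocalConnection I M) (p : F) :
    F →L[ℝ] F →L[ℝ] F :=
  ∑ i, (LinearMap.toContinuousLinearMap ((Module.finBasis ℝ F).coord i)).smulRight
    (Φ.coframe (Φ.inv p) ∘L
      cov (Φ.pull fun _ => Module.finBasis ℝ F i) (Φ.inv p) ∘L Φ.frame (Φ.inv p))

variable {Φ}

lemma christoffel_apply (cov : LocalConnection I M) (p a u : F) :
    Φ.christoffel cov p a u = ∑ i, (Module.finBasis ℝ F).coord i a •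
      Φ.coframe (Φ.inv p)
        (cov (Φ.pull fun _ => Module.finBasis ℝ F i) (Φ.inv p) (Φ.frame (Φ.inv p) u)) := by
  simp only [christoffel, sum_apply, ContinuousLinearMap.smulRight_apply, smul_apply]
  rfl

lemma mvfderiv_comp_chart {y : M} (hy : y ∈ Φ.source) {h : F → ℝ}
    (hh : DifferentiableAt ℝ h (Φ y)) (v : TangentSpace I y) :
    mvfderiv I (fun z => h (Φ z)) y v = fderiv ℝ h (Φ y) (Φ.coframe y v) := by
  have h1 : HasMFDerivAt I 𝓘(ℝ, F) Φ y (mfderiv I 𝓘(ℝ, F) Φ y) :=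
    ((contMDiffAt hy).mdifferentiableAt (by simp)).hasMFDerivAt
  have h2 : HasMFDerivAt 𝓘(ℝ, F) 𝓘(ℝ, ℝ) h (Φ y) (fderiv ℝ h (Φ y)) :=
    hh.hasFDerivAt.hasMFDerivAt
  have h3 := (h2.comp y h1).mfderiv
  exact DFunLike.congr_fun h3 v

/-- The covariant derivative in a chart. -/
theorem coframe_cov {cov : LocalConnection I M} {U : Set M}
    (hcov : IsCovariantDerivativeOn E cov U) {y : M} (hyU : U ∈ 𝓝 y) (hy : y ∈ Φ.source)
    {Y : (y : M) → TangentSpace I y} (hY : MDiffAt (T% Y) y) (v : TangentSpace I y) :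
    Φ.coframe y (cov Y y v) = fderiv ℝ (Φ.push Y) (Φ y) (Φ.coframe y v) +
      Φ.christoffel cov (Φ y) (Φ.coframe y (Y y)) (Φ.coframe y v) := by
  -- expand `Y` in the frame of the constant fields, and use the Leibniz rule
  set b := Module.finBasis ℝ F
  let c (i : Fin (Module.finrank ℝ F)) : F →L[ℝ] ℝ := LinearMap.toContinuousLinearMap (b.coord i)
  let h (i : Fin (Module.finrank ℝ F)) (z : M) : ℝ := c i (Φ.push Y (Φ z))
  let Z (i : Fin (Module.finrank ℝ F)) : (y : M) → TangentSpace I y := Φ.pull fun _ => b i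
  have hpush := differentiableAt_push hy hY
  have hcpush : ∀ i, DifferentiableAt ℝ (fun p => c i (Φ.push Y p)) (Φ y) := fun i =>
    (c i).differentiableAt.comp _ hpush
  have hh : ∀ i, MDiffAt (h i) y := fun i =>
    (hcpush i).mdifferentiableAt.comp y ((contMDiffAt hy).mdifferentiableAt (by simp))
  have hZ : ∀ i, MDiffAt (T% (Z i)) y := fun i =>
    mdifferentiableAt_pull hy (differentiableAt_const _)
  have hsum : ∀ᶠ z in 𝓝 y, (fun z => ∑ i, (h i • Z i) z) z = Y z := by
    filter_upwards [eventually_source hy] with z hz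
    have h1 : ∀ i, (h i • Z i) z = Φ.frame z (b.repr (Φ.coframe z (Y z)) i • b i) := by
      intro i
      rw [map_smul]
      change c i (Φ.push Y (Φ z)) • Φ.frame z (b i) = _
      rw [push_apply hz]
      rfl
    simp only [h1]
    rw [← map_sum, b.sum_repr, frame_coframe hz]
  have hsumd : MDiffAt (T% (fun z => ∑ i, (h i • Z i) z)) y :=
    MDifferentiableAt.sum_section fun i _ => (hh i).smul_section (hZ i)
  rw [← hcov.congr_of_eventuallyEq hsumd hY hyU hsum,
    cov_sum hcov _ (mem_of_mem_nhds hyU) hh hZ]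
  have hinv : Φ.inv (Φ y) = y := Φ.left_inv hy
  have hΓ : Φ.christoffel cov (Φ y) (Φ.coframe y (Y y)) (Φ.coframe y v) =
      ∑ i, c i (Φ.coframe y (Y y)) • Φ.coframe y (cov (Z i) y v) := by
    have h0 : ∀ x, x = y → ∀ u, u = Φ.coframe y v → ∀ i,
        Φ.coframe x (cov (Z i) x (Φ.frame x u)) = Φ.coframe y (cov (Z i) y v) := by
      rintro x rfl u rfl i
      rw [frame_coframe hy]
    rw [christoffel_apply]
    exact Finset.sum_congr rfl fun i _ => congrArg _ (h0 _ hinv _ rfl i)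
  have hd : fderiv ℝ (Φ.push Y) (Φ y) (Φ.coframe y v) =
      ∑ i, c i (fderiv ℝ (Φ.push Y) (Φ y) (Φ.coframe y v)) • b i :=
    (b.sum_repr _).symm
  rw [hΓ, hd, ← Finset.sum_add_distrib, sum_apply, map_sum]
  refine Finset.sum_congr rfl fun i _ => ?_
  have h2 : mvfderiv I (h i) y v = c i (fderiv ℝ (Φ.push Y) (Φ y) (Φ.coframe y v)) := by
    rw [mvfderiv_comp_chart (h := fun p => c i (Φ.push Y p)) hy (hcpush i)]
    have h3 : HasFDerivAt (fun p => c i (Φ.push Y p)) (c i ∘L fderiv ℝ (Φ.push Y) (Φ y)) (Φ y) :=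
      (c i).hasFDerivAt.comp _ hpush.hasFDerivAt
    rw [h3.fderiv]
    rfl
  have h4 : h i y = c i (Φ.coframe y (Y y)) := by
    change c i (Φ.push Y (Φ y)) = _
    rw [push_apply hy]
  have h5 : Φ.coframe y (Z i y) = b i := coframe_frame hy _
  rw [add_apply, smul_apply, ContinuousLinearMap.smulRight_apply, map_add, map_smul, map_smul,
    h2, h4, h5, add_comm]

/-- The Christoffel symbols of a smooth connection are smooth. -/
lemma contDiffOn_christoffel [T2Space M]
    {cov : CovariantDerivative I E (TangentSpace I : M → Type _)}
    (hcov : CovariantDerivative.ContMDiffCovariantDerivative cov ∞) :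
    ContDiffOn ℝ ∞ (Φ.christoffel cov.toFun) Φ.target := by
  rw [contDiffOn_clm_apply]
  intro a
  rw [contDiffOn_clm_apply]
  intro u
  simp only [christoffel_apply]
  refine ContDiffOn.sum fun i _ => contDiffOn_const.smul ?_
  intro p hp
  refine ContDiffAt.contDiffWithinAt ?_
  set x := Φ.inv p with hx
  have hxs : x ∈ Φ.source := Φ.map_target hp
  have hΦx : Φ x = p := Φ.right_inv hp
  -- smoothness is assumed on global smooth fields only, so the local fields have to be extended
  have hpull : ∀ a, CMDiff[Φ.source] ∞ (T% (Φ.pull fun _ => a)) := fun a y hy =>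
    (contMDiffAt_pull hy contDiffAt_const).contMDiffWithinAt
  obtain ⟨Z, hZ, hZe⟩ := exists_smooth_extension Φ.open_source
    (hpull (Module.finBasis ℝ F i)) hxs
  have h1 := hcov.contMDiff.contMDiff (σ := Z) (by simpa using hZ.contMDiffOn)
  have h2 := h1.contMDiffAt (x := x) univ_mem
  have h3 := h2.clm_bundle_apply (contMDiffAt_pull hxs (contDiffAt_const (c := u)))
  have h4 := contDiffAt_push hxs h3
  rw [hΦx] at h4
  refine h4.congr_of_eventuallyEq ?_
  have h5 : ContinuousAt Φ.inv p := (contMDiffAt_inv hp).continuousAt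
  filter_upwards [h5.eventually (eventually_eventually_nhds.2 hZe), eventually_target hp]
    with q hq hqt
  have hqs : Φ.inv q ∈ Φ.source := Φ.map_target hqt
  have h6 : cov Z (Φ.inv q) = cov (Φ.pull fun _ => Module.finBasis ℝ F i) (Φ.inv q) :=
    cov.isCovariantDerivativeOnUniv.congr_of_eventuallyEq
      (hZ.mdifferentiableAt (by simp))
      (mdifferentiableAt_pull hqs (differentiableAt_const _)) univ_mem hq
  simp only [push, pull, h6]

/-- A torsion-free connection has symmetric Christoffel symbols. -/
lemma christoffel_symm {cov : LocalConnection I M} {U : Set M}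
    (hcov : IsCovariantDerivativeOn E cov U)
    (htor : ∀ (Y Z : (x : M) → TangentSpace I x), ∀ x ∈ U,
      MDiffAt (T% Y) x → MDiffAt (T% Z) x →
        cov Z x (Y x) - cov Y x (Z x) = VectorField.mlieBracket I Y Z x)
    {p : F} (hp : p ∈ Φ.target) (hpU : U ∈ 𝓝 (Φ.inv p)) (a b : F) :
    Φ.christoffel cov p a b = Φ.christoffel cov p b a := by
  set x := Φ.inv p with hx
  have hxs : x ∈ Φ.source := Φ.map_target hp
  have hΦx : Φ x = p := Φ.right_inv hp
  have hpull : ∀ a, MDiffAt (T% (Φ.pull fun _ => a)) x := fun a =>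
    mdifferentiableAt_pull hxs (differentiableAt_const _)
  have hcf : ∀ a, Φ.coframe x (Φ.pull (fun _ => a) x) = a := fun a => coframe_frame hxs a
  have hpp : ∀ a, fderiv ℝ (Φ.push (Φ.pull fun _ => a)) p = 0 := by
    intro a
    rw [← hΦx]
    have : Φ.push (Φ.pull fun _ => a) =ᶠ[𝓝 (Φ x)] fun _ => a := by
      filter_upwards [eventually_target (Φ.map_source hxs)] with q hq
      rw [push_pull hq]
    rw [this.fderiv_eq, fderiv_const_apply]
  have h1 := congrArg (Φ.coframe x) (htor _ _ x (mem_of_mem_nhds hpU) (hpull a) (hpull b))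
  rw [map_sub, coframe_cov hcov hpU hxs (hpull a), coframe_cov hcov hpU hxs (hpull b),
    coframe_mlieBracket hxs (hpull a) (hpull b), hΦx] at h1
  simp only [hpp, hcf, zero_apply, zero_add, sub_zero] at h1
  exact (sub_eq_zero.1 h1).symm

variable (Φ)

/-- The local connection with given Christoffel symbols. -/
def chartConnection (Γ : F → F →L[ℝ] F →L[ℝ] F) (Y : (y : M) → TangentSpace I y) (y : M) :
    TangentSpace I y →L[ℝ] TangentSpace I y :=
  Φ.frame y ∘L (fderiv ℝ (Φ.push Y) (Φ y) + Γ (Φ y) (Φ.push Y (Φ y))) ∘L Φ.coframe y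

variable {Φ}

lemma coframe_chartConnection {Γ : F → F →L[ℝ] F →L[ℝ] F} {y : M} (hy : y ∈ Φ.source)
    (Y : (y : M) → TangentSpace I y) (v : TangentSpace I y) :
    Φ.coframe y (Φ.chartConnection Γ Y y v) = fderiv ℝ (Φ.push Y) (Φ y) (Φ.coframe y v) +
      Γ (Φ y) (Φ.coframe y (Y y)) (Φ.coframe y v) := by
  rw [chartConnection, ContinuousLinearMap.comp_apply, coframe_frame hy, push_apply hy]
  rfl

lemma coframe_injective {y : M} (hy : y ∈ Φ.source) : Function.Injective (Φ.coframe y) :=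
  (equivAt hy).injective

lemma isCovariantDerivativeOn_chartConnection (Γ : F → F →L[ℝ] F →L[ℝ] F) :
    IsCovariantDerivativeOn E (Φ.chartConnection Γ) Φ.source where
  add {Y Z x} hY hZ hx := by
    ext v
    apply coframe_injective hx
    have h1 : Φ.push (Y + Z) = Φ.push Y + Φ.push Z := by
      funext p
      exact map_add _ _ _
    rw [add_apply, map_add, coframe_chartConnection hx, coframe_chartConnection hx,
      coframe_chartConnection hx, h1,
      fderiv_add (differentiableAt_push hx hY) (differentiableAt_push hx hZ), Pi.add_apply, map_add,
      map_add, add_apply, add_apply]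
    abel
  leibniz {Y h x} hY hh hx := by
    ext v
    apply coframe_injective hx
    have hinv : Φ.inv (Φ x) = x := Φ.left_inv hx
    set k : F → ℝ := fun p => h (Φ.inv p) with hk
    have hkd : DifferentiableAt ℝ k (Φ x) := by
      have h3 : MDifferentiableAt 𝓘(ℝ, F) I Φ.inv (Φ x) :=
        (contMDiffAt_inv (Φ.map_source hx)).mdifferentiableAt (by simp)
      rw [← hinv] at hh
      exact (hh.comp (Φ x) h3).differentiableAt
    have h1 : Φ.push (h • Y) = k • Φ.push Y := by
      funext p
      exact map_smul _ _ _
    have h2 : mvfderiv I h x v = fderiv ℝ k (Φ x) (Φ.coframe x v) := by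
      rw [← mvfderiv_comp_chart hx hkd]
      have h3 : (fun z => k (Φ z)) =ᶠ[𝓝 x] h := by
        filter_upwards [eventually_source hx] with z hz
        rw [hk]
        exact congrArg h (Φ.left_inv hz)
      have h4 := h3.mfderiv_eq (I := I) (I' := 𝓘(ℝ, ℝ))
      exact (DFunLike.congr_fun h4 v).symm
    have h5 : k (Φ x) = h x := by rw [hk]; exact congrArg h hinv
    rw [add_apply, map_add, smul_apply, map_smul, ContinuousLinearMap.smulRight_apply,
      coframe_chartConnection hx, coframe_chartConnection hx, h1,
      fderiv_smul hkd (differentiableAt_push hx hY), h2, Pi.smul_apply', map_smul, map_smul,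
      map_smul, h5, add_apply, smul_apply, smul_apply, ContinuousLinearMap.smulRight_apply,
      push_apply hx]
    module

/-- The local connection with smooth Christoffel symbols is smooth. -/
lemma contMDiffAt_chartConnection {Γ : F → F →L[ℝ] F →L[ℝ] F} (hΓ : ContDiffOn ℝ ∞ Γ Φ.target)
    {x : M} (hx : x ∈ Φ.source) {Y : (y : M) → TangentSpace I y} (hY : CMDiffAt ∞ (T% Y) x) :
    ContMDiffAt I (I.prod 𝓘(ℝ, E →L[ℝ] E)) ∞ (fun y => (⟨y, Φ.chartConnection Γ Y y⟩ :
      TotalSpace (E →L[ℝ] E) fun y => TangentSpace I y →L[ℝ] TangentSpace I y)) x := by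
  refine contMDiffAt_endomorphism fun Z hZ => ?_
  have hYp := contDiffAt_push hx hY
  have hZp := contDiffAt_push hx hZ
  have hΓp : ContDiffAt ℝ ∞ Γ (Φ x) := hΓ.contDiffAt (eventually_target (Φ.map_source hx))
  have h1 : ContDiffAt ℝ ∞ (fun p => fderiv ℝ (Φ.push Y) p (Φ.push Z p) +
      Γ p (Φ.push Y p) (Φ.push Z p)) (Φ x) :=
    ((hYp.fderiv_right (m := ∞) (by simp)).clm_apply hZp).add ((hΓp.clm_apply hYp).clm_apply hZp)
  refine (contMDiffAt_pull hx h1).congr_of_eventuallyEq ?_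
  filter_upwards [eventually_source hx] with z hz
  congr 1
  rw [pull, chartConnection, ContinuousLinearMap.comp_apply, push_apply hz, push_apply hz]
  rfl

end SmoothChart

end Connections

/-! ### The Koszul formula -/

section Koszul

variable {F : Type*} [NormedAddCommGroup F] [NormedSpace ℝ F] [FiniteDimensional ℝ F]

/-- A scalar product. -/
structure IsScalarProduct (G : F →L[ℝ] F →L[ℝ] ℝ) : Prop where
  symm : ∀ a b, G a b = G b a
  pos : ∀ a, a ≠ 0 → 0 < G a a

lemma IsScalarProduct.eq_zero {G : F →L[ℝ] F →L[ℝ] ℝ} (hG : IsScalarProduct G) {a : F}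
    (h : G a a = 0) : a = 0 := by
  by_contra ha
  exact (hG.pos a ha).ne' h

lemma IsScalarProduct.exists_equiv {G : F →L[ℝ] F →L[ℝ] ℝ} (hG : IsScalarProduct G) :
    ∃ e : F ≃L[ℝ] (F →L[ℝ] ℝ), (e : F →L[ℝ] F →L[ℝ] ℝ) = G := by
  have hinj : Function.Injective G := by
    rw [injective_iff_map_eq_zero]
    intro a ha
    apply hG.eq_zero
    rw [ha]; rfl
  have hdim : Module.finrank ℝ F = Module.finrank ℝ (F →L[ℝ] ℝ) := by
    rw [← (LinearMap.toContinuousLinearMap (𝕜 := ℝ) (E := F) (F' := ℝ)).finrank_eq]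
    exact (Subspace.dual_finrank_eq (K := ℝ) (V := F)).symm
  refine ⟨(LinearEquiv.ofInjectiveOfFinrankEq (G : F →ₗ[ℝ] F →L[ℝ] ℝ) hinj
    hdim).toContinuousLinearEquiv, ?_⟩
  ext a b
  rfl

lemma IsScalarProduct.apply_inverse {G : F →L[ℝ] F →L[ℝ] ℝ} (hG : IsScalarProduct G)
    (l : F →L[ℝ] ℝ) : G (G.inverse l) = l := by
  obtain ⟨e, rfl⟩ := hG.exists_equiv
  rw [ContinuousLinearMap.inverse_equiv]
  exact e.apply_symm_apply l

/-- The bilinear map `Γ` with `2 G (Γ a b) c = S a b c + S b a c - S c a b`. -/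
def koszul (G : F →L[ℝ] F →L[ℝ] ℝ) (S : F →L[ℝ] F →L[ℝ] F →L[ℝ] ℝ) : F →L[ℝ] F →L[ℝ] F :=
  LinearMap.toContinuousLinearMap (LinearMap.toContinuousLinearMap.toLinearMap ∘ₗ
    LinearMap.mk₂ ℝ (fun a b => (2⁻¹ : ℝ) • G.inverse (S a b + S b a - (S.flip a).flip b))
      (by
        intro a a' b
        simp only [map_add, add_apply, map_sub, ContinuousLinearMap.flip_add]
        module)
      (by
        intro r a b
        simp only [map_smul, smul_apply, map_add, map_sub, ContinuousLinearMap.flip_smul]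
        module)
      (by intro a b b'; simp only [map_add, add_apply, map_sub]; module)
      (by
        intro r a b
        simp only [map_smul, smul_apply, map_add, map_sub]
        module))

lemma koszul_apply (G : F →L[ℝ] F →L[ℝ] ℝ) (S : F →L[ℝ] F →L[ℝ] F →L[ℝ] ℝ) (a b : F) :
    koszul G S a b = (2⁻¹ : ℝ) • G.inverse (S a b + S b a - (S.flip a).flip b) := rfl

lemma two_mul_koszul {G : F →L[ℝ] F →L[ℝ] ℝ} (hG : IsScalarProduct G)
    (S : F →L[ℝ] F →L[ℝ] F →L[ℝ] ℝ) (a b c : F) :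
    2 * G (koszul G S a b) c = S a b c + S b a c - S c a b := by
  rw [koszul_apply, map_smul, hG.apply_inverse, smul_apply, smul_eq_mul,
    mul_inv_cancel_left₀ two_ne_zero]
  rfl

lemma koszul_symm (G : F →L[ℝ] F →L[ℝ] ℝ) {S : F →L[ℝ] F →L[ℝ] F →L[ℝ] ℝ}
    (hS : ∀ v a b, S v a b = S v b a) (a b : F) : koszul G S a b = koszul G S b a := by
  have h : (S.flip a).flip b = (S.flip b).flip a := by
    ext v
    exact hS v a b
  rw [koszul_apply, koszul_apply, h, add_comm (S a b)]

lemma contDiffOn_koszul {X : Type*} [NormedAddCommGroup X] [NormedSpace ℝ X] {U : Set X}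
    {G : X → F →L[ℝ] F →L[ℝ] ℝ} {S : X → F →L[ℝ] F →L[ℝ] F →L[ℝ] ℝ}
    (hG : ContDiffOn ℝ ∞ G U) (hS : ContDiffOn ℝ ∞ S U) (hpos : ∀ p ∈ U, IsScalarProduct (G p)) :
    ContDiffOn ℝ ∞ (fun p => koszul (G p) (S p)) U := by
  rw [contDiffOn_clm_apply]
  intro a
  rw [contDiffOn_clm_apply]
  intro b
  have h1 : ContDiffOn ℝ ∞ (fun p => (G p).inverse) U := by
    intro p hp
    obtain ⟨e, he⟩ := (hpos p hp).exists_equiv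
    have h2 := contDiffAt_map_inverse (𝕜 := ℝ) (n := ∞) e
    rw [he] at h2
    exact h2.comp_contDiffWithinAt p (hG p hp)
  have h2 : ContDiffOn ℝ ∞ (fun p => ((S p).flip a).flip b) U := by
    rw [contDiffOn_clm_apply]
    intro v
    exact ((hS.clm_apply contDiffOn_const).clm_apply contDiffOn_const).clm_apply contDiffOn_const
  have h3 : ∀ a b, ContDiffOn ℝ ∞ (fun p => S p a b) U := fun a b =>
    (hS.clm_apply contDiffOn_const).clm_apply contDiffOn_const
  exact contDiffOn_const.smul (h1.clm_apply (((h3 a b).add (h3 b a)).sub h2))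

/-- A symmetric bilinear map which is skew-symmetric with respect to a scalar product vanishes. -/
lemma eq_zero_of_symm_of_skew {G : F →L[ℝ] F →L[ℝ] ℝ} (hG : IsScalarProduct G)
    {A : F →L[ℝ] F →L[ℝ] F} (hA : ∀ a b, A a b = A b a)
    (hskew : ∀ a b v, G (A a v) b + G a (A b v) = 0) : A = 0 := by
  have h : ∀ a v b, G (A a v) b = - G (A b v) a := by
    intro a v b
    rw [hG.symm (A b v) a]
    exact eq_neg_of_add_eq_zero_left (hskew a b v)
  ext a v
  apply hG.eq_zero
  set b := A a v
  have h1 : G (A a v) b = G (A b v) a := by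
    rw [hA a v, h v a b, hA b a, h a b v, neg_neg, hA v b]
  have h2 := h a v b
  change G (A a v) b = 0
  linarith

end Koszul

/-! ### Scalar products and connections adapted to a product of vector spaces -/

section Blocks

variable {E₁ : Type*} [NormedAddCommGroup E₁] [NormedSpace ℝ E₁] [FiniteDimensional ℝ E₁]
  {E₂ : Type*} [NormedAddCommGroup E₂] [NormedSpace ℝ E₂] [FiniteDimensional ℝ E₂]

/-- The bilinear map `Γ` preserves the two factors, in its first argument. -/
structure IsBlock (Γ : E₁ × E₂ →L[ℝ] E₁ × E₂ →L[ℝ] E₁ × E₂) : Prop where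
  snd_eq_zero : ∀ a u, (Γ (a, 0) u).2 = 0
  fst_eq_zero : ∀ b u, (Γ (0, b) u).1 = 0

/-- The mixed values lie in both factors. -/
lemma IsBlock.mixed_eq_zero {Γ : E₁ × E₂ →L[ℝ] E₁ × E₂ →L[ℝ] E₁ × E₂} (h : IsBlock Γ)
    (hΓ : ∀ a b, Γ a b = Γ b a) (a : E₁) (b : E₂) : Γ (a, 0) (0, b) = 0 := by
  ext
  · rw [hΓ]; exact h.fst_eq_zero _ _
  · exact h.snd_eq_zero _ _

/-- A symmetric bilinear map which preserves the two factors and is conformal with respect to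
a scalar product, up to a prescribed term, is unique. -/
lemma eq_of_isBlock [Nontrivial E₁] [Nontrivial E₂] {G : E₁ × E₂ →L[ℝ] E₁ × E₂ →L[ℝ] ℝ}
    (hG : IsScalarProduct G) {Γ Γ' : E₁ × E₂ →L[ℝ] E₁ × E₂ →L[ℝ] E₁ × E₂}
    (hΓ : ∀ a b, Γ a b = Γ b a) (hΓ' : ∀ a b, Γ' a b = Γ' b a) (hb : IsBlock Γ) (hb' : IsBlock Γ')
    {D : E₁ × E₂ → E₁ × E₂ → E₁ × E₂ → ℝ} {θ θ' : E₁ × E₂ →L[ℝ] ℝ}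
    (hθ : ∀ v a b, D v a b = G (Γ a v) b + G a (Γ b v) - 2 * θ v * G a b)
    (hθ' : ∀ v a b, D v a b = G (Γ' a v) b + G a (Γ' b v) - 2 * θ' v * G a b) : Γ = Γ' := by
  have key : ∀ v a b, G ((Γ - Γ') a v) b + G a ((Γ - Γ') b v) = 2 * (θ - θ') v * G a b := by
    intro v a b
    simp only [sub_apply, map_sub]
    linarith [hθ v a b, hθ' v a b]
  have hα : θ - θ' = 0 := by
    obtain ⟨e₁, he₁⟩ := exists_ne (0 : E₁)
    obtain ⟨e₂, he₂⟩ := exists_ne (0 : E₂)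
    -- in the direction of one factor, test on a vector of the other: the mixed terms vanish
    have h1 : ∀ v, (θ - θ') (0, v) = 0 := by
      intro v
      have h2 := key (0, v) (e₁, 0) (e₁, 0)
      rw [sub_apply, sub_apply, hb.mixed_eq_zero hΓ, hb'.mixed_eq_zero hΓ', sub_zero, map_zero,
        map_zero, zero_apply, add_zero] at h2
      have h3 := hG.pos (e₁, 0) (by simpa using he₁)
      simpa [h3.ne'] using h2.symm
    have h2 : ∀ v, (θ - θ') (v, 0) = 0 := by
      intro v
      have h2 := key (v, 0) (0, e₂) (0, e₂)
      rw [sub_apply, sub_apply, hΓ, hΓ', hb.mixed_eq_zero hΓ, hb'.mixed_eq_zero hΓ', sub_zero,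
        map_zero, map_zero, zero_apply, add_zero] at h2
      have h3 := hG.pos (0, e₂) (by simpa using he₂)
      simpa [h3.ne'] using h2.symm
    ext v
    · exact h2 v
    · exact h1 v
  rw [← sub_eq_zero]
  refine eq_zero_of_symm_of_skew hG
    (fun a b => by rw [sub_apply, sub_apply, sub_apply, sub_apply, hΓ, hΓ']) ?_
  intro a b v
  rw [key, hα, zero_apply, mul_zero, zero_mul]

/-- A field of scalar products on an open subset of `E₁ × E₂` for which the two factors are
orthogonal and whose restriction to each factor depends on the other variable only through
a conformal factor. -/
structure IsConformalBlock (G : E₁ × E₂ → E₁ × E₂ →L[ℝ] E₁ × E₂ →L[ℝ] ℝ) (U : Set (E₁ × E₂)) :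
    Prop where
  isScalarProduct : ∀ p ∈ U, IsScalarProduct (G p)
  orthogonal : ∀ p ∈ U, ∀ a b, G p (a, 0) (0, b) = 0
  conformal₁ : ∀ x y y', (x, y) ∈ U → (x, y') ∈ U →
    ∃ r : ℝ, ∀ a b, G (x, y') (a, 0) (b, 0) = r * G (x, y) (a, 0) (b, 0)
  conformal₂ : ∀ x x' y, (x, y) ∈ U → (x', y) ∈ U →
    ∃ r : ℝ, ∀ a b, G (x', y) (0, a) (0, b) = r * G (x, y) (0, a) (0, b)

/-- For a block conformal field of scalar products there is a smooth family of symmetric bilinear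
maps which preserve the factors and are conformal: the Christoffel symbols given by the Koszul
formula for `∇ G = -2 θ ⊗ G`. The form `θ` is determined by the condition that the restriction of
`G` to a factor is parallel in the direction of the other one. -/
theorem IsConformalBlock.exists_christoffel [Nontrivial E₁] [Nontrivial E₂]
    {G : E₁ × E₂ → E₁ × E₂ →L[ℝ] E₁ × E₂ →L[ℝ] ℝ} {U : Set (E₁ × E₂)} (hU : IsOpen U)
    (hG : IsConformalBlock G U) (hsm : ContDiffOn ℝ ∞ G U) :
    ∃ (Γ : E₁ × E₂ → E₁ × E₂ →L[ℝ] E₁ × E₂ →L[ℝ] E₁ × E₂) (θ : E₁ × E₂ → E₁ × E₂ →L[ℝ] ℝ),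
      ContDiffOn ℝ ∞ Γ U ∧ (∀ p a b, p ∈ U → Γ p a b = Γ p b a) ∧ (∀ p ∈ U, IsBlock (Γ p)) ∧
      ∀ p ∈ U, ∀ v a b, fderiv ℝ G p v a b =
        G p (Γ p a v) b + G p a (Γ p b v) - 2 * θ p v * G p a b := by
  obtain ⟨e₁, he₁⟩ := exists_ne (0 : E₁)
  obtain ⟨e₂, he₂⟩ := exists_ne (0 : E₂)
  set f₁ : E₁ × E₂ := (e₁, 0) with hf₁
  set f₂ : E₁ × E₂ := (0, e₂) with hf₂
  have hp₁ : ∀ p ∈ U, 0 < G p f₁ f₁ := fun p hp =>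
    (hG.isScalarProduct p hp).pos _ (by simpa [hf₁] using he₁)
  have hp₂ : ∀ p ∈ U, 0 < G p f₂ f₂ := fun p hp =>
    (hG.isScalarProduct p hp).pos _ (by simpa [hf₂] using he₂)
  let ι₁ : E₁ × E₂ →L[ℝ] E₁ × E₂ :=
    ContinuousLinearMap.inl ℝ E₁ E₂ ∘L ContinuousLinearMap.fst ℝ E₁ E₂
  let ι₂ : E₁ × E₂ →L[ℝ] E₁ × E₂ :=
    ContinuousLinearMap.inr ℝ E₁ E₂ ∘L ContinuousLinearMap.snd ℝ E₁ E₂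
  -- minus half the logarithmic derivative of `G`, tested on a vector of the other factor
  let θ : E₁ × E₂ → E₁ × E₂ →L[ℝ] ℝ := fun p =>
    (-(1 / 2) * (G p f₁ f₁)⁻¹) • (((fderiv ℝ G p).flip f₁).flip f₁ ∘L ι₂) +
    (-(1 / 2) * (G p f₂ f₂)⁻¹) • (((fderiv ℝ G p).flip f₂).flip f₂ ∘L ι₁)
  have hθ : ∀ p v, θ p v = -(1 / 2) * (G p f₁ f₁)⁻¹ * fderiv ℝ G p (0, v.2) f₁ f₁ +
      -(1 / 2) * (G p f₂ f₂)⁻¹ * fderiv ℝ G p (v.1, 0) f₂ f₂ := fun p v => rfl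
  -- `S = dG + 2 θ ⊗ G` is to equal `G (Γ a v) b + G a (Γ b v)`
  let S : E₁ × E₂ → E₁ × E₂ →L[ℝ] E₁ × E₂ →L[ℝ] E₁ × E₂ →L[ℝ] ℝ := fun p =>
    fderiv ℝ G p + (2 : ℝ) • (θ p).smulRight (G p)
  have hS : ∀ p v a b, S p v a b = fderiv ℝ G p v a b + 2 * (θ p v * G p a b) := fun p v a b => rfl
  have hd : ∀ p ∈ U, DifferentiableAt ℝ G p := fun p hp =>
    (hsm.contDiffAt (hU.mem_nhds hp)).differentiableAt (by simp)
  have hDab : ∀ p ∈ U, ∀ a b, HasFDerivAt (fun q => G q a b)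
      (((fderiv ℝ G p).flip a).flip b) p := by
    intro p hp a b
    exact ((hd p hp).hasFDerivAt.clm_apply (hasFDerivAt_const a p)).clm_apply
      (hasFDerivAt_const b p) |>.congr_fderiv (by ext <;> simp)
  -- derivative along a line
  have hline : ∀ p ∈ U, ∀ v a b, HasDerivAt (fun t : ℝ => G (p + t • v) a b)
      (fderiv ℝ G p v a b) 0 := by
    intro p hp v a b
    have h1 : HasDerivAt (fun t : ℝ => p + t • v) v 0 := by
      simpa using ((hasDerivAt_id (0 : ℝ)).smul_const v).const_add p
    have h2 := hDab p hp a b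
    have h3 : HasFDerivAt (fun q => G q a b) (((fderiv ℝ G p).flip a).flip b)
      (p + (0 : ℝ) • v) := by simpa using h2
    exact h3.comp_hasDerivAt 0 h1
  have hev : ∀ p ∈ U, ∀ v, ∀ᶠ t : ℝ in 𝓝 0, p + t • v ∈ U := by
    intro p hp v
    have h1 : ContinuousAt (fun t : ℝ => p + t • v) 0 := by fun_prop
    exact h1.eventually_mem (hU.mem_nhds (by simpa using hp))
  have hsymm : ∀ p ∈ U, ∀ v a b, fderiv ℝ G p v a b = fderiv ℝ G p v b a := by
    intro p hp v a b
    refine (hline p hp v a b).unique ((hline p hp v b a).congr_of_eventuallyEq ?_)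
    filter_upwards [hev p hp v] with t ht
    exact (hG.isScalarProduct _ ht).symm a b
  have hmix : ∀ p ∈ U, ∀ v a b, fderiv ℝ G p v (a, 0) (0, b) = 0 := by
    intro p hp v a b
    refine (hline p hp v (a, 0) (0, b)).unique
      ((hasDerivAt_const (0 : ℝ) (0 : ℝ)).congr_of_eventuallyEq ?_)
    filter_upwards [hev p hp v] with t ht
    exact hG.orthogonal _ ht a b
  -- where two values of `G` vary by the same factor, so do their derivatives
  have hratio : ∀ p ∈ U, ∀ v a b e, (∀ᶠ t : ℝ in 𝓝 0, ∃ r : ℝ,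
      G (p + t • v) a b = r * G p a b ∧ G (p + t • v) e e = r * G p e e) →
      fderiv ℝ G p v a b * G p e e = fderiv ℝ G p v e e * G p a b := by
    intro p hp v a b e h
    refine ((hline p hp v a b).mul_const (G p e e)).unique
      (((hline p hp v e e).mul_const (G p a b)).congr_of_eventuallyEq ?_)
    filter_upwards [h] with t ⟨r, h1, h2⟩
    rw [h1, h2]; ring
  -- `S` vanishes unless all its arguments lie in the same factor
  have hS1 : ∀ p ∈ U, ∀ z a b, S p (0, z) (a, 0) (b, 0) = 0 := by
    intro p hp z a b
    have h1 := hratio p hp (0, z) (a, 0) (b, 0) f₁ (by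
      filter_upwards [hev p hp (0, z)] with t ht
      have h2 : p + t • ((0 : E₁), z) = (p.1, p.2 + t • z) := by ext <;> simp
      rw [h2] at ht ⊢
      obtain ⟨r, hr⟩ := hG.conformal₁ p.1 p.2 _ hp ht
      exact ⟨r, hr a b, hr e₁ e₁⟩)
    have h3 := (hp₁ p hp).ne'
    rw [hS, hθ]
    simp only [Prod.mk_zero_zero, map_zero, zero_apply, mul_zero, add_zero]
    field_simp
    linarith
  have hS2 : ∀ p ∈ U, ∀ z a b, S p (z, 0) (0, a) (0, b) = 0 := by
    intro p hp z a b
    have h1 := hratio p hp (z, 0) (0, a) (0, b) f₂ (by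
      filter_upwards [hev p hp (z, 0)] with t ht
      have h2 : p + t • (z, (0 : E₂)) = (p.1 + t • z, p.2) := by ext <;> simp
      rw [h2] at ht ⊢
      obtain ⟨r, hr⟩ := hG.conformal₂ p.1 _ p.2 hp ht
      exact ⟨r, hr a b, hr e₂ e₂⟩)
    have h3 := (hp₂ p hp).ne'
    rw [hS, hθ]
    simp only [Prod.mk_zero_zero, map_zero, zero_apply, mul_zero, zero_add]
    field_simp
    linarith
  have hS3 : ∀ p ∈ U, ∀ v a b, S p v (a, 0) (0, b) = 0 := by
    intro p hp v a b
    rw [hS, hmix p hp, hG.orthogonal p hp, mul_zero, mul_zero, add_zero]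
  have hSs : ∀ p ∈ U, ∀ v a b, S p v a b = S p v b a := by
    intro p hp v a b
    rw [hS, hS, hsymm p hp, (hG.isScalarProduct p hp).symm a b]
  have hS4 : ∀ p ∈ U, ∀ v a b, S p v (0, b) (a, 0) = 0 := by
    intro p hp v a b
    rw [hSs p hp, hS3 p hp]
  have hsplit : ∀ v : E₁ × E₂, v = (v.1, 0) + (0, v.2) := fun v => by ext <;> simp
  have hfd : ContDiffOn ℝ ∞ (fderiv ℝ G) U := hsm.fderiv_of_isOpen hU (by simp)
  have happ : ∀ a b, ContDiffOn ℝ ∞ (fun p => G p a b) U := fun a b =>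
    (hsm.clm_apply contDiffOn_const).clm_apply contDiffOn_const
  have hθs : ContDiffOn ℝ ∞ θ U := by
    rw [contDiffOn_clm_apply]
    intro v
    have h1 : ∀ v a b, ContDiffOn ℝ ∞ (fun p => fderiv ℝ G p v a b) U := fun v a b =>
      ((hfd.clm_apply contDiffOn_const).clm_apply contDiffOn_const).clm_apply contDiffOn_const
    simp only [hθ]
    exact ((contDiffOn_const.mul ((happ _ _).inv fun p hp => (hp₁ p hp).ne')).mul (h1 _ _ _)).add
      ((contDiffOn_const.mul ((happ _ _).inv fun p hp => (hp₂ p hp).ne')).mul (h1 _ _ _))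
  have hSsm : ContDiffOn ℝ ∞ S U := by
    rw [contDiffOn_clm_apply]
    intro v
    rw [contDiffOn_clm_apply]
    intro a
    have h1 : ContDiffOn ℝ ∞ (fun p => fderiv ℝ G p v a) U :=
      (hfd.clm_apply contDiffOn_const).clm_apply contDiffOn_const
    have h2 : ContDiffOn ℝ ∞ (fun p => G p a) U := hsm.clm_apply contDiffOn_const
    exact h1.add (contDiffOn_const.smul ((hθs.clm_apply contDiffOn_const).smul h2))
  refine ⟨fun p => koszul (G p) (S p), θ, contDiffOn_koszul hsm hSsm hG.isScalarProduct,
    fun p a b hp => koszul_symm _ (hSs p hp) a b, fun p hp => ⟨?_, ?_⟩, ?_⟩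
  · intro a u
    have h1 : ∀ c, G p (koszul (G p) (S p) (a, 0) u) (0, c) = 0 := by
      intro c
      have h2 := two_mul_koszul (hG.isScalarProduct p hp) (S p) (a, 0) u (0, c)
      rw [hsplit u] at h2 ⊢
      simp only [map_add, add_apply] at h2 ⊢
      rw [hS3 p hp, hS3 p hp, hS3 p hp, hS2 p hp, hS3 p hp, hS1 p hp] at h2
      linarith
    set x := koszul (G p) (S p) (a, 0) u
    have h2 := h1 x.2
    have h3 : G p x (0, x.2) = G p (0, x.2) (0, x.2) := by
      conv_lhs => rw [hsplit x]
      rw [map_add, add_apply, hG.orthogonal p hp, zero_add]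
      simp
    rw [h3] at h2
    simpa using (hG.isScalarProduct p hp).eq_zero h2
  · intro a u
    have h1 : ∀ c, G p (koszul (G p) (S p) (0, a) u) (c, 0) = 0 := by
      intro c
      have h2 := two_mul_koszul (hG.isScalarProduct p hp) (S p) (0, a) u (c, 0)
      rw [hsplit u] at h2 ⊢
      simp only [map_add, add_apply] at h2 ⊢
      rw [hS4 p hp, hS4 p hp, hS4 p hp, hS4 p hp, hS1 p hp, hS2 p hp] at h2
      linarith
    set x := koszul (G p) (S p) (0, a) u
    have h2 := h1 x.1
    have h3 : G p x (x.1, 0) = G p (x.1, 0) (x.1, 0) := by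
      conv_lhs => rw [hsplit x]
      rw [map_add, add_apply, (hG.isScalarProduct p hp).symm (0, x.2), hG.orthogonal p hp, add_zero]
      simp
    rw [h3] at h2
    simpa using (hG.isScalarProduct p hp).eq_zero h2
  · intro p hp v a b
    have hGp := hG.isScalarProduct p hp
    have h1 := two_mul_koszul hGp (S p) a v b
    have h2 := two_mul_koszul hGp (S p) b v a
    rw [hGp.symm a]
    have h3 := hS p v a b
    rw [hSs p hp v b a, hSs p hp a b v, hSs p hp b v a] at *
    linarith

end Blocks

/-! ### Metrics in a chart -/

section WeylConnections

variable {E : Type*} [NormedAddCommGroup E] [NormedSpace ℝ E] [FiniteDimensional ℝ E]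
  {H : Type*} [TopologicalSpace H] {I : ModelWithCorners ℝ E H}
  {M : Type*} [TopologicalSpace M] [ChartedSpace H M] [IsManifold I ∞ M]
  {F : Type*} [NormedAddCommGroup F] [NormedSpace ℝ F] [FiniteDimensional ℝ F]

namespace SmoothChart

variable (Φ : SmoothChart I M F)

/-- The representative of a metric in a chart. -/
def metric (g : Metric I M) (p : F) : F →L[ℝ] F →L[ℝ] ℝ :=
  ContinuousLinearMap.precomp ℝ (Φ.frame (Φ.inv p)) ∘L g.inner (Φ.inv p) ∘L Φ.frame (Φ.inv p)

variable {Φ}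

lemma metric_coframe (g : Metric I M) {y : M} (hy : y ∈ Φ.source) (v w : TangentSpace I y) :
    Φ.metric g (Φ y) (Φ.coframe y v) (Φ.coframe y w) = g.inner y v w := by
  have h : ∀ x, x = y → g.inner x (Φ.frame x (Φ.coframe y v)) (Φ.frame x (Φ.coframe y w)) =
      g.inner y v w := by
    rintro x rfl
    rw [frame_coframe hy, frame_coframe hy]
  exact h _ (Φ.left_inv hy)

lemma isScalarProduct_metric (g : Metric I M) {p : F} (hp : p ∈ Φ.target) :
    IsScalarProduct (Φ.metric g p) where
  symm a b := g.symm _ _ _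
  pos a ha := by
    refine g.pos _ _ fun h => ha ?_
    have h1 := coframe_frame (Φ.map_target hp) a
    exact h1.symm.trans ((congrArg _ h).trans (map_zero _))

lemma contMDiffAt_inner (g : Metric I M) {x : M} {Y Z : (y : M) → TangentSpace I y}
    (hY : CMDiffAt ∞ (T% Y) x) (hZ : CMDiffAt ∞ (T% Z) x) :
    ContMDiffAt I 𝓘(ℝ, ℝ) ∞ (fun y => g.inner y (Y y) (Z y)) x := by
  have : ContMDiffAt I (I.prod 𝓘(ℝ, ℝ)) ∞
      (fun m ↦ TotalSpace.mk' ℝ (E := Bundle.Trivial M ℝ) m (g.inner m (Y m) (Z m))) x := by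
    apply ContMDiffAt.clm_bundle_apply₂ (F₁ := E) (F₂ := E)
    · exact g.contMDiff.contMDiffAt
    · exact hY
    · exact hZ
  rw [contMDiffAt_totalSpace] at this
  exact this.2

lemma contDiffOn_metric (g : Metric I M) : ContDiffOn ℝ ∞ (Φ.metric g) Φ.target := by
  rw [contDiffOn_clm_apply]
  intro a
  rw [contDiffOn_clm_apply]
  intro b p hp
  refine ContDiffAt.contDiffWithinAt ?_
  have hx : Φ.inv p ∈ Φ.source := Φ.map_target hp
  have h1 := contMDiffAt_inner g (contMDiffAt_pull hx (contDiffAt_const (c := a)))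
    (contMDiffAt_pull hx (contDiffAt_const (c := b)))
  exact (h1.comp p (contMDiffAt_inv hp)).contDiffAt

/-- The derivative of the scalar product of two vector fields, in a chart. -/
lemma mfderiv_inner (g : Metric I M) {y : M} (hy : y ∈ Φ.source)
    {Y Z : (y : M) → TangentSpace I y} (hY : MDiffAt (T% Y) y) (hZ : MDiffAt (T% Z) y)
    (v : TangentSpace I y) :
    mfderiv I 𝓘(ℝ, ℝ) (fun z => g.inner z (Y z) (Z z)) y v =
      fderiv ℝ (Φ.metric g) (Φ y) (Φ.coframe y v) (Φ.coframe y (Y y)) (Φ.coframe y (Z y)) +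
      Φ.metric g (Φ y) (fderiv ℝ (Φ.push Y) (Φ y) (Φ.coframe y v)) (Φ.coframe y (Z y)) +
      Φ.metric g (Φ y) (Φ.coframe y (Y y)) (fderiv ℝ (Φ.push Z) (Φ y) (Φ.coframe y v)) := by
  have hG : DifferentiableAt ℝ (Φ.metric g) (Φ y) :=
    ((contDiffOn_metric g).contDiffAt (eventually_target (Φ.map_source hy))).differentiableAt
      (by simp)
  have h1 := (hG.hasFDerivAt.clm_apply (differentiableAt_push hy hY).hasFDerivAt).clm_apply
    (differentiableAt_push hy hZ).hasFDerivAt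
  have h2 : (fun z => g.inner z (Y z) (Z z)) =ᶠ[𝓝 y]
      fun z => Φ.metric g (Φ z) (Φ.push Y (Φ z)) (Φ.push Z (Φ z)) := by
    filter_upwards [eventually_source hy] with z hz
    rw [push_apply hz, push_apply hz, metric_coframe g hz]
  have h3 : mfderiv I 𝓘(ℝ, ℝ) (fun z => g.inner z (Y z) (Z z)) y v =
      mfderiv I 𝓘(ℝ, ℝ) (fun z => Φ.metric g (Φ z) (Φ.push Y (Φ z)) (Φ.push Z (Φ z))) y v :=
    DFunLike.congr_fun (h2.mfderiv_eq (I := I) (I' := 𝓘(ℝ, ℝ))) v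
  refine h3.trans ((mvfderiv_comp_chart (h := fun p => Φ.metric g p (Φ.push Y p) (Φ.push Z p))
    hy h1.differentiableAt v).trans ?_)
  rw [h1.fderiv]
  simp only [add_apply, ContinuousLinearMap.comp_apply, ContinuousLinearMap.flip_apply,
    push_apply hy]
  ring

end SmoothChart

/-! ### Weyl connections on open subsets -/

/-- The local connection `cov` is torsion-free and conformal on `U`: `∇ g = -2 θ ⊗ g`. -/
structure IsWeylOn (g : Metric I M) (cov : LocalConnection I M) (U : Set M) : Prop where
  isCov : IsCovariantDerivativeOn E cov U
  torsion_free : ∀ (Y Z : (x : M) → TangentSpace I x), ∀ x ∈ U,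
    MDiffAt (T% Y) x → MDiffAt (T% Z) x →
      cov Z x (Y x) - cov Y x (Z x) = VectorField.mlieBracket I Y Z x
  conformal : ∃ θ : (x : M) → TangentSpace I x →L[ℝ] ℝ,
    ∀ (Y Z : (x : M) → TangentSpace I x), ∀ x ∈ U, ∀ v : TangentSpace I x,
      MDiffAt (T% Y) x → MDiffAt (T% Z) x →
        mfderiv I 𝓘(ℝ, ℝ) (fun y => g.inner y (Y y) (Z y)) x v =
          g.inner x (cov Y x v) (Z x) + g.inner x (Y x) (cov Z x v)
            - 2 * θ x v * g.inner x (Y x) (Z x)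

/-- The local connection `cov` preserves the distribution `D` on `U`. -/
def PreservesOn (cov : LocalConnection I M) (D : (x : M) → Submodule ℝ (TangentSpace I x))
    (U : Set M) : Prop :=
  ∀ (Y : (x : M) → TangentSpace I x), ∀ x ∈ U, ∀ v : TangentSpace I x,
    MDiffAt (T% Y) x → (∀ᶠ y in 𝓝 x, Y y ∈ D y) → cov Y x v ∈ D x

/-- In the chart, `D₁` and `D₂` are the tangent spaces of the factors of `E₁ × E₂`. -/
structure SmoothChart.IsSplit {E₁ : Type*} [NormedAddCommGroup E₁] [NormedSpace ℝ E₁]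
    {E₂ : Type*} [NormedAddCommGroup E₂] [NormedSpace ℝ E₂] (Φ : SmoothChart I M (E₁ × E₂))
    (D₁ D₂ : (x : M) → Submodule ℝ (TangentSpace I x)) : Prop where
  mem₁ : ∀ y ∈ Φ.source, ∀ v, v ∈ D₁ y ↔ (Φ.coframe y v).2 = 0
  mem₂ : ∀ y ∈ Φ.source, ∀ v, v ∈ D₂ y ↔ (Φ.coframe y v).1 = 0

/-- The local connection `cov` is torsion-free and conformal, and preserves `D₁` and `D₂` on `U`. -/
structure IsAdaptedOn (g : Metric I M) (D₁ D₂ : (x : M) → Submodule ℝ (TangentSpace I x))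
    (cov : LocalConnection I M) (U : Set M) : Prop extends IsWeylOn g cov U where
  preserves₁ : PreservesOn cov D₁ U
  preserves₂ : PreservesOn cov D₂ U

namespace SmoothChart

variable {Φ : SmoothChart I M F}

lemma push_pull_const {p : F} (hp : p ∈ Φ.target) (a : F) :
    fderiv ℝ (Φ.push (Φ.pull fun _ => a)) p = 0 := by
  have : Φ.push (Φ.pull fun _ => a) =ᶠ[𝓝 p] fun _ => a := by
    filter_upwards [eventually_target hp] with q hq
    rw [push_pull hq]
  rw [this.fderiv_eq, fderiv_const_apply]

lemma coframe_cov_const {cov : LocalConnection I M} {U : Set M}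
    (hcov : IsCovariantDerivativeOn E cov U) {y : M} (hyU : U ∈ 𝓝 y) (hy : y ∈ Φ.source)
    (a : F) (v : TangentSpace I y) :
    Φ.coframe y (cov (Φ.pull fun _ => a) y v) = Φ.christoffel cov (Φ y) a (Φ.coframe y v) := by
  rw [coframe_cov hcov hyU hy (mdifferentiableAt_pull hy (differentiableAt_const _)),
    push_pull_const (Φ.map_source hy), zero_apply, zero_add]
  congr 2
  exact coframe_frame hy a

/-- The conformality of a connection in terms of its Christoffel symbols. -/
lemma fderiv_metric {g : Metric I M} {cov : LocalConnection I M} {U : Set M}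
    (hcov : IsWeylOn g cov U) :
    ∃ θ : F → F →L[ℝ] ℝ, ∀ y ∈ Φ.source, U ∈ 𝓝 y → ∀ v a b,
      fderiv ℝ (Φ.metric g) (Φ y) v a b = Φ.metric g (Φ y) (Φ.christoffel cov (Φ y) a v) b +
        Φ.metric g (Φ y) a (Φ.christoffel cov (Φ y) b v) -
        2 * θ (Φ y) v * Φ.metric g (Φ y) a b := by
  obtain ⟨θ, hθ⟩ := hcov.conformal
  refine ⟨fun p => θ (Φ.inv p) ∘L Φ.frame (Φ.inv p), fun y hy hyU v a b => ?_⟩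
  have hd : ∀ a, MDiffAt (T% (Φ.pull fun _ => a)) y := fun a =>
    mdifferentiableAt_pull hy (differentiableAt_const _)
  have h1 := hθ _ _ y (mem_of_mem_nhds hyU) (Φ.frame y v) (hd a) (hd b)
  rw [mfderiv_inner g hy (hd a) (hd b), push_pull_const (Φ.map_source hy),
    push_pull_const (Φ.map_source hy), ← metric_coframe g hy, ← metric_coframe g hy,
    ← metric_coframe g hy, coframe_cov_const hcov.isCov hyU hy,
    coframe_cov_const hcov.isCov hyU hy, coframe_frame hy] at h1
  have h2 : ∀ a, Φ.coframe y (Φ.pull (fun _ => a) y) = a := fun a => coframe_frame hy a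
  have h3 : ∀ x, x = y → θ x (Φ.frame x v) = θ y (Φ.frame y v) := by rintro x rfl; rfl
  rw [h2, h2, zero_apply, map_zero, zero_apply, map_zero, add_zero, add_zero] at h1
  rw [h1, ContinuousLinearMap.comp_apply, h3 _ (Φ.left_inv hy)]

/-- A local connection with symmetric conformal Christoffel symbols is a Weyl connection. -/
lemma isWeylOn_chartConnection {g : Metric I M} {Γ : F → F →L[ℝ] F →L[ℝ] F}
    {θ : F → F →L[ℝ] ℝ} (hsymm : ∀ p a b, p ∈ Φ.target → Γ p a b = Γ p b a)
    (hconf : ∀ p ∈ Φ.target, ∀ v a b, fderiv ℝ (Φ.metric g) p v a b =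
      Φ.metric g p (Γ p a v) b + Φ.metric g p a (Γ p b v) - 2 * θ p v * Φ.metric g p a b) :
    IsWeylOn g (Φ.chartConnection Γ) Φ.source where
  isCov := isCovariantDerivativeOn_chartConnection Γ
  torsion_free Y Z x hx hY hZ := by
    apply coframe_injective hx
    rw [map_sub, coframe_chartConnection hx, coframe_chartConnection hx,
      coframe_mlieBracket hx hY hZ, hsymm _ _ _ (Φ.map_source hx)]
    abel
  conformal := by
    refine ⟨fun x => θ (Φ x) ∘L Φ.coframe x, fun Y Z x hx v hY hZ => ?_⟩
    rw [mfderiv_inner g hx hY hZ, hconf _ (Φ.map_source hx), ← metric_coframe g hx,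
      ← metric_coframe g hx, ← metric_coframe g hx, coframe_chartConnection hx,
      coframe_chartConnection hx, map_add, map_add, add_apply, ContinuousLinearMap.comp_apply]
    change @Eq ℝ _ _
    ring

variable {E₁ : Type*} [NormedAddCommGroup E₁] [NormedSpace ℝ E₁] [FiniteDimensional ℝ E₁]
  {E₂ : Type*} [NormedAddCommGroup E₂] [NormedSpace ℝ E₂] [FiniteDimensional ℝ E₂]
  {Ψ : SmoothChart I M (E₁ × E₂)} {D₁ D₂ : (x : M) → Submodule ℝ (TangentSpace I x)}

/-- The Christoffel symbols of a connection which preserves `D₁` and `D₂`. -/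
lemma IsSplit.isBlock (hΨ : Ψ.IsSplit D₁ D₂) {cov : LocalConnection I M} {U : Set M}
    (hcov : IsCovariantDerivativeOn E cov U) (h₁ : PreservesOn cov D₁ U)
    (h₂ : PreservesOn cov D₂ U) {y : M} (hyU : U ∈ 𝓝 y) (hy : y ∈ Ψ.source) :
    IsBlock (Ψ.christoffel cov (Ψ y)) where
  snd_eq_zero a u := by
    have h := h₁ (Ψ.pull fun _ => (a, 0)) y (mem_of_mem_nhds hyU) (Ψ.frame y u)
      (mdifferentiableAt_pull hy (differentiableAt_const _)) (by
        filter_upwards [eventually_source hy] with z hz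
        rw [hΨ.mem₁ z hz, pull, coframe_frame hz])
    rwa [hΨ.mem₁ y hy, coframe_cov_const hcov hyU hy, coframe_frame hy] at h
  fst_eq_zero b u := by
    have h := h₂ (Ψ.pull fun _ => (0, b)) y (mem_of_mem_nhds hyU) (Ψ.frame y u)
      (mdifferentiableAt_pull hy (differentiableAt_const _)) (by
        filter_upwards [eventually_source hy] with z hz
        rw [hΨ.mem₂ z hz, pull, coframe_frame hz])
    rwa [hΨ.mem₂ y hy, coframe_cov_const hcov hyU hy, coframe_frame hy] at h

lemma IsSplit.preservesOn₁ (hΨ : Ψ.IsSplit D₁ D₂)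
    {Γ : E₁ × E₂ → E₁ × E₂ →L[ℝ] E₁ × E₂ →L[ℝ] E₁ × E₂}
    (hΓ : ∀ p ∈ Ψ.target, IsBlock (Γ p)) : PreservesOn (Ψ.chartConnection Γ) D₁ Ψ.source := by
  intro Y x hx v hY hYD
  have h1 : (fun p => (Ψ.push Y p).2) =ᶠ[𝓝 (Ψ x)] fun _ => 0 := by
    have h3 : Ψ.inv (Ψ x) = x := Ψ.left_inv hx
    have h4 : ContinuousAt Ψ.inv (Ψ x) := (contMDiffAt_inv (Ψ.map_source hx)).continuousAt
    rw [ContinuousAt, h3] at h4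
    filter_upwards [h4.eventually hYD, eventually_target (Ψ.map_source hx)] with p hp hpt
    exact (hΨ.mem₁ _ (Ψ.map_target hpt) _).1 hp
  have h2 : HasFDerivAt (fun p => (Ψ.push Y p).2)
      (ContinuousLinearMap.snd ℝ E₁ E₂ ∘L fderiv ℝ (Ψ.push Y) (Ψ x)) (Ψ x) :=
    (ContinuousLinearMap.snd ℝ E₁ E₂).hasFDerivAt.comp _ (differentiableAt_push hx hY).hasFDerivAt
  have h3 := h1.fderiv_eq (𝕜 := ℝ)
  rw [h2.fderiv, fderiv_const_apply] at h3
  have h4 : Ψ.coframe x (Y x) = ((Ψ.coframe x (Y x)).1, 0) := by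
    ext
    · rfl
    · exact (hΨ.mem₁ x hx _).1 hYD.self_of_nhds
  rw [hΨ.mem₁ x hx, coframe_chartConnection hx, h4, Prod.snd_add,
    (hΓ _ (Ψ.map_source hx)).snd_eq_zero, add_zero]
  exact DFunLike.congr_fun h3 _

lemma IsSplit.preservesOn₂ (hΨ : Ψ.IsSplit D₁ D₂)
    {Γ : E₁ × E₂ → E₁ × E₂ →L[ℝ] E₁ × E₂ →L[ℝ] E₁ × E₂}
    (hΓ : ∀ p ∈ Ψ.target, IsBlock (Γ p)) : PreservesOn (Ψ.chartConnection Γ) D₂ Ψ.source := by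
  intro Y x hx v hY hYD
  have h1 : (fun p => (Ψ.push Y p).1) =ᶠ[𝓝 (Ψ x)] fun _ => 0 := by
    have h3 : Ψ.inv (Ψ x) = x := Ψ.left_inv hx
    have h4 : ContinuousAt Ψ.inv (Ψ x) := (contMDiffAt_inv (Ψ.map_source hx)).continuousAt
    rw [ContinuousAt, h3] at h4
    filter_upwards [h4.eventually hYD, eventually_target (Ψ.map_source hx)] with p hp hpt
    exact (hΨ.mem₂ _ (Ψ.map_target hpt) _).1 hp
  have h2 : HasFDerivAt (fun p => (Ψ.push Y p).1)
      (ContinuousLinearMap.fst ℝ E₁ E₂ ∘L fderiv ℝ (Ψ.push Y) (Ψ x)) (Ψ x) :=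
    (ContinuousLinearMap.fst ℝ E₁ E₂).hasFDerivAt.comp _ (differentiableAt_push hx hY).hasFDerivAt
  have h3 := h1.fderiv_eq (𝕜 := ℝ)
  rw [h2.fderiv, fderiv_const_apply] at h3
  have h4 : Ψ.coframe x (Y x) = (0, (Ψ.coframe x (Y x)).2) := by
    ext
    · exact (hΨ.mem₂ x hx _).1 hYD.self_of_nhds
    · rfl
  rw [hΨ.mem₂ x hx, coframe_chartConnection hx, h4, Prod.fst_add,
    (hΓ _ (Ψ.map_source hx)).fst_eq_zero, add_zero]
  exact DFunLike.congr_fun h3 _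

/-- Two Weyl connections that preserve the same splitting agree. -/
lemma IsSplit.eq_of_isAdaptedOn [Nontrivial E₁] [Nontrivial E₂] (hΨ : Ψ.IsSplit D₁ D₂)
    {g : Metric I M} {cov cov' : LocalConnection I M} {U U' : Set M} {y : M} (hy : y ∈ Ψ.source)
    (hyU : U ∈ 𝓝 y) (hyU' : U' ∈ 𝓝 y) (h : IsAdaptedOn g D₁ D₂ cov U)
    (h' : IsAdaptedOn g D₁ D₂ cov' U') {Y : (x : M) → TangentSpace I x} (hY : MDiffAt (T% Y) y) :
    cov Y y = cov' Y y := by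
  obtain ⟨θ, hθ⟩ := fderiv_metric (Φ := Ψ) h.toIsWeylOn
  obtain ⟨θ', hθ'⟩ := fderiv_metric (Φ := Ψ) h'.toIsWeylOn
  have hinv : Ψ.inv (Ψ y) = y := Ψ.left_inv hy
  have hs : ∀ a b, Ψ.christoffel cov (Ψ y) a b = Ψ.christoffel cov (Ψ y) b a :=
    christoffel_symm h.isCov h.torsion_free (Ψ.map_source hy) (by rwa [hinv])
  have hs' : ∀ a b, Ψ.christoffel cov' (Ψ y) a b = Ψ.christoffel cov' (Ψ y) b a :=
    christoffel_symm h'.isCov h'.torsion_free (Ψ.map_source hy) (by rwa [hinv])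
  have h1 := eq_of_isBlock (isScalarProduct_metric g (Ψ.map_source hy)) hs hs'
    (hΨ.isBlock h.isCov h.preserves₁ h.preserves₂ hyU hy)
    (hΨ.isBlock h'.isCov h'.preserves₁ h'.preserves₂ hyU' hy)
    (D := fun v a b => fderiv ℝ (Ψ.metric g) (Ψ y) v a b)
    (fun v a b => hθ y hy hyU v a b) (fun v a b => hθ' y hy hyU' v a b)
  ext v
  apply coframe_injective hy
  rw [coframe_cov h.isCov hyU hy hY, coframe_cov h'.isCov hyU' hy hY, h1]

/-- Existence of the adapted Weyl connection in a chart. -/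
lemma IsSplit.exists_isAdaptedOn [Nontrivial E₁] [Nontrivial E₂] (hΨ : Ψ.IsSplit D₁ D₂)
    {g : Metric I M} (hg : IsConformalBlock (Ψ.metric g) Ψ.target) :
    ∃ cov : LocalConnection I M, IsAdaptedOn g D₁ D₂ cov Ψ.source ∧
      ∀ x ∈ Ψ.source, ∀ Y : (x : M) → TangentSpace I x, CMDiffAt ∞ (T% Y) x →
        ContMDiffAt I (I.prod 𝓘(ℝ, E →L[ℝ] E)) ∞ (fun y => (⟨y, cov Y y⟩ :
          TotalSpace (E →L[ℝ] E) fun y => TangentSpace I y →L[ℝ] TangentSpace I y)) x := by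
  obtain ⟨Γ, θ, hsm, hsymm, hblock, hθ⟩ :=
    hg.exists_christoffel Ψ.open_target (contDiffOn_metric g)
  exact ⟨Ψ.chartConnection Γ, ⟨isWeylOn_chartConnection hsymm hθ, hΨ.preservesOn₁ hblock,
    hΨ.preservesOn₂ hblock⟩, fun x hx Y hY => contMDiffAt_chartConnection hsm hx hY⟩

end SmoothChart

/-! ### The adapted Weyl structure -/

/-- Near `x` there is one and only one Weyl connection which preserves `D₁` and `D₂`. -/
structure HasAdaptedConnectionNear (g : Metric I M)
    (D₁ D₂ : (x : M) → Submodule ℝ (TangentSpace I x)) (x : M) : Prop where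
  exists_adapted : ∃ (U : Set M) (cov : LocalConnection I M), IsOpen U ∧ x ∈ U ∧
    IsAdaptedOn g D₁ D₂ cov U ∧
      ∀ x ∈ U, ∀ Y : (x : M) → TangentSpace I x, CMDiffAt ∞ (T% Y) x →
        ContMDiffAt I (I.prod 𝓘(ℝ, E →L[ℝ] E)) ∞ (fun y => (⟨y, cov Y y⟩ :
          TotalSpace (E →L[ℝ] E) fun y => TangentSpace I y →L[ℝ] TangentSpace I y)) x
  unique : ∀ (U U' : Set M) (cov cov' : LocalConnection I M), U ∈ 𝓝 x → U' ∈ 𝓝 x →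
    IsAdaptedOn g D₁ D₂ cov U → IsAdaptedOn g D₁ D₂ cov' U' →
      ∀ Y : (x : M) → TangentSpace I x, MDiffAt (T% Y) x → cov Y x = cov' Y x

lemma SmoothChart.IsSplit.hasAdaptedConnectionNear
    {E₁ : Type*} [NormedAddCommGroup E₁] [NormedSpace ℝ E₁] [FiniteDimensional ℝ E₁] [Nontrivial E₁]
    {E₂ : Type*} [NormedAddCommGroup E₂] [NormedSpace ℝ E₂] [FiniteDimensional ℝ E₂] [Nontrivial E₂]
    {Ψ : SmoothChart I M (E₁ × E₂)} {D₁ D₂ : (x : M) → Submodule ℝ (TangentSpace I x)}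
    (hΨ : Ψ.IsSplit D₁ D₂) {g : Metric I M} (hg : IsConformalBlock (Ψ.metric g) Ψ.target) {x : M}
    (hx : x ∈ Ψ.source) : HasAdaptedConnectionNear g D₁ D₂ x where
  exists_adapted := by
    obtain ⟨cov, h1, h2⟩ := hΨ.exists_isAdaptedOn hg
    exact ⟨Ψ.source, cov, Ψ.open_source, hx, h1, h2⟩
  unique U U' cov cov' hU hU' h h' Y hY := hΨ.eq_of_isAdaptedOn hx hU hU' h h' hY

/-- A Weyl structure is determined by its values on differentiable fields, as its value on any other
field is `0` by convention. -/
lemma WeylStructure.ext_nabla {c : ConformalStructure I M} {W W' : WeylStructure c}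
    (h : ∀ (Y : (x : M) → TangentSpace I x) (x : M), MDiffAt (T% Y) x →
      W.nabla Y x = W'.nabla Y x) : W = W' := by
  have h1 : W.nabla = W'.nabla := by
    have h2 : W.nabla.toFun = W'.nabla.toFun := by
      funext Y x
      by_cases hY : MDiffAt (T% Y) x
      · exact h Y x hY
      · exact (W.eq_zero_of_not_mdifferentiableAt Y x hY).trans
          (W'.eq_zero_of_not_mdifferentiableAt Y x hY).symm
    cases hW : W.nabla with
    | mk f hf =>
      cases hW' : W'.nabla with
      | mk f' hf' =>
        rw [hW, hW'] at h2
        change f = f' at h2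
        subst h2
        rfl
  cases W
  cases W'
  simp only at h1
  subst h1
  rfl

lemma WeylStructure.isWeylOn {c : ConformalStructure I M} (W : WeylStructure c) {g : Metric I M}
    (hg : c.HasMetric g) : IsWeylOn g W.nabla.toFun univ where
  isCov := W.nabla.isCovariantDerivativeOnUniv
  torsion_free Y Z x _ hY hZ := W.torsion_free Y Z x hY hZ
  conformal := by
    obtain ⟨θ, hθ⟩ := W.preserves_conformal g hg
    exact ⟨θ, fun Y Z x _ v hY hZ => hθ Y Z x v hY hZ⟩

lemma preservesOn_univ_iff {nabla : CovariantDerivative I E (TangentSpace I : M → Type _)}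
    {D : (x : M) → Submodule ℝ (TangentSpace I x)} :
    PreservesOn nabla.toFun D univ ↔ PreservesDistribution nabla D :=
  ⟨fun h Y x v hY hD => h Y x (mem_univ x) v hY hD, fun h Y x _ v hY hD => h Y x v hY hD⟩

lemma WeylStructure.isAdaptedOn {c : ConformalStructure I M} {W : WeylStructure c} {g : Metric I M}
    (hg : c.HasMetric g) {D₁ D₂ : (x : M) → Submodule ℝ (TangentSpace I x)}
    (hW : W.PreservesSplitting D₁ D₂) : IsAdaptedOn g D₁ D₂ W.nabla.toFun univ :=
  ⟨W.isWeylOn hg, preservesOn_univ_iff.2 hW.1, preservesOn_univ_iff.2 hW.2⟩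

/-- It suffices to check conformality for one metric of the conformal class. -/
lemma IsWeylOn.of_conformal {c : ConformalStructure I M} {g g' : Metric I M} (hg : c.HasMetric g)
    (hg' : c.HasMetric g') {cov : LocalConnection I M} {U : Set M} (h : IsWeylOn g cov U) :
    IsWeylOn g' cov U where
  isCov := h.isCov
  torsion_free := h.torsion_free
  conformal := by
    obtain ⟨f, hf, hpos, hfg⟩ : (conformalSetoid I M).r g g' := Quotient.exact (hg.trans hg'.symm)
    obtain ⟨θ, hθ⟩ := h.conformal
    let df : (x : M) → TangentSpace I x →L[ℝ] ℝ := fun x => mfderiv I 𝓘(ℝ, ℝ) f x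
    -- for `g' = f g`, the form `θ` changes by `-d (log f) / 2`
    refine ⟨fun x => θ x - (2 * f x)⁻¹ • df x, fun Y Z x hx v hY hZ => ?_⟩
    have h1 : HasMFDerivAt I 𝓘(ℝ, ℝ) f x (mfderiv I 𝓘(ℝ, ℝ) f x) :=
      ((hf x).mdifferentiableAt (by simp)).hasMFDerivAt
    have h2 : MDifferentiableAt I 𝓘(ℝ, ℝ) (fun y => g.inner y (Y y) (Z y)) x := by
      have : MDifferentiableAt I (I.prod 𝓘(ℝ, ℝ))
          (fun m ↦ TotalSpace.mk' ℝ (E := Bundle.Trivial M ℝ) m (g.inner m (Y m) (Z m))) x := by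
        apply MDifferentiableAt.clm_bundle_apply₂ (F₁ := E) (F₂ := E)
        · exact g.contMDiff.contMDiffAt.mdifferentiableAt (by simp)
        · exact hY
        · exact hZ
      rw [mdifferentiableAt_totalSpace] at this
      exact this.2
    have h3 := h1.mul h2.hasMFDerivAt
    let d : ℝ := mfderiv I 𝓘(ℝ, ℝ) (fun y => g.inner y (Y y) (Z y)) x v
    have hd : d = g.inner x (cov Y x v) (Z x) + g.inner x (Y x) (cov Z x v)
        - 2 * θ x v * g.inner x (Y x) (Z x) := hθ Y Z x hx v hY hZ
    have h4 : mfderiv I 𝓘(ℝ, ℝ) (fun y => g'.inner y (Y y) (Z y)) x v =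
        f x * d + g.inner x (Y x) (Z x) * df x v := by
      have h5 : (fun y => g'.inner y (Y y) (Z y)) = f * fun y => g.inner y (Y y) (Z y) := by
        funext y
        exact hfg y _ _
      have h6 : mfderiv I 𝓘(ℝ, ℝ) (fun y => g'.inner y (Y y) (Z y)) x v =
          mfderiv I 𝓘(ℝ, ℝ) (f * fun y => g.inner y (Y y) (Z y)) x v := by rw [h5]; rfl
      rw [h6]
      exact DFunLike.congr_fun h3.mfderiv v
    rw [h4, hd, hfg, hfg, hfg, sub_apply, smul_apply, smul_eq_mul]
    have := (hpos x).ne'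
    change @Eq ℝ _ _
    field_simp
    ring

/-- Local adapted Weyl connections fit together, because they are unique. -/
theorem existsUnique_adapted {c : ConformalStructure I M} {g : Metric I M} (hg : c.HasMetric g)
    {D₁ D₂ : (x : M) → Submodule ℝ (TangentSpace I x)}
    (h : ∀ x, HasAdaptedConnectionNear g D₁ D₂ x) :
    ∃! W : WeylStructure c, W.PreservesSplitting D₁ D₂ := by
  classical
  choose U cov hU hxU had hsm using fun x => (h x).exists_adapted
  choose θ hθ using fun x => (had x).conformal
  -- on non-differentiable fields the value is `0`, by the convention for Weyl structures
  let nabla : LocalConnection I M := fun Y x => if MDiffAt (T% Y) x then cov x Y x else 0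
  have hnabla : ∀ x, ∀ y ∈ U x, ∀ Y : (x : M) → TangentSpace I x, MDiffAt (T% Y) y →
      nabla Y y = cov x Y y := by
    intro x y hy Y hY
    simp only [nabla, if_pos hY]
    exact (h y).unique _ _ _ _ ((hU y).mem_nhds (hxU y)) ((hU x).mem_nhds hy) (had y) (had x) Y hY
  have hself : ∀ x, ∀ Y : (x : M) → TangentSpace I x, MDiffAt (T% Y) x → nabla Y x = cov x Y x :=
    fun x Y hY => hnabla x x (hxU x) Y hY
  have hweyl : IsWeylOn g nabla univ :=
    { isCov :=
        { add := by
            intro Y Z x hY hZ _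
            rw [hself x _ hY, hself x _ hZ, hself x _ (mdifferentiableAt_add_section hY hZ),
              (had x).isCov.add hY hZ (hxU x)]
          leibniz := by
            intro Y f x hY hf _
            rw [hself x _ hY, hself x _ (hf.smul_section hY), (had x).isCov.leibniz hY hf (hxU x)] }
      torsion_free := by
        intro Y Z x _ hY hZ
        rw [hself x _ hY, hself x _ hZ, (had x).torsion_free Y Z x (hxU x) hY hZ]
      conformal := by
        refine ⟨fun x => θ x x, fun Y Z x _ v hY hZ => ?_⟩
        rw [hself x _ hY, hself x _ hZ, hθ x Y Z x (hxU x) v hY hZ] }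
  let D : CovariantDerivative I E (TangentSpace I : M → Type _) := ⟨nabla, hweyl.isCov⟩
  let W : WeylStructure c :=
    { nabla := D
      smooth := by
        refine ⟨⟨fun {Y} hY => ?_⟩⟩
        intro x _
        have hY' : ∀ y, CMDiffAt ∞ (T% Y) y := fun y =>
          (hY.contMDiffAt univ_mem).of_le (by simp)
        refine ((hsm x x (hxU x) Y (hY' x)).congr_of_eventuallyEq ?_).contMDiffWithinAt
        filter_upwards [(hU x).mem_nhds (hxU x)] with y hy
        have := hnabla x y hy Y ((hY' y).mdifferentiableAt (by simp))
        exact congrArg (fun l => (⟨y, l⟩ :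
          TotalSpace (E →L[ℝ] E) fun y => TangentSpace I y →L[ℝ] TangentSpace I y)) this
      torsion_free := fun Y Z x hY hZ => hweyl.torsion_free Y Z x (mem_univ x) hY hZ
      preserves_conformal := by
        intro g' hg'
        obtain ⟨θ', hθ'⟩ := (hweyl.of_conformal hg hg').conformal
        exact ⟨θ', fun Y Z x v hY hZ => hθ' Y Z x (mem_univ x) v hY hZ⟩
      eq_zero_of_not_mdifferentiableAt := fun Y x hY => if_neg hY }
  refine ⟨W, ⟨?_, ?_⟩, ?_⟩
  · intro Y x v hY hD
    change nabla Y x v ∈ D₁ x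
    rw [hself x Y hY]
    exact (had x).preserves₁ Y x (hxU x) v hY hD
  · intro Y x v hY hD
    change nabla Y x v ∈ D₂ x
    rw [hself x Y hY]
    exact (had x).preserves₂ Y x (hxU x) v hY hD
  · intro W' hW'
    refine WeylStructure.ext_nabla fun Y x hY => ?_
    refine Eq.trans ?_ (hself x Y hY).symm
    exact (h x).unique _ _ _ _ univ_mem ((hU x).mem_nhds (hxU x)) (WeylStructure.isAdaptedOn hg hW')
      (had x) Y hY

end WeylConnections

/-! ### Split charts of conformal products -/

section ProductCharts

variable {E : Type*} [NormedAddCommGroup E] [NormedSpace ℝ E] [FiniteDimensional ℝ E]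
  {H : Type*} [TopologicalSpace H] {I : ModelWithCorners ℝ E H}
  {M : Type*} [TopologicalSpace M] [ChartedSpace H M] [IsManifold I ∞ M]
  {E₁ : Type*} [NormedAddCommGroup E₁] [NormedSpace ℝ E₁] [FiniteDimensional ℝ E₁]
  {H₁ : Type*} [TopologicalSpace H₁] {I₁ : ModelWithCorners ℝ E₁ H₁}
  {M₁ : Type*} [TopologicalSpace M₁] [ChartedSpace H₁ M₁] [IsManifold I₁ ∞ M₁]
  {E₂ : Type*} [NormedAddCommGroup E₂] [NormedSpace ℝ E₂] [FiniteDimensional ℝ E₂]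
  {H₂ : Type*} [TopologicalSpace H₂] {I₂ : ModelWithCorners ℝ E₂ H₂}
  {M₂ : Type*} [TopologicalSpace M₂] [ChartedSpace H₂ M₂] [IsManifold I₂ ∞ M₂]

namespace SmoothChart

variable (I) in
/-- The preferred chart at `x` of a manifold without boundary. -/
def atPoint [I.Boundaryless] (x : M) : SmoothChart I M E where
  toOpenPartialHomeomorph := (chartAt H x).trans I.toHomeomorph.toOpenPartialHomeomorph
  smooth := by
    refine (contMDiffOn_extChartAt (I := I) (n := ∞) (x := x)).mono ?_
    intro y hy
    simpa using hy
  smooth_symm := by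
    refine (contMDiffOn_extChartAt_symm (I := I) (n := ∞) x).mono ?_
    intro y hy
    have h : I.symm y ∈ (chartAt H x).target := by simpa using hy
    rw [extChartAt_target, I.range_eq_univ]
    exact ⟨h, trivial⟩

lemma mem_source_atPoint [I.Boundaryless] (x : M) : x ∈ (atPoint I x).source := by
  simp [atPoint]

/-- The chart with values in `E₁ × E₂` given by a diffeomorphism to a product manifold and by charts
of the factors. -/
def prodChart (Ψ : OpenPartialHomeomorph M (M₁ × M₂))
    (hΨ : ContMDiffOn I (I₁.prod I₂) ∞ Ψ Ψ.source)
    (hΨ' : ContMDiffOn (I₁.prod I₂) I ∞ Ψ.symm Ψ.target)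
    (Φ₁ : SmoothChart I₁ M₁ E₁) (Φ₂ : SmoothChart I₂ M₂ E₂) : SmoothChart I M (E₁ × E₂) where
  toOpenPartialHomeomorph :=
    Ψ.trans (Φ₁.toOpenPartialHomeomorph.prod Φ₂.toOpenPartialHomeomorph)
  smooth := by
    have hΨs : ContMDiffOn I (I₁.prod I₂) ∞ Ψ
        (Ψ.trans (Φ₁.toOpenPartialHomeomorph.prod Φ₂.toOpenPartialHomeomorph)).source :=
      hΨ.mono fun y hy => hy.1
    exact (Φ₁.smooth.comp (contMDiff_fst.comp_contMDiffOn hΨs) fun y hy => hy.2.1).prodMk_space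
      (Φ₂.smooth.comp (contMDiff_snd.comp_contMDiffOn hΨs) fun y hy => hy.2.2)
  smooth_symm := by
    have h1 : ContMDiffOn 𝓘(ℝ, E₁ × E₂) I₁ ∞ (fun p : E₁ × E₂ => Φ₁.inv p.1)
        (Ψ.trans (Φ₁.toOpenPartialHomeomorph.prod Φ₂.toOpenPartialHomeomorph)).target :=
      Φ₁.smooth_symm.comp contDiff_fst.contMDiff.contMDiffOn fun p hp => hp.1.1
    have h2 : ContMDiffOn 𝓘(ℝ, E₁ × E₂) I₂ ∞ (fun p : E₁ × E₂ => Φ₂.inv p.2)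
        (Ψ.trans (Φ₁.toOpenPartialHomeomorph.prod Φ₂.toOpenPartialHomeomorph)).target :=
      Φ₂.smooth_symm.comp contDiff_snd.contMDiff.contMDiffOn fun p hp => hp.1.2
    exact hΨ'.comp (h1.prodMk h2) fun p hp => hp.2

variable {Ψ : OpenPartialHomeomorph M (M₁ × M₂)}
    {hΨ : ContMDiffOn I (I₁.prod I₂) ∞ Ψ Ψ.source}
    {hΨ' : ContMDiffOn (I₁.prod I₂) I ∞ Ψ.symm Ψ.target}
    {Φ₁ : SmoothChart I₁ M₁ E₁} {Φ₂ : SmoothChart I₂ M₂ E₂}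

lemma mem_source_prodChart {y : M} : y ∈ (prodChart Ψ hΨ hΨ' Φ₁ Φ₂).source ↔
    y ∈ Ψ.source ∧ (Ψ y).1 ∈ Φ₁.source ∧ (Ψ y).2 ∈ Φ₂.source := by
  simp [prodChart]

lemma coframe_prodChart {y : M} (hy : y ∈ (prodChart Ψ hΨ hΨ' Φ₁ Φ₂).source)
    (v : TangentSpace I y) : (prodChart Ψ hΨ hΨ' Φ₁ Φ₂).coframe y v =
      (Φ₁.coframe (Ψ y).1 (mfderiv I I₁ (fun y => (Ψ y).1) y v),
        Φ₂.coframe (Ψ y).2 (mfderiv I I₂ (fun y => (Ψ y).2) y v)) := by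
  obtain ⟨h0, h1, h2⟩ := mem_source_prodChart.1 hy
  have hd : ContMDiffAt I (I₁.prod I₂) ∞ Ψ y := hΨ.contMDiffAt (Ψ.open_source.mem_nhds h0)
  have hd1 : MDifferentiableAt I I₁ (fun y => (Ψ y).1) y :=
    (contMDiffAt_fst.comp y hd).mdifferentiableAt (by simp)
  have hd2 : MDifferentiableAt I I₂ (fun y => (Ψ y).2) y :=
    (contMDiffAt_snd.comp y hd).mdifferentiableAt (by simp)
  have h3 : HasMFDerivAt I 𝓘(ℝ, E₁) (fun y => Φ₁ (Ψ y).1) y _ :=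
    ((contMDiffAt h1).mdifferentiableAt (by simp)).hasMFDerivAt.comp y hd1.hasMFDerivAt
  have h4 : HasMFDerivAt I 𝓘(ℝ, E₂) (fun y => Φ₂ (Ψ y).2) y _ :=
    ((contMDiffAt h2).mdifferentiableAt (by simp)).hasMFDerivAt.comp y hd2.hasMFDerivAt
  have h5 : HasMFDerivAt I 𝓘(ℝ, E₁ × E₂) (fun y => (Φ₁ (Ψ y).1, Φ₂ (Ψ y).2)) y _ :=
    ⟨h3.1.prodMk h4.1, h3.2.prodMk h4.2⟩
  exact DFunLike.congr_fun h5.mfderiv v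

lemma isSplit_prodChart : (prodChart Ψ hΨ hΨ' Φ₁ Φ₂).IsSplit
    (kerD I I₂ fun y => (Ψ y).2) (kerD I I₁ fun y => (Ψ y).1) where
  mem₁ y hy v := by
    obtain ⟨h0, h1, h2⟩ := mem_source_prodChart.1 hy
    rw [coframe_prodChart hy]
    exact ((map_eq_zero_iff _ (coframe_injective h2)).symm :)
  mem₂ y hy v := by
    obtain ⟨h0, h1, h2⟩ := mem_source_prodChart.1 hy
    rw [coframe_prodChart hy]
    exact ((map_eq_zero_iff _ (coframe_injective h1)).symm :)

/-- In a chart of a conformal product, the metric is block diagonal, and each block is conformal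
to a metric of the corresponding factor. -/
lemma isConformalBlock_prodChart {c : ConformalStructure I M} {c₁ : ConformalStructure I₁ M₁}
    {c₂ : ConformalStructure I₂ M₂} {g : Metric I M} (hg : c.HasMetric g)
    (h₁ : IsConformalSubmersionOn c c₁ (fun y => (Ψ y).1) Ψ.source)
    (h₂ : IsConformalSubmersionOn c c₂ (fun y => (Ψ y).2) Ψ.source)
    (horth : ∀ y ∈ Ψ.source, ∀ v ∈ kerD I I₁ (fun y => (Ψ y).1) y,
      ∀ w ∈ kerD I I₂ (fun y => (Ψ y).2) y, c.Orthogonal y v w) :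
    IsConformalBlock ((prodChart Ψ hΨ hΨ' Φ₁ Φ₂).metric g) (prodChart Ψ hΨ hΨ' Φ₁ Φ₂).target := by
  set Φ := prodChart Ψ hΨ hΨ' Φ₁ Φ₂ with hΦ
  obtain ⟨g₁, hg₁⟩ := Quotient.exists_rep c₁
  obtain ⟨g₂, hg₂⟩ := Quotient.exists_rep c₂
  have hs : Φ.IsSplit (kerD I I₂ fun y => (Ψ y).2) (kerD I I₁ fun y => (Ψ y).1) :=
    isSplit_prodChart
  have hm1 : ∀ y ∈ Φ.source, ∀ a, Φ.frame y (a, 0) ∈ kerD I I₂ (fun y => (Ψ y).2) y := by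
    intro y hy a
    rw [hs.mem₁ y hy, coframe_frame hy]
  have hm2 : ∀ y ∈ Φ.source, ∀ a, Φ.frame y (0, a) ∈ kerD I I₁ (fun y => (Ψ y).1) y := by
    intro y hy a
    rw [hs.mem₂ y hy, coframe_frame hy]
  have horth' : ∀ y ∈ Φ.source, ∀ v ∈ kerD I I₂ (fun y => (Ψ y).2) y,
      ∀ w ∈ kerD I I₁ (fun y => (Ψ y).1) y, c.Orthogonal y v w := by
    intro y hy v hv w hw g' hg'
    rw [g'.symm]
    exact horth y (mem_source_prodChart.1 hy).1 w hw v hv g' hg'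
  have hb1 : ∀ p ∈ Φ.target, ∃ r : ℝ, 0 < r ∧ ∀ a b,
      Φ₁.metric g₁ p.1 a b = r * Φ.metric g p (a, 0) (b, 0) := by
    intro p hp
    have hy : Φ.inv p ∈ Φ.source := Φ.map_target hp
    set y := Φ.inv p with hyp
    obtain ⟨h0, h3, h4⟩ := mem_source_prodChart.1 hy
    obtain ⟨-, hr⟩ := h₁.2 y h0
    obtain ⟨r, hr0, hr⟩ := hr g g₁ hg hg₁
    have hp1 : Φ₁ (Ψ y).1 = p.1 := congrArg Prod.fst (Φ.right_inv hp)
    have hd : ∀ a,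
        Φ₁.coframe (Ψ y).1 (mfderiv I I₁ (fun y => (Ψ y).1) y (Φ.frame y (a, 0))) = a := by
      intro a
      have h5 := coframe_prodChart hy (Φ.frame y (a, 0))
      rw [← hΦ, coframe_frame hy] at h5
      exact (congrArg Prod.fst h5).symm
    refine ⟨r, hr0, fun a b => ?_⟩
    have h6 := hr (Φ.frame y (a, 0)) (Φ.frame y (b, 0))
      (fun u hu => horth' y hy _ (hm1 y hy a) u hu) (fun u hu => horth' y hy _ (hm1 y hy b) u hu)
    rw [← metric_coframe (Φ := Φ₁) g₁ h3, hd, hd, hp1] at h6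
    exact h6
  have hb2 : ∀ p ∈ Φ.target, ∃ r : ℝ, 0 < r ∧ ∀ a b,
      Φ₂.metric g₂ p.2 a b = r * Φ.metric g p (0, a) (0, b) := by
    intro p hp
    have hy : Φ.inv p ∈ Φ.source := Φ.map_target hp
    set y := Φ.inv p with hyp
    obtain ⟨h0, h3, h4⟩ := mem_source_prodChart.1 hy
    obtain ⟨-, hr⟩ := h₂.2 y h0
    obtain ⟨r, hr0, hr⟩ := hr g g₂ hg hg₂
    have hp1 : Φ₂ (Ψ y).2 = p.2 := congrArg Prod.snd (Φ.right_inv hp)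
    have hd : ∀ a,
        Φ₂.coframe (Ψ y).2 (mfderiv I I₂ (fun y => (Ψ y).2) y (Φ.frame y (0, a))) = a := by
      intro a
      have h5 := coframe_prodChart hy (Φ.frame y (0, a))
      rw [← hΦ, coframe_frame hy] at h5
      exact (congrArg Prod.snd h5).symm
    refine ⟨r, hr0, fun a b => ?_⟩
    have h6 := hr (Φ.frame y (0, a)) (Φ.frame y (0, b))
      (fun u hu => horth y h0 _ (hm2 y hy a) u hu) (fun u hu => horth y h0 _ (hm2 y hy b) u hu)
    rw [← metric_coframe (Φ := Φ₂) g₂ h4, hd, hd, hp1] at h6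
    exact h6
  have hratio : ∀ {r r' k m m' : ℝ}, 0 < r' → k = r * m → k = r' * m' → m' = r / r' * m := by
    intro r r' k m m' h1 h2 h3
    field_simp
    linarith
  refine ⟨fun p hp => isScalarProduct_metric g hp, fun p hp a b => ?_, fun x y y' hp hp' => ?_,
    fun x x' y hp hp' => ?_⟩
  · have hy : Φ.inv p ∈ Φ.source := Φ.map_target hp
    exact horth' _ hy _ (hm1 _ hy a) _ (hm2 _ hy b) g hg
  · obtain ⟨r, hr, h⟩ := hb1 _ hp
    obtain ⟨r', hr', h'⟩ := hb1 _ hp'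
    exact ⟨r / r', fun a b => hratio hr' (h a b) (h' a b)⟩
  · obtain ⟨r, hr, h⟩ := hb2 _ hp
    obtain ⟨r', hr', h'⟩ := hb2 _ hp'
    exact ⟨r / r', fun a b => hratio hr' (h a b) (h' a b)⟩

end SmoothChart

open SmoothChart

/-- Each point of a conformal product has a split chart in which the metric is conformally block
diagonal. -/
theorem exists_split_chart [I₁.Boundaryless] [I₂.Boundaryless]
    {Ψ : OpenPartialHomeomorph M (M₁ × M₂)}
    (hΨ : ContMDiffOn I (I₁.prod I₂) ∞ Ψ Ψ.source)
    (hΨ' : ContMDiffOn (I₁.prod I₂) I ∞ Ψ.symm Ψ.target)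
    {c : ConformalStructure I M} {c₁ : ConformalStructure I₁ M₁}
    {c₂ : ConformalStructure I₂ M₂} {g : Metric I M} (hg : c.HasMetric g)
    (h₁ : IsConformalSubmersionOn c c₁ (fun y => (Ψ y).1) Ψ.source)
    (h₂ : IsConformalSubmersionOn c c₂ (fun y => (Ψ y).2) Ψ.source)
    (horth : ∀ y ∈ Ψ.source, ∀ v ∈ kerD I I₁ (fun y => (Ψ y).1) y,
      ∀ w ∈ kerD I I₂ (fun y => (Ψ y).2) y, c.Orthogonal y v w) {x : M} (hx : x ∈ Ψ.source) :
    ∃ Φ : SmoothChart I M (E₁ × E₂), x ∈ Φ.source ∧ Φ.source ⊆ Ψ.source ∧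
      Φ.IsSplit (kerD I I₂ fun y => (Ψ y).2) (kerD I I₁ fun y => (Ψ y).1) ∧
      IsConformalBlock (Φ.metric g) Φ.target :=
  ⟨prodChart Ψ hΨ hΨ' (atPoint I₁ (Ψ x).1) (atPoint I₂ (Ψ x).2),
    mem_source_prodChart.2 ⟨hx, mem_source_atPoint _, mem_source_atPoint _⟩,
    fun _ hy => (mem_source_prodChart.1 hy).1, isSplit_prodChart,
    isConformalBlock_prodChart hg h₁ h₂ horth⟩

lemma SmoothChart.IsSplit.congr {Φ : SmoothChart I M (E₁ × E₂)}
    {D₁ D₂ D₁' D₂' : (x : M) → Submodule ℝ (TangentSpace I x)} (h : Φ.IsSplit D₁ D₂)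
    (h₁ : ∀ y ∈ Φ.source, D₁ y = D₁' y) (h₂ : ∀ y ∈ Φ.source, D₂ y = D₂' y) :
    Φ.IsSplit D₁' D₂' where
  mem₁ y hy v := by rw [← h₁ y hy, h.mem₁ y hy]
  mem₂ y hy v := by rw [← h₂ y hy, h.mem₂ y hy]

/-- Each point of a manifold with a local conformal product structure has a split chart in which
the metric is conformally block diagonal. -/
theorem ConformalProductNeighborhood.exists_split_chart {c : ConformalStructure I M}
    {D₁ D₂ : (x : M) → Submodule ℝ (TangentSpace I x)} {x : M}
    (N : ConformalProductNeighborhood c D₁ D₂ x) {g : Metric I M} (hg : c.HasMetric g) :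
    ∃ Φ : SmoothChart I M (EuclideanSpace ℝ (Fin N.n₁) × EuclideanSpace ℝ (Fin N.n₂)),
      x ∈ Φ.source ∧ Φ.IsSplit D₁ D₂ ∧ IsConformalBlock (Φ.metric g) Φ.target := by
  let _ := N.top₁
  let _ := N.top₂
  let _ := N.charted₁
  let _ := N.charted₂
  have := N.mfd₁
  have := N.mfd₂
  obtain ⟨Φ, hx, hsub, hs, hb⟩ := ConformalProducts.exists_split_chart N.smooth
    N.smooth_symm.contMDiffOn hg N.conformal₁ N.conformal₂ N.orthogonal N.mem_source
  exact ⟨Φ, hx, hs.congr (fun y hy => N.ker₂_eq y (hsub hy)) (fun y hy => N.ker₁_eq y (hsub hy)),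
    hb⟩

end ProductCharts

/-! ### Parallel transport in a chart -/

section Transport

variable {E : Type*} [NormedAddCommGroup E] [NormedSpace ℝ E] [FiniteDimensional ℝ E]
  {H : Type*} [TopologicalSpace H] {I : ModelWithCorners ℝ E H}
  {M : Type*} [TopologicalSpace M] [ChartedSpace H M] [IsManifold I ∞ M]
  {F : Type*} [NormedAddCommGroup F] [NormedSpace ℝ F] [FiniteDimensional ℝ F]

namespace SmoothChart

variable {Φ : SmoothChart I M F}

lemma contMDiffAt_symm_trivialization {x y : M}
    (hy : y ∈ (trivializationAt E (TangentSpace I : M → Type _) x).baseSet) (u : E) :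
    CMDiffAt ∞ (T% (fun z : M =>
      (trivializationAt E (TangentSpace I : M → Type _) x).symm z u)) y := by
  set e := trivializationAt E (TangentSpace I : M → Type _) x
  have h := e.contMDiffOn_symm (IB := I) (n := ∞)
  have h1 : ContMDiffAt I (I.prod 𝓘(ℝ, E)) ∞ (fun z : M => ((z, u) : M × E)) y :=
    contMDiffAt_id.prodMk contMDiffAt_const
  have h2 := (h.contMDiffAt (x := (y, u)) (e.open_target.mem_nhds
    (e.mem_target.2 hy))).comp y h1
  refine h2.congr_of_eventuallyEq ?_
  filter_upwards [e.open_baseSet.mem_nhds hy] with z hz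
  exact (e.mk_symm hz u)

set_option maxHeartbeats 1000000 in
/-- The covariant derivative of a vector field along a curve, in a chart. -/
theorem coframe_covDerivAlong (nabla : CovariantDerivative I E (TangentSpace I : M → Type _))
    {W : ℝ → TangentBundle I M} {t : ℝ} (hW : ContMDiffAt 𝓘(ℝ, ℝ) I.tangent ∞ W t)
    (ht : (W t).proj ∈ Φ.source) :
    Φ.coframe (W t).proj (covDerivAlong nabla W t) =
      deriv (fun s => Φ.coframe (W s).proj (W s).2) t +
        Φ.christoffel nabla.toFun (Φ (W t).proj) (Φ.coframe (W t).proj (W t).2)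
          (deriv (fun s => Φ (W s).proj) t) := by
  set x := (W t).proj with hx
  set e := trivializationAt E (TangentSpace I : M → Type _) x with he
  have hxe : x ∈ e.baseSet := FiberBundle.mem_baseSet_trivializationAt' x
  obtain ⟨hproj, hfib⟩ := contMDiffAt_totalSpace.1 hW
  have ha : DifferentiableAt ℝ (fun s => (e (W s)).2) t :=
    hfib.contDiffAt.differentiableAt (by simp)
  have hγ : MDifferentiableAt 𝓘(ℝ, ℝ) I (fun s => (W s).proj) t := hproj.mdifferentiableAt (by simp)
  have hΦ : MDifferentiableAt I 𝓘(ℝ, F) Φ x := (contMDiffAt ht).mdifferentiableAt (by simp)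
  set γ' : TangentSpace I x := mfderiv 𝓘(ℝ, ℝ) I (fun s => (W s).proj) t (1 : ℝ) with hγ'
  have hderiv : HasDerivAt (fun s => Φ (W s).proj) (Φ.coframe x γ') t := by
    let γ'' : ℝ →L[ℝ] F :=
      ContinuousLinearMap.comp (Φ.coframe x) (mfderiv 𝓘(ℝ, ℝ) I (fun s => (W s).proj) t)
    have h1 : HasFDerivAt (fun s => Φ (W s).proj) γ'' t :=
      (hΦ.hasMFDerivAt.comp t hγ.hasMFDerivAt).hasFDerivAt
    exact h1.hasDerivAt
  -- the transition from the bundle trivialization to the chart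
  let T : F → E →L[ℝ] F := fun q =>
    ContinuousLinearMap.comp (Φ.coframe (Φ.inv q)) (e.symmL ℝ (Φ.inv q))
  have hT : ∀ q, Φ.inv q ∈ e.baseSet → ∀ u, T q u = Φ.push (fun y => e.symm y u) q := by
    intro q hq u
    simp only [T, ContinuousLinearMap.comp_apply, push]
    rw [Trivialization.symmL_apply (hb := hq)]
  let U : Set F := Φ.target ∩ Φ.inv ⁻¹' e.baseSet
  have hU : IsOpen U := Φ.symm.continuousOn.isOpen_inter_preimage Φ.open_target e.open_baseSet
  have hinv : Φ.inv (Φ x) = x := Φ.left_inv ht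
  have hxU : Φ x ∈ U := ⟨Φ.map_source ht, by rw [mem_preimage, hinv]; exact hxe⟩
  have hTs : ContDiffOn ℝ ∞ T U := by
    rw [contDiffOn_clm_apply]
    intro u q hq
    refine ContDiffAt.contDiffWithinAt ?_
    have h1 := contDiffAt_push (Φ := Φ) (Φ.map_target hq.1)
      (contMDiffAt_symm_trivialization (I := I) (x := x) hq.2 u)
    rw [show Φ (Φ.toOpenPartialHomeomorph.symm q) = q from Φ.right_inv hq.1] at h1
    refine h1.congr_of_eventuallyEq ?_
    filter_upwards [hU.mem_nhds hq] with q' hq'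
    exact hT q' hq'.2 u
  have hTd : DifferentiableAt ℝ T (Φ x) :=
    (hTs.contDiffAt (hU.mem_nhds hxU)).differentiableAt (by simp)
  have hcont : ContinuousAt (fun s => (W s).proj) t := hproj.continuousAt
  have hev : (fun s => Φ.coframe (W s).proj (W s).2) =ᶠ[𝓝 t]
      fun s => T (Φ (W s).proj) ((e (W s)).2) := by
    filter_upwards [hcont.eventually (eventually_source ht),
      hcont.eventually (e.open_baseSet.mem_nhds hxe)] with s hs hse
    have h1 : ∀ y, y = (W s).proj → Φ.coframe y (e.symm y (e (W s)).2) =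
        Φ.coframe (W s).proj (W s).2 := by
      rintro y rfl
      congr 1
      exact e.symm_apply_apply_mk hse (W s).2
    have h2 : Φ.inv (Φ (W s).proj) = (W s).proj := Φ.left_inv hs
    rw [hT _ (by rw [h2]; exact hse)]
    exact (h1 _ h2).symm
  have h1 : HasDerivAt (fun s => T (Φ (W s).proj) ((e (W s)).2))
      (fderiv ℝ T (Φ x) (Φ.coframe x γ') (e (W t)).2 +
        T (Φ x) (deriv (fun s => (e (W s)).2) t)) t :=
    (hTd.hasFDerivAt.comp_hasDerivAt t hderiv).clm_apply ha.hasDerivAt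
  rw [hev.deriv_eq, h1.deriv, hderiv.deriv]
  have hY : MDiffAt (T% (fun y : M => e.symm y (e (W t)).2)) x :=
    (contMDiffAt_symm_trivialization hxe _).mdifferentiableAt (by simp)
  have h2 : covDerivAlong nabla W t = e.symm x (deriv (fun s => (e (W s)).2) t) +
      nabla (fun y => e.symm y (e (W t)).2) x γ' := rfl
  have h3 : e.symm x (e (W t)).2 = (W t).2 := e.symm_apply_apply_mk hxe (W t).2
  have h4 : T (Φ x) (deriv (fun s => (e (W s)).2) t) =
      Φ.coframe x (e.symm x (deriv (fun s => (e (W s)).2) t)) :=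
    (hT _ hxU.2 _).trans
      (push_apply (Φ := Φ) ht (fun y => e.symm y (deriv (fun s => (e (W s)).2) t)))
  have h5 : HasFDerivAt (Φ.push (fun y => e.symm y (e (W t)).2))
      ((fderiv ℝ T (Φ x)).flip (e (W t)).2) (Φ x) := by
    have := hTd.hasFDerivAt.clm_apply (hasFDerivAt_const (e (W t)).2 (Φ x))
    refine (this.congr_fderiv ?_).congr_of_eventuallyEq ?_
    · ext v
      simp
    · filter_upwards [hU.mem_nhds hxU] with q hq
      exact (hT q hq.2 _).symm
  rw [h2, map_add, coframe_cov nabla.isCovariantDerivativeOnUniv univ_mem ht hY, h3, h5.fderiv, h4,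
    ContinuousLinearMap.flip_apply]
  abel

end SmoothChart

/-! ### Invariance of a parallel distribution under the holonomy group -/

/-- Uniqueness in both directions of time: `eq_zero_of_linear_ode`, and its reflection. -/
lemma eq_zero_of_linear_ode_on_ball {X : Type*} [NormedAddCommGroup X] [NormedSpace ℝ X]
    {L : ℝ → X →L[ℝ] X} {ξ : ℝ → X} {c r s : ℝ} (hL : ContinuousOn L (Metric.ball c r))
    (hξ : ∀ t ∈ Metric.ball c r, HasDerivAt ξ (L t (ξ t)) t) (hs : s ∈ Metric.ball c r)
    (h0 : ξ s = 0) : ∀ t ∈ Metric.ball c r, ξ t = 0 := by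
  intro t ht
  have hconv : ∀ {a b}, a ∈ Metric.ball c r → b ∈ Metric.ball c r → Icc a b ⊆ Metric.ball c r :=
    fun ha hb => (convex_ball c r).ordConnected.out ha hb
  rcases le_total s t with hst | hst
  · exact eq_zero_of_linear_ode (hL.mono (hconv hs ht)) (fun τ hτ => hξ τ (hconv hs ht hτ)) h0 t
      ⟨hst, le_rfl⟩
  · have hsub : ∀ τ ∈ Icc (-s) (-t), -τ ∈ Metric.ball c r := fun τ hτ =>
      hconv ht hs ⟨by linarith [hτ.2], by linarith [hτ.1]⟩
    have h1 := eq_zero_of_linear_ode (ξ := fun τ => ξ (-τ)) (L := fun τ => -L (-τ))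
      (a := -s) (b := -t) ((hL.comp continuous_neg.continuousOn hsub).neg) (fun τ hτ => by
        have h2 := (hξ (-τ) (hsub τ hτ)).scomp τ (hasDerivAt_neg τ)
        have h3 : HasDerivAt (fun τ => ξ (-τ)) ((-1 : ℝ) • (L (-τ)) (ξ (-τ))) τ := h2
        simpa using h3) (by simpa using h0) (-t) ⟨by linarith, le_rfl⟩
    simpa using h1

variable {E₁ : Type*} [NormedAddCommGroup E₁] [NormedSpace ℝ E₁] [FiniteDimensional ℝ E₁]
  {E₂ : Type*} [NormedAddCommGroup E₂] [NormedSpace ℝ E₂] [FiniteDimensional ℝ E₂]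
  {D₁ D₂ : (x : M) → Submodule ℝ (TangentSpace I x)}

open SmoothChart

/-- Along a curve in a split chart, a parallel vector field which is tangent to `D₁` at one point is
tangent to `D₁` everywhere: its component in `E₂` satisfies a linear differential equation. -/
lemma SmoothChart.IsSplit.parallel_mem [T2Space M] {Ψ : SmoothChart I M (E₁ × E₂)}
    (hΨ : Ψ.IsSplit D₁ D₂) {nabla : CovariantDerivative I E (TangentSpace I : M → Type _)}
    (hsm : CovariantDerivative.ContMDiffCovariantDerivative nabla ∞)
    (h₁ : PreservesDistribution nabla D₁) (h₂ : PreservesDistribution nabla D₂)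
    {W : ℝ → TangentBundle I M} (hW : ContMDiff 𝓘(ℝ, ℝ) I.tangent ∞ W)
    (hpar : ∀ t, covDerivAlong nabla W t = 0) {c r : ℝ}
    (hsub : ∀ t ∈ Metric.ball c r, (W t).proj ∈ Ψ.source) {s t : ℝ} (hs : s ∈ Metric.ball c r)
    (ht : t ∈ Metric.ball c r) (h : (W s).2 ∈ D₁ (W s).proj) : (W t).2 ∈ D₁ (W t).proj := by
  rw [hΨ.mem₁ _ (hsub _ hs)] at h
  rw [hΨ.mem₁ _ (hsub _ ht)]
  have hγ : ∀ t ∈ Metric.ball c r, ContDiffAt ℝ ∞ (fun s => Ψ (W s).proj) t := fun t ht =>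
    ((contMDiffAt (hsub t ht)).comp t (contMDiffAt_totalSpace.1 (hW t)).1).contDiffAt
  have hw : ∀ t ∈ Metric.ball c r,
      ContDiffAt ℝ ∞ (fun s => Ψ.coframe (W s).proj (W s).2) t := fun t ht =>
    ((contMDiffAt_coframe (hsub t ht)).comp t (hW t)).contDiffAt
  let L : ℝ → E₂ →L[ℝ] E₂ := fun t => -(ContinuousLinearMap.snd ℝ E₁ E₂ ∘L
    ((Ψ.christoffel nabla.toFun (Ψ (W t).proj)).flip (deriv (fun s => Ψ (W s).proj) t)) ∘L
      ContinuousLinearMap.inr ℝ E₁ E₂)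
  refine eq_zero_of_linear_ode_on_ball (L := L) (ξ := fun s => (Ψ.coframe (W s).proj (W s).2).2)
    (c := c) (r := r) ?_ ?_ hs h t ht
  · intro t ht
    refine ContinuousAt.continuousWithinAt ?_
    have h1 : ContinuousAt (fun t => deriv (fun s => Ψ (W s).proj) t) t := by
      have h2 := ((hγ t ht).fderiv_right (m := ∞) (by simp)).continuousAt
      exact (h2.clm_apply continuousAt_const)
    have h3 : ContinuousAt (fun t => (Ψ.christoffel nabla.toFun (Ψ (W t).proj)).flip) t := by
      have h4 : ContinuousAt (Ψ.christoffel nabla.toFun) (Ψ (W t).proj) :=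
        (contDiffOn_christoffel hsm).continuousOn.continuousAt
          (eventually_target (Ψ.map_source (hsub t ht)))
      exact
        (ContinuousLinearMap.flipₗᵢ ℝ (E₁ × E₂) (E₁ × E₂) (E₁ × E₂)).continuous.continuousAt.comp
        (h4.comp (f := fun t => Ψ (W t).proj) (hγ t ht).continuousAt)
    exact (continuousAt_const.clm_comp ((h3.clm_apply h1).clm_comp continuousAt_const)).neg
  · intro t ht
    have h1 := coframe_covDerivAlong (Φ := Ψ) nabla (hW t) (hsub t ht)
    rw [hpar t, map_zero] at h1
    have h2 := ((hw t ht).differentiableAt (by simp)).hasDerivAt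
    have h3 := (ContinuousLinearMap.snd ℝ E₁ E₂).hasFDerivAt.comp_hasDerivAt t h2
    refine h3.congr_deriv ?_
    have hb := hΨ.isBlock nabla.isCovariantDerivativeOnUniv (preservesOn_univ_iff.2 h₁)
      (preservesOn_univ_iff.2 h₂) univ_mem (hsub t ht)
    rw [eq_neg_of_add_eq_zero_left h1.symm]
    set w := Ψ.coframe (W t).proj (W t).2
    have h4 : w = (w.1, 0) + (0, w.2) := by ext <;> simp
    conv_lhs => rw [h4]
    rw [map_add, add_apply, map_neg, map_add]
    change -((Ψ.christoffel nabla.toFun (Ψ (W t).proj) (w.1, 0) _).2 + _) = _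
    rw [hb.snd_eq_zero, zero_add]
    rfl

/-- A distribution `D` is locally parallel if, along each curve in a small open set, a parallel
vector field which is tangent to `D` at one point is tangent to `D` everywhere. -/
def IsLocallyParallel (nabla : CovariantDerivative I E (TangentSpace I : M → Type _))
    (D : (x : M) → Submodule ℝ (TangentSpace I x)) : Prop :=
  ∀ x, ∃ U ∈ 𝓝 x, ∀ W : ℝ → TangentBundle I M, ContMDiff 𝓘(ℝ, ℝ) I.tangent ∞ W →
    (∀ t, covDerivAlong nabla W t = 0) → ∀ c r, (∀ t ∈ Metric.ball c r, (W t).proj ∈ U) →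
      ∀ s ∈ Metric.ball c r, ∀ t ∈ Metric.ball c r,
        (W s).2 ∈ D (W s).proj → (W t).2 ∈ D (W t).proj

/-- Parallel transports preserve a locally parallel distribution. -/
lemma IsParallelTransport.mem
    {nabla : CovariantDerivative I E (TangentSpace I : M → Type _)}
    {D : (x : M) → Submodule ℝ (TangentSpace I x)} (hloc : IsLocallyParallel nabla D)
    {x y : M} {A : TangentSpace I x ≃ₗ[ℝ] TangentSpace I y} (hA : IsParallelTransport nabla x y A) :
    ∀ v ∈ D x, A v ∈ D y := by
  induction hA with
  | segment x y γ A start finish smooth parallel =>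
    intro v hv
    obtain ⟨W, hW, hproj, hpar, hW0, hW1⟩ := parallel v
    have hloc' : ∀ c, ∃ r > 0, ∀ s ∈ Metric.ball c r, ∀ t ∈ Metric.ball c r,
        (W s).2 ∈ D (W s).proj → (W t).2 ∈ D (W t).proj := by
      intro c
      obtain ⟨U, hU, h⟩ := hloc (W c).proj
      have hcont : ContinuousAt (fun s => (W s).proj) c :=
        (contMDiffAt_totalSpace.1 (hW c)).1.continuousAt
      obtain ⟨r, hr, hsub⟩ := Metric.eventually_nhds_iff_ball.1
        (hcont.eventually hU)
      exact ⟨r, hr, h W hW hpar c r hsub⟩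
    have hclopen : IsClopen {t | (W t).2 ∈ D (W t).proj} := by
      constructor
      · refine isClosed_iff_nhds.2 fun c hc => ?_
        obtain ⟨r, hr, h⟩ := hloc' c
        obtain ⟨s, hs, hsD⟩ := hc _ (Metric.ball_mem_nhds c hr)
        exact h s hs c (Metric.mem_ball_self hr) hsD
      · refine Metric.isOpen_iff.2 fun c hc => ?_
        obtain ⟨r, hr, h⟩ := hloc' c
        exact ⟨r, hr, fun t ht => h c (Metric.mem_ball_self hr) t ht hc⟩
    have huniv := hclopen.eq_univ ⟨0, by
      change (W 0).2 ∈ D (W 0).proj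
      rw [hW0]; exact hv⟩
    have h1 : (1 : ℝ) ∈ {t | (W t).2 ∈ D (W t).proj} := by rw [huniv]; exact mem_univ _
    change (W 1).2 ∈ D (W 1).proj at h1
    rw [hW1] at h1
    exact h1
  | trans x y z A B _ _ hA hB => exact fun v hv => hB _ (hA v hv)

/-- A locally parallel distribution is invariant under the holonomy group. -/
lemma IsLocallyParallel.holonomy_mem
    {nabla : CovariantDerivative I E (TangentSpace I : M → Type _)}
    {D : (x : M) → Submodule ℝ (TangentSpace I x)} (hloc : IsLocallyParallel nabla D) {x : M}
    {A : TangentSpace I x ≃ₗ[ℝ] TangentSpace I x} (hA : A ∈ holonomyGroup nabla x) :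
    ∀ v ∈ D x, A v ∈ D x := by
  have : FiniteDimensional ℝ (TangentSpace I x) := inferInstanceAs (FiniteDimensional ℝ E)
  induction hA using Subgroup.closure_induction with
  | mem A hA => exact hA.mem hloc
  | one => exact fun v hv => hv
  | mul A B _ _ hA hB => exact fun v hv => hA _ (hB v hv)
  | inv A _ hA =>
    intro v hv
    -- an injective map of a finite-dimensional space into itself is onto
    have h1 : (D x).map (A : TangentSpace I x →ₗ[ℝ] TangentSpace I x) = D x := by
      refine Submodule.eq_of_le_of_finrank_eq ?_ (LinearEquiv.finrank_map_eq A (D x))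
      rintro _ ⟨u, hu, rfl⟩
      exact hA u hu
    rw [← h1] at hv
    obtain ⟨u, hu, rfl⟩ := hv
    change A⁻¹ (A u) ∈ D x
    rwa [show A⁻¹ (A u) = u from A.symm_apply_apply u]

lemma SmoothChart.IsSplit.ne_bot [Nontrivial E₁] {Ψ : SmoothChart I M (E₁ × E₂)}
    (hΨ : Ψ.IsSplit D₁ D₂) {x : M} (hx : x ∈ Ψ.source) : D₁ x ≠ ⊥ := by
  obtain ⟨e, he⟩ := exists_ne (0 : E₁)
  intro h
  have h1 : Ψ.frame x (e, 0) ∈ D₁ x := by rw [hΨ.mem₁ x hx, coframe_frame hx]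
  rw [h, Submodule.mem_bot] at h1
  have h2 := coframe_frame hx (e, (0 : E₂))
  rw [h1, map_zero] at h2
  exact he (congrArg Prod.fst h2).symm

lemma SmoothChart.IsSplit.ne_top [Nontrivial E₂] {Ψ : SmoothChart I M (E₁ × E₂)}
    (hΨ : Ψ.IsSplit D₁ D₂) {x : M} (hx : x ∈ Ψ.source) : D₁ x ≠ ⊤ := by
  obtain ⟨e, he⟩ := exists_ne (0 : E₂)
  intro h
  have h1 : Ψ.frame x (0, e) ∈ D₁ x := h ▸ Submodule.mem_top
  rw [hΨ.mem₁ x hx, coframe_frame hx] at h1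
  exact he h1

end Transport

/-! ### Parallel transport along radial segments -/

section Radial

/-- `P v` is the parallel transport, along the segment from `p₀` to `p₀ + v`, for the connection
with Christoffel symbols `Γ`. Rescaling the segment turns the equation of parallel transport into
the equation `ode` along rays. -/
structure IsRadialTransport {F : Type*} [NormedAddCommGroup F] [NormedSpace ℝ F]
    (Γ : F → F →L[ℝ] F →L[ℝ] F) (p₀ : F) (P : F → F →L[ℝ] F) (r : ℝ) : Prop where
  pos : 0 < r
  smooth : ContDiffOn ℝ ∞ P (Metric.ball 0 r)
  zero : P 0 = ContinuousLinearMap.id ℝ F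
  equiv : ∀ v ∈ Metric.ball (0 : F) r, ∃ e : F ≃L[ℝ] F, (e : F →L[ℝ] F) = P v
  ode : ∀ v ∈ Metric.ball (0 : F) r, ∀ a, fderiv ℝ P v v a = -Γ (p₀ + v) (P v a) v

/-- The radial transport solves a linear radial equation in the space of endomorphisms of `F`, with
initial value the identity. -/
lemma exists_isRadialTransport {F : Type*} [NormedAddCommGroup F] [NormedSpace ℝ F]
    [FiniteDimensional ℝ F] {U : Set F} (hU : IsOpen U) {Γ : F → F →L[ℝ] F →L[ℝ] F}
    (hΓ : ContDiffOn ℝ ∞ Γ U) {p₀ : F} (hp₀ : p₀ ∈ U) :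
    ∃ P r, IsRadialTransport Γ p₀ P r ∧ ∀ v ∈ Metric.ball (0 : F) r, p₀ + v ∈ U := by
  obtain ⟨Γ', hΓ', heq⟩ := exists_contDiff_eventuallyEq hU hΓ hp₀
  let B : (F →L[ℝ] F) × F → F →L[ℝ] (F →L[ℝ] F) := fun z =>
    -((ContinuousLinearMap.compL ℝ F F F).flip z.1 ∘L (Γ' (p₀ + z.2)).flip)
  have hBapp : ∀ z w a, B z w a = -Γ' (p₀ + z.2) (z.1 a) w := fun z w a => rfl
  have hB : ContDiff ℝ ∞ B := by
    have h1 : ContDiff ℝ ∞ fun z : (F →L[ℝ] F) × F => (Γ' (p₀ + z.2)).flip :=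
      (ContinuousLinearMap.flipₗᵢ ℝ F F F).contDiff.comp
        (hΓ'.comp (contDiff_const.add contDiff_snd))
    have h2 : ContDiff ℝ ∞ fun z : (F →L[ℝ] F) × F =>
        (ContinuousLinearMap.compL ℝ F F F).flip z.1 :=
      ((ContinuousLinearMap.compL ℝ F F F).flip).contDiff.comp contDiff_fst
    exact (h2.clm_comp h1).neg
  obtain ⟨S, r₁, hr₁, hS, hS0, hode⟩ := exists_radial_solution hB (ContinuousLinearMap.id ℝ F)
  let P : F → F →L[ℝ] F := fun v => S (ContinuousLinearMap.id ℝ F, v)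
  have hmem : ∀ v : F, v ∈ Metric.ball (0 : F) r₁ →
      (ContinuousLinearMap.id ℝ F, v) ∈ Metric.ball (ContinuousLinearMap.id ℝ F, (0 : F)) r₁ := by
    intro v hv
    rw [Metric.mem_ball, dist_prod_same_left]
    exact hv
  have hP : ContDiffOn ℝ ∞ P (Metric.ball 0 r₁) :=
    hS.comp (contDiff_const.prodMk contDiff_id).contDiffOn hmem
  have hP0 : P 0 = ContinuousLinearMap.id ℝ F := hS0 _ (hmem 0 (Metric.mem_ball_self hr₁))
  have hPc : ContinuousAt P 0 := hP.continuousOn.continuousAt (Metric.ball_mem_nhds 0 hr₁)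
  have hadd : ContinuousAt (fun v : F => p₀ + v) 0 := by fun_prop
  have hadd0 : Tendsto (fun v : F => p₀ + v) (𝓝 0) (𝓝 p₀) := by simpa [ContinuousAt] using hadd
  have hinv : ∀ᶠ v in 𝓝 (0 : F), P v ∈ range ((↑) : (F ≃L[ℝ] F) → F →L[ℝ] F) := by
    have h1 := ContinuousLinearEquiv.nhds (ContinuousLinearEquiv.refl ℝ F)
    refine hPc.eventually ?_
    rw [hP0]
    exact h1
  obtain ⟨r, hr, h⟩ := Metric.eventually_nhds_iff_ball.1
    (hinv.and ((hadd0.eventually heq).and ((hadd0.eventually (hU.mem_nhds hp₀)).and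
      (Metric.ball_mem_nhds (0 : F) hr₁))))
  have hsub : Metric.ball (0 : F) r ⊆ Metric.ball 0 r₁ := fun v hv => (h v hv).2.2.2
  refine ⟨P, r, ⟨hr, hP.mono hsub, hP0, fun v hv => (h v hv).1, fun v hv a => ?_⟩,
    fun v hv => (h v hv).2.2.1⟩
  have h1 := hode (ContinuousLinearMap.id ℝ F) v (hmem v (hsub hv))
  have h2 : HasFDerivAt P (fderiv ℝ S (ContinuousLinearMap.id ℝ F, v) ∘L
      ContinuousLinearMap.inr ℝ (F →L[ℝ] F) F) v := by
    have h3 : HasFDerivAt S (fderiv ℝ S (ContinuousLinearMap.id ℝ F, v))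
        (ContinuousLinearMap.id ℝ F, v) :=
      ((hS.contDiffAt (Metric.isOpen_ball.mem_nhds (hmem v (hsub hv)))).differentiableAt
        (by simp)).hasFDerivAt
    exact h3.comp v (hasFDerivAt_prodMk_right _ v)
  rw [h2.fderiv]
  have h4 : Γ' (p₀ + v) = Γ (p₀ + v) := (h v hv).2.1
  rw [← h4, ← hBapp (P v, v)]
  exact DFunLike.congr_fun h1 a

/-- The first order expansion of the radial transport. -/
lemma IsRadialTransport.fderiv_zero {F : Type*} [NormedAddCommGroup F] [NormedSpace ℝ F]
    {Γ : F → F →L[ℝ] F →L[ℝ] F} {p₀ : F} {P : F → F →L[ℝ] F} {r : ℝ}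
    (h : IsRadialTransport Γ p₀ P r) (hΓ : ContinuousAt Γ p₀) (w a : F) :
    fderiv ℝ P 0 w a = -Γ p₀ a w := by
  have hball : Metric.ball (0 : F) r ∈ 𝓝 0 := Metric.ball_mem_nhds 0 h.pos
  have h1 : ContinuousAt (fderiv ℝ P) 0 :=
    ((h.smooth.contDiffAt hball).fderiv_right (m := ∞) (by simp)).continuousAt
  have h2 : ContinuousAt P 0 := h.smooth.continuousOn.continuousAt hball
  have hs : ContinuousAt (fun t : ℝ => t • w) 0 := by fun_prop
  have hs0 : Tendsto (fun t : ℝ => t • w) (𝓝[≠] 0) (𝓝 0) := by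
    have : Tendsto (fun t : ℝ => t • w) (𝓝 0) (𝓝 0) := by simpa [ContinuousAt] using hs
    exact this.mono_left nhdsWithin_le_nhds
  have hl : Tendsto (fun t : ℝ => fderiv ℝ P (t • w) w a) (𝓝[≠] 0) (𝓝 (fderiv ℝ P 0 w a)) :=
    (((h1.clm_apply continuousAt_const).clm_apply continuousAt_const).tendsto.comp hs0 :)
  have hr : Tendsto (fun t : ℝ => -Γ (p₀ + t • w) (P (t • w) a) w) (𝓝[≠] 0)
      (𝓝 (-Γ p₀ a w)) := by
    have h3 : ContinuousAt (fun v => Γ (p₀ + v)) 0 := by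
      refine ContinuousAt.comp (f := fun v => p₀ + v) (g := Γ) ?_ (by fun_prop)
      simpa using hΓ
    have h4 : ContinuousAt (fun v => -Γ (p₀ + v) (P v a) w) 0 :=
      ((h3.clm_apply (h2.clm_apply continuousAt_const)).clm_apply continuousAt_const).neg
    have h5 := h4.tendsto.comp hs0
    simp only [h.zero, add_zero] at h5
    exact h5
  refine tendsto_nhds_unique_of_eventuallyEq hl hr ?_
  filter_upwards [hs0.eventually hball, self_mem_nhdsWithin] with t ht ht0
  have h6 := h.ode _ ht a
  rw [map_smul, map_smul, smul_apply, ← smul_neg] at h6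
  exact smul_right_injective F ht0 h6

/-- The radial transport satisfies the equation of parallel transport along each reparametrization
of a ray, with velocity `s' • v` at `s • v`; at the origin the equation `ode` is void, which is
why `s'` has to vanish there. -/
lemma IsRadialTransport.ode_smul {F : Type*} [NormedAddCommGroup F] [NormedSpace ℝ F]
    {Γ : F → F →L[ℝ] F →L[ℝ] F} {p₀ : F} {P : F → F →L[ℝ] F} {r : ℝ}
    (h : IsRadialTransport Γ p₀ P r) {v : F} {s s' : ℝ} (hs : s • v ∈ Metric.ball (0 : F) r)
    (hs' : s = 0 → s' = 0) (a : F) :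
    fderiv ℝ P (s • v) (s' • v) a + Γ (p₀ + s • v) (P (s • v) a) (s' • v) = 0 := by
  rcases eq_or_ne s 0 with h0 | h0
  · rw [hs' h0, zero_smul, map_zero, map_zero, zero_apply, add_zero]
  · have h5 := h.ode _ hs a
    rw [map_smul, map_smul, smul_apply, ← smul_neg] at h5
    have h6 := smul_right_injective F h0 h5
    change fderiv ℝ P (s • v) v a = _ at h6
    rw [map_smul, map_smul, smul_apply, h6, smul_neg, neg_add_cancel]

variable {E : Type*} [NormedAddCommGroup E] [NormedSpace ℝ E] [FiniteDimensional ℝ E]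
  {H : Type*} [TopologicalSpace H] {I : ModelWithCorners ℝ E H}
  {M : Type*} [TopologicalSpace M] [ChartedSpace H M] [IsManifold I ∞ M]
  {F : Type*} [NormedAddCommGroup F] [NormedSpace ℝ F] [FiniteDimensional ℝ F]

namespace SmoothChart

variable {Φ : SmoothChart I M F}

lemma mk_frame_coframe {y : M} (hy : y ∈ Φ.source) (u : TangentSpace I y) :
    (⟨Φ.inv (Φ y), Φ.frame (Φ.inv (Φ y)) (Φ.coframe y u)⟩ : TangentBundle I M) = ⟨y, u⟩ := by
  have h : ∀ x, x = y → (⟨x, Φ.frame x (Φ.coframe y u)⟩ : TangentBundle I M) = ⟨y, u⟩ := by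
    rintro x rfl
    rw [frame_coframe hy]
  exact h _ (Φ.left_inv hy)

lemma covDerivAlong_eq_zero {nabla : CovariantDerivative I E (TangentSpace I : M → Type _)}
    {W : ℝ → TangentBundle I M} {t : ℝ} (hW : ContMDiffAt 𝓘(ℝ, ℝ) I.tangent ∞ W t)
    (ht : (W t).proj ∈ Φ.source) {w γ : ℝ → F} (hw : ∀ s, Φ.coframe (W s).proj (W s).2 = w s)
    (hγ : ∀ s, Φ (W s).proj = γ s)
    (h : deriv w t + Φ.christoffel nabla.toFun (γ t) (w t) (deriv γ t) = 0) :
    covDerivAlong nabla W t = 0 := by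
  apply coframe_injective ht
  rw [map_zero, coframe_covDerivAlong nabla hW ht, funext hw, funext hγ, hw, hγ, h]

/-- The radial transport defines parallel vector fields along all curves of the form
`p₀ + σ t • v`. -/
lemma parallel_radial {nabla : CovariantDerivative I E (TangentSpace I : M → Type _)} {p₀ : F}
    {P : F → F →L[ℝ] F} {r : ℝ} (hP : IsRadialTransport (Φ.christoffel nabla.toFun) p₀ P r)
    (hsub : ∀ v ∈ Metric.ball (0 : F) r, p₀ + v ∈ Φ.target) {v : F} {σ : ℝ → ℝ}
    (hσ : ContDiff ℝ ∞ σ) (hσ0 : ∀ t, 0 ≤ σ t) (hσv : ∀ t, σ t • v ∈ Metric.ball (0 : F) r)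
    (a : F) :
    ContMDiff 𝓘(ℝ, ℝ) I.tangent ∞ (fun t => (⟨Φ.inv (p₀ + σ t • v),
      Φ.frame (Φ.inv (p₀ + σ t • v)) (P (σ t • v) a)⟩ : TangentBundle I M)) ∧
    ∀ t, covDerivAlong nabla (fun t => (⟨Φ.inv (p₀ + σ t • v),
      Φ.frame (Φ.inv (p₀ + σ t • v)) (P (σ t • v) a)⟩ : TangentBundle I M)) t = 0 := by
  set W : ℝ → TangentBundle I M := fun t => ⟨Φ.inv (p₀ + σ t • v),
      Φ.frame (Φ.inv (p₀ + σ t • v)) (P (σ t • v) a)⟩ with hWdef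
  have ht : ∀ t, p₀ + σ t • v ∈ Φ.target := fun t => hsub _ (hσv t)
  have hs : ContDiff ℝ ∞ fun t => σ t • v := hσ.smul contDiff_const
  have hPs : ContDiff ℝ ∞ fun t => P (σ t • v) a := by
    have h1 : ContDiff ℝ ∞ fun t => P (σ t • v) := contDiff_iff_contDiffAt.2 fun t =>
      (hP.smooth.contDiffAt (Metric.isOpen_ball.mem_nhds (hσv t))).comp t hs.contDiffAt
    exact h1.clm_apply contDiff_const
  have hW : ContMDiff 𝓘(ℝ, ℝ) I.tangent ∞ W := by
    intro t
    have h1 : ContMDiffAt 𝓘(ℝ, ℝ) 𝓘(ℝ, F × F) ∞ (fun t => (p₀ + σ t • v, P (σ t • v) a)) t :=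
      ((contDiff_const.add hs).prodMk hPs).contMDiff.contMDiffAt
    exact (contMDiffAt_frame (Φ := Φ) (q := (p₀ + σ t • v, P (σ t • v) a)) (ht t)).comp t h1
  refine ⟨hW, fun t => ?_⟩
  have hsrc : ∀ t, (W t).proj ∈ Φ.source := fun t => Φ.map_target (ht t)
  have h3 : HasDerivAt (fun s => σ s • v) (deriv σ t • v) t :=
    ((hσ.differentiable (by simp)) t).hasDerivAt.smul_const v
  have h4 : HasDerivAt (fun s => P (σ s • v) a) (fderiv ℝ P (σ t • v) (deriv σ t • v) a) t := by
    have h5 : HasFDerivAt P (fderiv ℝ P (σ t • v)) (σ t • v) :=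
      ((hP.smooth.contDiffAt (Metric.isOpen_ball.mem_nhds (hσv t))).differentiableAt
        (by simp)).hasFDerivAt
    have h6 : HasDerivAt (fun s => P (σ s • v)) (fderiv ℝ P (σ t • v) (deriv σ t • v)) t :=
      HasFDerivAt.comp_hasDerivAt (f := fun s => σ s • v) t h5 h3
    exact ((ContinuousLinearMap.apply ℝ F a).hasFDerivAt.comp_hasDerivAt t h6)
  refine covDerivAlong_eq_zero (hW t) (hsrc t) (fun s => coframe_frame (hsrc s) _)
    (fun s => Φ.right_inv (ht s)) ?_
  rw [h4.deriv, (h3.const_add (p₀)).deriv]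
  refine hP.ode_smul (hσv t) (fun h0 => ?_) a
  -- where `σ` vanishes it has a minimum
  have h5 : IsLocalMin σ t := Filter.Eventually.of_forall fun s => by rw [h0]; exact hσ0 s
  exact h5.deriv_eq_zero

/-- Near each point, radial transport in a chart is a parallel transport, and so is its inverse. -/
theorem exists_radial_parallelTransport
    {nabla : CovariantDerivative I E (TangentSpace I : M → Type _)} {x : M} (hx : x ∈ Φ.source)
    {P : F → F →L[ℝ] F} {r : ℝ} (hP : IsRadialTransport (Φ.christoffel nabla.toFun) (Φ x) P r)
    (hsub : ∀ v ∈ Metric.ball (0 : F) r, Φ x + v ∈ Φ.target) {y : M} (hy : y ∈ Φ.source)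
    (hyr : Φ y - Φ x ∈ Metric.ball (0 : F) r) :
    ∃ A : TangentSpace I x ≃ₗ[ℝ] TangentSpace I y, IsParallelTransport nabla x y A ∧
      IsParallelTransport nabla y x A.symm ∧
      ∀ u, Φ.coframe y (A u) = P (Φ y - Φ x) (Φ.coframe x u) := by
  set v := Φ y - Φ x with hv
  obtain ⟨e, he⟩ := hP.equiv v hyr
  have he' : ∀ a, P v a = e a := fun a => by rw [← he]; rfl
  let A : TangentSpace I x ≃ₗ[ℝ] TangentSpace I y :=
    ((equivAt hx).trans (e.trans (equivAt hy).symm)).toLinearEquiv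
  have hA : ∀ u, Φ.coframe y (A u) = P v (Φ.coframe x u) := by
    intro u
    rw [he']
    exact (equivAt hy).apply_symm_apply _
  have hA' : ∀ w, P v (Φ.coframe x (A.symm w)) = Φ.coframe y w := by
    intro w
    rw [← hA, A.apply_symm_apply]
  have hpy : Φ x + (1 : ℝ) • v = Φ y := by rw [one_smul, hv]; abel
  have hpx : Φ x + (0 : ℝ) • v = Φ x := by rw [zero_smul, add_zero]
  have hmem : ∀ s ∈ Icc (0 : ℝ) 1, s • v ∈ Metric.ball (0 : F) r := by
    intro s hs
    rw [mem_ball_zero_iff, norm_smul, Real.norm_of_nonneg hs.1]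
    rw [mem_ball_zero_iff] at hyr
    exact (mul_le_of_le_one_left (norm_nonneg v) hs.2).trans_lt hyr
  -- this parametrization gives a smooth curve on all of `ℝ` which does not leave the segment
  have hI : ∀ t, Real.smoothTransition t ∈ Icc (0 : ℝ) 1 := fun t =>
    ⟨Real.smoothTransition.nonneg t, Real.smoothTransition.le_one t⟩
  have hsm : ContDiff ℝ ∞ Real.smoothTransition := Real.smoothTransition.contDiff
  have hsm' : ContDiff ℝ ∞ fun t : ℝ => Real.smoothTransition (1 - t) :=
    hsm.comp (contDiff_const.sub contDiff_id)
  have h0 : Real.smoothTransition 0 = 0 := Real.smoothTransition.zero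
  have h1 : Real.smoothTransition 1 = 1 := Real.smoothTransition.one
  have hinvx : Φ.inv (Φ x) = x := Φ.left_inv hx
  have hinvy : Φ.inv (Φ y) = y := Φ.left_inv hy
  -- the values of the parallel fields at the end points
  have hend : ∀ (a : F) (s : ℝ) (z : M) (w : TangentSpace I z), z ∈ Φ.source →
      Φ x + s • v = Φ z → P (s • v) a = Φ.coframe z w →
      (⟨Φ.inv (Φ x + s • v), Φ.frame (Φ.inv (Φ x + s • v)) (P (s • v) a)⟩ :
        TangentBundle I M) = ⟨z, w⟩ := by
    intro a s z w hz h2 h3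
    rw [h2, h3, mk_frame_coframe hz]
  have hcurve : ∀ σ : ℝ → ℝ, ContDiff ℝ ∞ σ → (∀ t, σ t ∈ Icc (0 : ℝ) 1) →
      ContMDiff 𝓘(ℝ, ℝ) I ∞ fun t => Φ.inv (Φ x + σ t • v) := by
    intro σ hσ hσI t
    have h2 : ContMDiffAt 𝓘(ℝ, ℝ) 𝓘(ℝ, F) ∞ (fun t => Φ x + σ t • v) t :=
      (contDiff_const.add (hσ.smul contDiff_const)).contMDiff.contMDiffAt
    exact (contMDiffAt_inv (hsub _ (hmem _ (hσI t)))).comp t h2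
  refine ⟨A, ?_, ?_, hA⟩
  · refine .segment x y (fun t => Φ.inv (Φ x + Real.smoothTransition t • v)) A
      (by simp only [h0, hpx, hinvx]) (by simp only [h1, hpy, hinvy]) (hcurve _ hsm hI) fun u => ?_
    obtain ⟨hW, hpar⟩ := parallel_radial hP hsub hsm (fun t => (hI t).1) (fun t => hmem _ (hI t))
      (Φ.coframe x u)
    refine ⟨_, hW, fun t => rfl, hpar, ?_, ?_⟩
    · refine hend _ _ x u hx (by rw [h0, hpx]) ?_
      rw [h0, zero_smul, hP.zero]; rfl
    · refine hend _ _ y (A u) hy (by rw [h1, hpy]) ?_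
      rw [h1, one_smul, hA]
  · refine .segment y x (fun t => Φ.inv (Φ x + Real.smoothTransition (1 - t) • v)) A.symm
      (by simp only [sub_zero, h1, hpy, hinvy]) (by simp only [sub_self, h0, hpx, hinvx])
      (hcurve _ hsm' fun t => hI _) fun w => ?_
    obtain ⟨hW, hpar⟩ := parallel_radial hP hsub hsm' (fun t => (hI _).1) (fun t => hmem _ (hI _))
      (Φ.coframe x (A.symm w))
    refine ⟨_, hW, fun t => rfl, hpar, ?_, ?_⟩
    · refine hend _ _ y w hy (by rw [sub_zero, h1, hpy]) ?_
      rw [sub_zero, h1, one_smul, hA']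
    · refine hend _ _ x (A.symm w) hx (by rw [sub_self, h0, hpx]) ?_
      rw [sub_self, h0, zero_smul, hP.zero]; rfl

end SmoothChart

end Radial

/-! ### The parallel distributions defined by an invariant subspace -/

section ParallelDistribution

variable {E : Type*} [NormedAddCommGroup E] [NormedSpace ℝ E] [FiniteDimensional ℝ E]
  {H : Type*} [TopologicalSpace H] {I : ModelWithCorners ℝ E H}
  {M : Type*} [TopologicalSpace M] [ChartedSpace H M] [IsManifold I ∞ M]
  {F : Type*} [NormedAddCommGroup F] [NormedSpace ℝ F] [FiniteDimensional ℝ F]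
  {nabla : CovariantDerivative I E (TangentSpace I : M → Type _)}

open SmoothChart

/-- Parallel transport reaches all points near `x`, along the rays of a chart. -/
lemma exists_nhds_parallelTransport [I.Boundaryless] [T2Space M]
    (hsm : CovariantDerivative.ContMDiffCovariantDerivative nabla ∞) (x : M) :
    ∃ U ∈ 𝓝 x, ∀ y ∈ U, ∃ A : TangentSpace I x ≃ₗ[ℝ] TangentSpace I y,
      IsParallelTransport nabla x y A ∧ IsParallelTransport nabla y x A.symm := by
  set Φ := atPoint I x
  have hx : x ∈ Φ.source := mem_source_atPoint x
  obtain ⟨P, r, hP, hsub⟩ := exists_isRadialTransport Φ.open_target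
    (contDiffOn_christoffel (Φ := Φ) hsm) (Φ.map_source hx)
  have h1 : Tendsto (fun y => Φ y - Φ x) (𝓝 x) (𝓝 0) := by
    simpa using (contMDiffAt hx).continuousAt.tendsto.sub_const (Φ x)
  refine ⟨_, (eventually_source hx).and (h1.eventually (Metric.ball_mem_nhds 0 hP.pos)),
    fun y hy => ?_⟩
  obtain ⟨A, hA, hA', -⟩ := exists_radial_parallelTransport hx hP hsub hy.1 hy.2
  exact ⟨A, hA, hA'⟩

/-- On a connected manifold, each point can be reached by parallel transport. -/
lemma exists_parallelTransport [I.Boundaryless] [T2Space M] [ConnectedSpace M]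
    (hsm : CovariantDerivative.ContMDiffCovariantDerivative nabla ∞) (x₀ y : M) :
    ∃ A : TangentSpace I x₀ ≃ₗ[ℝ] TangentSpace I y,
      IsParallelTransport nabla x₀ y A ∧ IsParallelTransport nabla y x₀ A.symm := by
  set R : Set M := {y | ∃ A : TangentSpace I x₀ ≃ₗ[ℝ] TangentSpace I y,
      IsParallelTransport nabla x₀ y A ∧ IsParallelTransport nabla y x₀ A.symm}
  have hR : IsClopen R := by
    constructor
    · refine isClosed_iff_nhds.2 fun z hz => ?_
      obtain ⟨U, hU, h⟩ := exists_nhds_parallelTransport hsm z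
      obtain ⟨y, hy, A, hA, hA'⟩ := hz U hU
      obtain ⟨B, hB, hB'⟩ := h y hy
      exact ⟨A.trans B.symm, .trans _ _ _ _ _ hA hB', .trans _ _ _ _ _ hB hA'⟩
    · refine isOpen_iff_mem_nhds.2 fun z ⟨A, hA, hA'⟩ => ?_
      obtain ⟨U, hU, h⟩ := exists_nhds_parallelTransport hsm z
      filter_upwards [hU] with y hy
      obtain ⟨B, hB, hB'⟩ := h y hy
      exact ⟨A.trans B, .trans _ _ _ _ _ hA hB, .trans _ _ _ _ _ hB' hA'⟩
  have hx₀ : x₀ ∈ R := by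
    obtain ⟨U, hU, h⟩ := exists_nhds_parallelTransport hsm x₀
    exact h x₀ (mem_of_mem_nhds hU)
  have h := hR.eq_univ ⟨x₀, hx₀⟩
  have hy : y ∈ R := by rw [h]; exact mem_univ y
  exact hy

/-- A subspace which is invariant under the holonomy group extends to a distribution which is
invariant under parallel transport. -/
lemma exists_parallel_distribution [I.Boundaryless] [T2Space M] [ConnectedSpace M]
    (hsm : CovariantDerivative.ContMDiffCovariantDerivative nabla ∞) {x₀ : M}
    {V : Submodule ℝ (TangentSpace I x₀)}
    (hV : ∀ A ∈ holonomyGroup nabla x₀, ∀ v ∈ V, A v ∈ V) :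
    ∃ D : (x : M) → Submodule ℝ (TangentSpace I x), D x₀ = V ∧
      ∀ (y z : M) (B : TangentSpace I y ≃ₗ[ℝ] TangentSpace I z),
        IsParallelTransport nabla y z B → ∀ v, B v ∈ D z ↔ v ∈ D y := by
  choose A hA hA' using exists_parallelTransport (nabla := nabla) hsm x₀
  let D : (x : M) → Submodule ℝ (TangentSpace I x) := fun y =>
    V.comap ((A y).symm : TangentSpace I y →ₗ[ℝ] TangentSpace I x₀)
  have hmem : ∀ y v, v ∈ D y ↔ (A y).symm v ∈ V := fun y v => Iff.rfl
  have hhol : ∀ L ∈ holonomyGroup nabla x₀, ∀ v, L v ∈ V ↔ v ∈ V := by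
    intro L hL v
    refine ⟨fun h => ?_, hV L hL v⟩
    have h1 := hV _ (inv_mem hL) _ h
    rwa [show L⁻¹ (L v) = v from L.symm_apply_apply v] at h1
  have hloop : ∀ {L : TangentSpace I x₀ ≃ₗ[ℝ] TangentSpace I x₀},
      IsParallelTransport nabla x₀ x₀ L → ∀ v, L v ∈ V ↔ v ∈ V := fun {L} hL =>
    hhol L (Subgroup.subset_closure hL)
  refine ⟨D, ?_, fun y z B hB v => ?_⟩
  · ext v
    rw [hmem]
    exact hloop (hA' x₀) v
  · rw [hmem, hmem, ← hloop (.trans _ _ _ _ _ (.trans _ _ _ _ _ (hA y) hB) (hA' z))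
      ((A y).symm v)]
    simp only [LinearEquiv.trans_apply, LinearEquiv.apply_symm_apply]

/-- In the chart, the distribution `D` is invariant under radial transport. -/
def SmoothChart.IsRadiallyParallel (Φ : SmoothChart I M F) (x : M) (P : F → F →L[ℝ] F) (r : ℝ)
    (D : (x : M) → Submodule ℝ (TangentSpace I x)) : Prop :=
  ∀ y ∈ Φ.source, Φ y - Φ x ∈ Metric.ball (0 : F) r →
    ∀ (u : TangentSpace I x) (w : TangentSpace I y),
      Φ.coframe y w = P (Φ y - Φ x) (Φ.coframe x u) → (w ∈ D y ↔ u ∈ D x)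

/-- A distribution which is invariant under radial transport from each point is preserved by the
connection. -/
lemma preservesDistribution_of_isRadiallyParallel [T2Space M]
    (hsm : CovariantDerivative.ContMDiffCovariantDerivative nabla ∞)
    {D : (x : M) → Submodule ℝ (TangentSpace I x)}
    (h : ∀ x, ∃ (Φ : SmoothChart I M E) (P : E → E →L[ℝ] E) (r : ℝ), x ∈ Φ.source ∧
      IsRadialTransport (Φ.christoffel nabla.toFun) (Φ x) P r ∧ Φ.IsRadiallyParallel x P r D) :
    PreservesDistribution nabla D := by
  intro Y x v hY hYD
  obtain ⟨Φ, P, r, hx, hP, hrad⟩ := h x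
  set p := Φ x with hp
  -- in the moving frame given by radial transport, `D` is the constant subspace `K`
  let K : Submodule ℝ E := (D x).map (Φ.coframe x : TangentSpace I x →ₗ[ℝ] E)
  have hK : ∀ u, Φ.coframe x u ∈ K ↔ u ∈ D x := by
    intro u
    refine ⟨?_, fun hu => ⟨u, hu, rfl⟩⟩
    rintro ⟨u', hu', he⟩
    rwa [← coframe_injective hx he]
  have hball : Metric.ball (0 : E) r ∈ 𝓝 0 := Metric.ball_mem_nhds 0 hP.pos
  have hPd : HasFDerivAt P (fderiv ℝ P 0) (p - p) := by
    rw [sub_self]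
    exact ((hP.smooth.contDiffAt hball).differentiableAt (by simp)).hasFDerivAt
  have hsub : HasFDerivAt (fun q => q - p) (ContinuousLinearMap.id ℝ E) p :=
    (hasFDerivAt_id p).sub_const p
  have hQ : HasFDerivAt (fun q => P (q - p)) (fderiv ℝ P 0) p :=
    HasFDerivAt.comp (f := fun q => q - p) p hPd hsub
  have hpush := differentiableAt_push hx hY
  let b : E → E := fun q => (P (q - p)).inverse (Φ.push Y q)
  have hb : DifferentiableAt ℝ b p := by
    have h1 : DifferentiableAt ℝ (fun q => (P (q - p)).inverse) p := by
      have h2 := (contDiffAt_map_inverse (𝕜 := ℝ) (n := 1)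
        (ContinuousLinearEquiv.refl ℝ E)).differentiableAt (by simp)
      have h3 : DifferentiableAt ℝ ContinuousLinearMap.inverse (P (p - p)) := by
        rw [sub_self, hP.zero]; exact h2
      exact DifferentiableAt.comp (f := fun q => P (q - p)) p h3 hQ.differentiableAt
    exact h1.clm_apply hpush
  have hsub0 : Tendsto (fun q => q - p) (𝓝 p) (𝓝 0) := by
    have := hsub.continuousAt.tendsto
    rwa [sub_self] at this
  have hinv : ContinuousAt Φ.inv p := (contMDiffAt_inv (Φ.map_source hx)).continuousAt
  have hinvx : Φ.inv p = x := Φ.left_inv hx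
  have hYD' : ∀ᶠ q in 𝓝 p, Y (Φ.inv q) ∈ D (Φ.inv q) := by
    rw [ContinuousAt, hinvx] at hinv
    exact hinv.eventually hYD
  have hPb : ∀ᶠ q in 𝓝 p, Φ.push Y q = P (q - p) (b q) := by
    filter_upwards [hsub0.eventually hball] with q hq
    obtain ⟨e, he⟩ := hP.equiv _ hq
    simp only [b]
    rw [← he, ContinuousLinearMap.inverse_equiv]
    exact (e.apply_symm_apply _).symm
  have hbK : ∀ᶠ q in 𝓝 p, b q ∈ K := by
    filter_upwards [hPb, hYD', hsub0.eventually hball, eventually_target (Φ.map_source hx)]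
      with q h1 h2 h3 h4
    have h5 : Φ (Φ.inv q) = q := Φ.right_inv h4
    rw [← coframe_frame hx (b q), hK, ← hrad (Φ.inv q) (Φ.map_target h4) (by rw [h5]; exact h3)
      (Φ.frame x (b q)) (Y (Φ.inv q)) (by rw [h5, coframe_frame hx, ← h1]; rfl)]
    exact h2
  have hbp : b p = Φ.coframe x (Y x) := by
    have := hPb.self_of_nhds
    rw [sub_self, hP.zero, push_apply hx] at this
    exact this.symm
  -- the derivative of a curve in a subspace lies in this subspace
  have hmem : ∀ w, fderiv ℝ b p w ∈ K := by
    intro w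
    have h1 : HasDerivAt (fun t : ℝ => p + t • w) w 0 := by
      simpa using ((hasDerivAt_id (0 : ℝ)).smul_const w).const_add p
    have h2 : HasFDerivAt b (fderiv ℝ b p) (p + (0 : ℝ) • w) := by simpa using hb.hasFDerivAt
    have h3 : HasDerivAt (fun t : ℝ => b (p + t • w)) (fderiv ℝ b p w) 0 :=
      HasFDerivAt.comp_hasDerivAt (f := fun t : ℝ => p + t • w) 0 h2 h1
    have h4 := h3.tendsto_slope_zero
    refine K.closed_of_finiteDimensional.mem_of_tendsto h4 ?_
    have h5 : Tendsto (fun t : ℝ => p + t • w) (𝓝 0) (𝓝 p) := by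
      have := h1.continuousAt.tendsto
      simpa using this
    filter_upwards [nhdsWithin_le_nhds (h5.eventually hbK)] with t ht
    simp only [zero_add, zero_smul, add_zero]
    exact K.smul_mem _ (K.sub_mem ht hbK.self_of_nhds)
  -- differentiating `Y = P b` produces the Christoffel symbol with the opposite sign
  have hderiv : ∀ w, fderiv ℝ (Φ.push Y) p w =
      -Φ.christoffel nabla.toFun p (Φ.coframe x (Y x)) w + fderiv ℝ b p w := by
    intro w
    have h1 := (hQ.clm_apply hb.hasFDerivAt).congr_of_eventuallyEq hPb
    have hΓ : ContinuousAt (Φ.christoffel nabla.toFun) p :=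
      (contDiffOn_christoffel hsm).continuousOn.continuousAt (eventually_target (Φ.map_source hx))
    rw [h1.fderiv, ← hbp, ← hP.fderiv_zero hΓ w (b p), sub_self, hP.zero]
    simp only [add_apply, ContinuousLinearMap.comp_apply, ContinuousLinearMap.flip_apply,
      ContinuousLinearMap.id_apply]
    abel
  rw [← hK, coframe_cov nabla.isCovariantDerivativeOnUniv univ_mem hx hY, hderiv, ← hp]
  rw [add_right_comm, neg_add_cancel, zero_add]
  exact hmem _

/-- Two solutions of the same homogeneous linear differential equation are proportional. -/
lemma mul_eq_mul_of_hasDerivAt {f h κ : ℝ → ℝ}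
    (hf : ∀ t ∈ Icc (0 : ℝ) 1, HasDerivAt f (κ t * f t) t)
    (hh : ∀ t ∈ Icc (0 : ℝ) 1, HasDerivAt h (κ t * h t) t) (hpos : ∀ t ∈ Icc (0 : ℝ) 1, h t ≠ 0) :
    f 1 * h 0 = f 0 * h 1 := by
  have h1 : ∀ t ∈ Icc (0 : ℝ) 1, HasDerivAt (fun t => f t / h t) 0 t := by
    intro t ht
    refine ((hf t ht).div (hh t ht) (hpos t ht)).congr_deriv ?_
    have := hpos t ht
    field_simp
    ring
  have h2 : f 1 / h 1 = f 0 / h 0 := constant_of_has_deriv_right_zero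
    (fun t ht => (h1 t ht).continuousAt.continuousWithinAt)
    (fun t ht => (h1 t ⟨ht.1, ht.2.le⟩).hasDerivWithinAt) 1 ⟨zero_le_one, le_rfl⟩
  rwa [div_eq_div_iff (hpos 1 ⟨zero_le_one, le_rfl⟩) (hpos 0 ⟨le_rfl, zero_le_one⟩)] at h2

/-- The radial transport is parallel along rays, including their origin. -/
lemma IsRadialTransport.fderiv_ray {Γ : F → F →L[ℝ] F →L[ℝ] F} {p₀ : F} {P : F → F →L[ℝ] F}
    {r : ℝ} (h : IsRadialTransport Γ p₀ P r) (hΓ : ContinuousAt Γ p₀) {t : ℝ} {v : F}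
    (ht : t • v ∈ Metric.ball (0 : F) r) (a : F) :
    fderiv ℝ P (t • v) v a = -Γ (p₀ + t • v) (P (t • v) a) v := by
  rcases eq_or_ne t 0 with rfl | h0
  · rw [zero_smul, add_zero, h.fderiv_zero hΓ, h.zero]; rfl
  · have h1 := h.ode_smul (s' := 1) ht (fun h => absurd h h0) a
    rw [one_smul] at h1
    exact eq_neg_of_add_eq_zero_left h1

/-- Radial transport for a connection with `∇ G = -2 θ ⊗ G` is conformal, in the sense that it
respects orthogonality: scalar products of parallel fields all satisfy `f' = -2 θ f`. -/
lemma IsRadialTransport.conformal {Γ : F → F →L[ℝ] F →L[ℝ] F} {p₀ : F} {P : F → F →L[ℝ] F}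
    {r : ℝ} (hP : IsRadialTransport Γ p₀ P r) (hΓ : ContinuousAt Γ p₀)
    {G : F → F →L[ℝ] F →L[ℝ] ℝ} {θ : F → F →L[ℝ] ℝ}
    (hG : ∀ v ∈ Metric.ball (0 : F) r, IsScalarProduct (G (p₀ + v)))
    (hGd : ∀ v ∈ Metric.ball (0 : F) r, DifferentiableAt ℝ G (p₀ + v))
    (hθ : ∀ v ∈ Metric.ball (0 : F) r, ∀ w a b, fderiv ℝ G (p₀ + v) w a b =
      G (p₀ + v) (Γ (p₀ + v) a w) b + G (p₀ + v) a (Γ (p₀ + v) b w) -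
        2 * θ (p₀ + v) w * G (p₀ + v) a b) {v : F} (hv : v ∈ Metric.ball (0 : F) r) (a b : F) :
    G p₀ a b = 0 ↔ G (p₀ + v) (P v a) (P v b) = 0 := by
  rcases eq_or_ne a 0 with rfl | ha
  · simp
  have hmem : ∀ t ∈ Icc (0 : ℝ) 1, t • v ∈ Metric.ball (0 : F) r := by
    intro s hs
    rw [mem_ball_zero_iff, norm_smul, Real.norm_of_nonneg hs.1]
    rw [mem_ball_zero_iff] at hv
    exact (mul_le_of_le_one_left (norm_nonneg v) hs.2).trans_lt hv
  have hinj : ∀ t ∈ Icc (0 : ℝ) 1, P (t • v) a ≠ 0 := by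
    intro t ht h0
    obtain ⟨e, he⟩ := hP.equiv _ (hmem t ht)
    rw [← he] at h0
    exact ha (e.map_eq_zero_iff.1 h0)
  let f : F → F → ℝ → ℝ := fun a b t => G (p₀ + t • v) (P (t • v) a) (P (t • v) b)
  have hf : ∀ a b, ∀ t ∈ Icc (0 : ℝ) 1,
      HasDerivAt (f a b) (-2 * θ (p₀ + t • v) v * f a b t) t := by
    intro a b t ht
    have h1 : HasDerivAt (fun t : ℝ => t • v) v t := by
      simpa using (hasDerivAt_id t).smul_const v
    have hPt : HasFDerivAt P (fderiv ℝ P (t • v)) (t • v) :=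
      ((hP.smooth.contDiffAt (Metric.isOpen_ball.mem_nhds (hmem t ht))).differentiableAt
        (by simp)).hasFDerivAt
    have h2 : HasDerivAt (fun t : ℝ => P (t • v)) (fderiv ℝ P (t • v) v) t :=
      HasFDerivAt.comp_hasDerivAt (f := fun t : ℝ => t • v) t hPt h1
    have h3 : ∀ a, HasDerivAt (fun t : ℝ => P (t • v) a)
        (-Γ (p₀ + t • v) (P (t • v) a) v) t := by
      intro a
      rw [← hP.fderiv_ray hΓ (hmem t ht)]
      exact (ContinuousLinearMap.apply ℝ F a).hasFDerivAt.comp_hasDerivAt t h2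
    have h4 : HasDerivAt (fun t : ℝ => G (p₀ + t • v)) (fderiv ℝ G (p₀ + t • v) v) t :=
      HasFDerivAt.comp_hasDerivAt (f := fun t : ℝ => p₀ + t • v) t
        (hGd _ (hmem t ht)).hasFDerivAt (h1.const_add p₀)
    refine ((h4.clm_apply (h3 a)).clm_apply (h3 b)).congr_deriv ?_
    rw [add_apply, hθ _ (hmem t ht), map_neg, map_neg, neg_apply]
    simp only [f]
    ring
  have h0 : ∀ b, f a b 0 = G p₀ a b := by
    intro b
    simp only [f, zero_smul, add_zero, hP.zero]
    rfl
  have h1 : ∀ b, f a b 1 = G (p₀ + v) (P v a) (P v b) := fun b => by simp only [f, one_smul]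
  have hpos : ∀ t ∈ Icc (0 : ℝ) 1, f a a t ≠ 0 := fun t ht =>
    ((hG _ (hmem t ht)).pos _ (hinj t ht)).ne'
  have h2 := mul_eq_mul_of_hasDerivAt (hf a b) (hf a a) hpos
  have h3 := hpos 0 ⟨le_rfl, zero_le_one⟩
  have h4 := hpos 1 ⟨zero_le_one, le_rfl⟩
  rw [← h0, ← h1]
  constructor
  · intro h
    rw [h, zero_mul] at h2
    exact (mul_eq_zero.1 h2).resolve_right h3
  · intro h
    rw [h, zero_mul] at h2
    exact (mul_eq_zero.1 h2.symm).resolve_right h4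

/-- The orthogonal complement of a distribution. -/
def orthogonalDistribution (g : Metric I M) (D : (x : M) → Submodule ℝ (TangentSpace I x))
    (x : M) : Submodule ℝ (TangentSpace I x) where
  carrier := {v | ∀ u ∈ D x, g.inner x u v = 0}
  add_mem' {v w} hv hw u hu := by rw [map_add, hv u hu, hw u hu, add_zero]
  zero_mem' u _ := map_zero _
  smul_mem' r v hv u hu := by rw [map_smul, hv u hu, smul_zero]

lemma mem_orthogonalDistribution {g : Metric I M} {D : (x : M) → Submodule ℝ (TangentSpace I x)}
    {x : M} {v : TangentSpace I x} :
    v ∈ orthogonalDistribution g D x ↔ ∀ u ∈ D x, g.inner x u v = 0 := Iff.rfl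

/-- Since parallel transport is conformal, a distribution which is invariant under parallel
transport and its orthogonal complement are both radially parallel in any chart. -/
theorem exists_isRadiallyParallel [T2Space M] {c : ConformalStructure I M} {W : WeylStructure c}
    {g : Metric I M} (hg : c.HasMetric g) {D : (x : M) → Submodule ℝ (TangentSpace I x)}
    (hD : ∀ (y z : M) (B : TangentSpace I y ≃ₗ[ℝ] TangentSpace I z),
        IsParallelTransport W.nabla y z B → ∀ v, B v ∈ D z ↔ v ∈ D y)
    (Φ : SmoothChart I M F) {x : M} (hx : x ∈ Φ.source) :
    ∃ P r, IsRadialTransport (Φ.christoffel W.nabla.toFun) (Φ x) P r ∧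
      (∀ v ∈ Metric.ball (0 : F) r, Φ x + v ∈ Φ.target) ∧
      Φ.IsRadiallyParallel x P r D ∧
      Φ.IsRadiallyParallel x P r (orthogonalDistribution g D) := by
  have hΓ := contDiffOn_christoffel (Φ := Φ) W.smooth
  obtain ⟨P, r, hP, hsub⟩ := exists_isRadialTransport Φ.open_target hΓ (Φ.map_source hx)
  obtain ⟨θ, hθ⟩ := fderiv_metric (Φ := Φ) (W.isWeylOn hg)
  have hconf := fun (v : F) (hv : v ∈ Metric.ball (0 : F) r) (a b : F) =>
    hP.conformal (hΓ.continuousOn.continuousAt (eventually_target (Φ.map_source hx)))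
    (G := Φ.metric g) (θ := θ) (fun v hv => isScalarProduct_metric g (hsub v hv))
    (fun v hv => ((contDiffOn_metric g).contDiffAt
      (eventually_target (hsub v hv))).differentiableAt (by simp))
    (fun v hv w a b => by
      have h1 := hθ (Φ.inv (Φ x + v)) (Φ.map_target (hsub v hv)) univ_mem w a b
      rwa [show Φ (Φ.inv (Φ x + v)) = Φ x + v from Φ.right_inv (hsub v hv)] at h1) hv a b
  have key : ∀ y ∈ Φ.source, Φ y - Φ x ∈ Metric.ball (0 : F) r →
      ∃ A : TangentSpace I x ≃ₗ[ℝ] TangentSpace I y, (∀ u, A u ∈ D y ↔ u ∈ D x) ∧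
        (∀ u, Φ.coframe y (A u) = P (Φ y - Φ x) (Φ.coframe x u)) := by
    intro y hy hyr
    obtain ⟨A, hA, -, hAP⟩ := exists_radial_parallelTransport hx hP hsub hy hyr
    exact ⟨A, hD x y A hA, hAP⟩
  refine ⟨P, r, hP, hsub, ?_, ?_⟩
  · intro y hy hyr u w hw
    obtain ⟨A, hA, hAP⟩ := key y hy hyr
    rw [← hAP] at hw
    rw [coframe_injective hy hw, hA]
  · intro y hy hyr u w hw
    obtain ⟨A, hA, hAP⟩ := key y hy hyr
    rw [← hAP] at hw
    rw [coframe_injective hy hw, mem_orthogonalDistribution, mem_orthogonalDistribution]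
    have hg0 : ∀ u', g.inner x u' u = 0 ↔ g.inner y (A u') (A u) = 0 := by
      intro u'
      have h1 := hconf _ hyr (Φ.coframe x u') (Φ.coframe x u)
      rw [← hAP, ← hAP, add_sub_cancel, metric_coframe g hx, metric_coframe g hy] at h1
      exact h1
    constructor
    · intro h u' hu'
      rw [hg0]
      exact h _ ((hA u').2 hu')
    · intro h w' hw'
      have h1 : A (A.symm w') = w' := A.apply_symm_apply w'
      rw [← h1, hA] at hw'
      rw [← h1, ← hg0]
      exact h _ hw'

end ParallelDistribution

/-! ### Integration of the parallel distributions -/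

section Integration

universe u

variable {E : Type*} [NormedAddCommGroup E] [NormedSpace ℝ E] [FiniteDimensional ℝ E]
  {H : Type*} [TopologicalSpace H] {I : ModelWithCorners ℝ E H}
  {M : Type*} [TopologicalSpace M] [ChartedSpace H M] [IsManifold I ∞ M]
  {F : Type*} [NormedAddCommGroup F] [NormedSpace ℝ F] [FiniteDimensional ℝ F]
  {F' : Type*} [NormedAddCommGroup F'] [NormedSpace ℝ F'] [FiniteDimensional ℝ F']

namespace SmoothChart

/-- The composition of a chart with a local diffeomorphism of vector spaces. -/
def transDiffeo (Φ : SmoothChart I M F) (e : OpenPartialHomeomorph F F')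
    (he : ContDiffOn ℝ ∞ e e.source) (he' : ContDiffOn ℝ ∞ e.symm e.target) :
    SmoothChart I M F' where
  toOpenPartialHomeomorph := Φ.toOpenPartialHomeomorph.trans e
  smooth := he.contMDiffOn.comp (Φ.smooth.mono fun _ hy => hy.1) fun _ hy => hy.2
  smooth_symm := Φ.smooth_symm.comp (he'.contMDiffOn.mono fun _ hy => hy.1) fun _ hy => hy.2

lemma mem_source_transDiffeo {Φ : SmoothChart I M F} {e : OpenPartialHomeomorph F F'}
    {he : ContDiffOn ℝ ∞ e e.source} {he' : ContDiffOn ℝ ∞ e.symm e.target} {y : M} :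
    y ∈ (Φ.transDiffeo e he he').source ↔ y ∈ Φ.source ∧ Φ y ∈ e.source := by
  simp [transDiffeo]

lemma coframe_transDiffeo {Φ : SmoothChart I M F} {e : OpenPartialHomeomorph F F'}
    {he : ContDiffOn ℝ ∞ e e.source} {he' : ContDiffOn ℝ ∞ e.symm e.target} {y : M}
    (hy : y ∈ (Φ.transDiffeo e he he').source) (v : TangentSpace I y) :
    (Φ.transDiffeo e he he').coframe y v = fderiv ℝ e (Φ y) (Φ.coframe y v) := by
  obtain ⟨h1, h2⟩ := mem_source_transDiffeo.1 hy
  have h3 : HasMFDerivAt I 𝓘(ℝ, F) Φ y (mfderiv I 𝓘(ℝ, F) Φ y) :=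
    ((contMDiffAt h1).mdifferentiableAt (by simp)).hasMFDerivAt
  have h4 : HasMFDerivAt 𝓘(ℝ, F) 𝓘(ℝ, F') e (Φ y) (fderiv ℝ e (Φ y)) :=
    ((he.contDiffAt (e.open_source.mem_nhds h2)).differentiableAt
      (by simp)).hasFDerivAt.hasMFDerivAt
  exact DFunLike.congr_fun (h4.comp y h3).mfderiv v

/-- The composition of a chart with a linear isomorphism. -/
def transLinear (Φ : SmoothChart I M F) (L : F ≃L[ℝ] F') : SmoothChart I M F' :=
  Φ.transDiffeo L.toHomeomorph.toOpenPartialHomeomorph L.contDiff.contDiffOn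
    L.symm.contDiff.contDiffOn

lemma mem_source_transLinear {Φ : SmoothChart I M F} {L : F ≃L[ℝ] F'} {y : M} :
    y ∈ (Φ.transLinear L).source ↔ y ∈ Φ.source := by
  refine mem_source_transDiffeo.trans ?_
  simp

lemma coframe_transLinear {Φ : SmoothChart I M F} {L : F ≃L[ℝ] F'} {y : M} (hy : y ∈ Φ.source)
    (v : TangentSpace I y) : (Φ.transLinear L).coframe y v = L (Φ.coframe y v) := by
  refine (coframe_transDiffeo (mem_source_transLinear.2 hy) v).trans ?_
  have h : fderiv ℝ L (Φ y) = (L : F →L[ℝ] F') := L.fderiv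
  exact DFunLike.congr_fun h _

end SmoothChart

open SmoothChart

section Graph

variable {X K : Type u} [NormedAddCommGroup X] [NormedSpace ℝ X] [FiniteDimensional ℝ X]
  [NormedAddCommGroup K] [NormedSpace ℝ K] [FiniteDimensional ℝ K]
  {D : (x : M) → Submodule ℝ (TangentSpace I x)}

/-- Near a point where it is `0 × K`, a radially parallel distribution is the graph of a smooth
family of linear maps from `K` to `X`. -/
lemma exists_graph {Γ : X × K → X × K →L[ℝ] X × K →L[ℝ] X × K} {Φ : SmoothChart I M (X × K)}
    {x : M} (hx : x ∈ Φ.source)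
    {P : X × K → X × K →L[ℝ] X × K} {r : ℝ} (hP : IsRadialTransport Γ (Φ x) P r)
    (hrad : Φ.IsRadiallyParallel x P r D) (hD : ∀ u, u ∈ D x ↔ (Φ.coframe x u).1 = 0) :
    ∃ (A : X × K → K →L[ℝ] X) (U : Set (X × K)), IsOpen U ∧ Φ x ∈ U ∧ U ⊆ Φ.target ∧
      ContDiffOn ℝ ∞ A U ∧ ∀ q ∈ U, ∀ w : TangentSpace I (Φ.inv q),
        w ∈ D (Φ.inv q) ↔ (Φ.coframe (Φ.inv q) w).1 = A q (Φ.coframe (Φ.inv q) w).2 := by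
  set p := Φ x with hp
  -- the transported subspace `P (0 × K)` is parametrized by `k ↦ (B k, C k)`
  let B : X × K → K →L[ℝ] X := fun q =>
    ContinuousLinearMap.fst ℝ X K ∘L P (q - p) ∘L ContinuousLinearMap.inr ℝ X K
  let C : X × K → K →L[ℝ] K := fun q =>
    ContinuousLinearMap.snd ℝ X K ∘L P (q - p) ∘L ContinuousLinearMap.inr ℝ X K
  have hPs : ∀ q, q - p ∈ Metric.ball (0 : X × K) r →
      ContDiffAt ℝ ∞ (fun q => P (q - p)) q := fun q hq =>
    ContDiffAt.comp (f := fun q => q - p) q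
      (hP.smooth.contDiffAt (Metric.isOpen_ball.mem_nhds hq)) (contDiffAt_id.sub contDiffAt_const)
  have hBs : ∀ q, q - p ∈ Metric.ball (0 : X × K) r → ContDiffAt ℝ ∞ B q := fun q hq =>
    contDiffAt_const.clm_comp ((hPs q hq).clm_comp contDiffAt_const)
  have hCs : ∀ q, q - p ∈ Metric.ball (0 : X × K) r → ContDiffAt ℝ ∞ C q := fun q hq =>
    contDiffAt_const.clm_comp ((hPs q hq).clm_comp contDiffAt_const)
  have hp0 : p - p ∈ Metric.ball (0 : X × K) r := by
    rw [sub_self]; exact Metric.mem_ball_self hP.pos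
  have hCp : C p = ((ContinuousLinearEquiv.refl ℝ K : K ≃L[ℝ] K) : K →L[ℝ] K) := by
    simp only [C, sub_self, hP.zero]
    ext k
    rfl
  have hinv : ∀ᶠ q in 𝓝 p, C q ∈ range ((↑) : (K ≃L[ℝ] K) → K →L[ℝ] K) := by
    refine (hCs p hp0).continuousAt.eventually ?_
    rw [hCp]
    exact ContinuousLinearEquiv.nhds _
  have hball : ∀ᶠ q in 𝓝 p, q - p ∈ Metric.ball (0 : X × K) r := by
    have h1 : ContinuousAt (fun q => q - p) p := by fun_prop
    exact h1.eventually (Metric.isOpen_ball.mem_nhds hp0)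
  obtain ⟨U, hU, hUo, hpU⟩ := eventually_nhds_iff.1
    (hinv.and (hball.and (eventually_target (Φ.map_source hx))))
  refine ⟨fun q => B q ∘L (C q).inverse, U, hUo, hpU, fun q hq => (hU q hq).2.2, ?_, ?_⟩
  · intro q hq
    obtain ⟨⟨e, he⟩, hqb, -⟩ := hU q hq
    have h1 := contDiffAt_map_inverse (𝕜 := ℝ) (n := ∞) e
    rw [he] at h1
    exact ((hBs q hqb).clm_comp (ContDiffAt.comp (f := C) q h1 (hCs q hqb))).contDiffWithinAt
  · intro q hq w
    obtain ⟨⟨e, he⟩, hqb, hqt⟩ := hU q hq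
    have hΦq : Φ (Φ.inv q) = q := Φ.right_inv hqt
    obtain ⟨f, hf⟩ := hP.equiv _ hqb
    set a := Φ.coframe (Φ.inv q) w
    set b := f.symm a with hb
    have hfb : P (q - p) b = a := by rw [← hf]; exact f.apply_symm_apply a
    have h1 : w ∈ D (Φ.inv q) ↔ b.1 = 0 := by
      rw [hrad (Φ.inv q) (Φ.map_target hqt) (by rw [hΦq]; exact hqb) (Φ.frame x b) w (by
        rw [hΦq, coframe_frame hx, hfb]), hD, coframe_frame hx]
    have hBC : ∀ k, P (q - p) (0, k) = (B q k, C q k) := fun k => rfl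
    rw [h1]
    change b.1 = 0 ↔ a.1 = B q ((C q).inverse a.2)
    rw [← he, ContinuousLinearMap.inverse_equiv]
    constructor
    · intro h0
      have h2 : b = (0, b.2) := by ext <;> simp [h0]
      rw [h2, hBC, ← he] at hfb
      rw [← hfb]
      change B q b.2 = B q (e.symm (e b.2))
      rw [e.symm_apply_apply]
    · intro h0
      have h2 : P (q - p) (0, e.symm a.2) = a := by
        rw [hBC]
        refine Prod.ext h0.symm ?_
        rw [← he]
        exact e.apply_symm_apply _
      have h3 : b = (0, e.symm a.2) := by
        apply f.injective
        rw [hb, f.apply_symm_apply]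
        rw [← hf] at h2
        exact h2.symm
      rw [h3]

/-- A parallel distribution of a torsion-free connection is integrable: near each point it is the
kernel of the differential of a smooth map. -/
theorem exists_first_integral {cov : LocalConnection I M}
    (htor : ∀ (Y Z : (x : M) → TangentSpace I x), ∀ x ∈ (univ : Set M),
      MDiffAt (T% Y) x → MDiffAt (T% Z) x →
        cov Z x (Y x) - cov Y x (Z x) = VectorField.mlieBracket I Y Z x)
    (hpres : PreservesOn cov D univ)
    {Γ : X × K → X × K →L[ℝ] X × K →L[ℝ] X × K} {Φ : SmoothChart I M (X × K)}
    {x : M} (hx : x ∈ Φ.source)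
    {P : X × K → X × K →L[ℝ] X × K} {r : ℝ} (hP : IsRadialTransport Γ (Φ x) P r)
    (hrad : Φ.IsRadiallyParallel x P r D) (hD : ∀ u, u ∈ D x ↔ (Φ.coframe x u).1 = 0) :
    ∃ (f : X × K → X) (U : Set (X × K)), IsOpen U ∧ Φ x ∈ U ∧ U ⊆ Φ.target ∧
      ContDiffOn ℝ ∞ f U ∧ ∀ q ∈ U, ∀ w : TangentSpace I (Φ.inv q),
        w ∈ D (Φ.inv q) ↔ fderiv ℝ f q (Φ.coframe (Φ.inv q) w) = 0 := by
  obtain ⟨A, U, hU, hxU, hUt, hA, hAD⟩ := exists_graph hx hP hrad hD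
  have hAd : ∀ z ∈ U, DifferentiableAt ℝ A z := fun z hz =>
    (hA.contDiffAt (hU.mem_nhds hz)).differentiableAt (by simp)
  have hint : ∀ z ∈ U, ∀ w₁ w₂, fderiv ℝ A z (A z w₁, w₁) w₂ = fderiv ℝ A z (A z w₂, w₂) w₁ := by
    intro z hz w₁ w₂
    set y := Φ.inv z with hy
    have hys : y ∈ Φ.source := Φ.map_target (hUt hz)
    have hΦy : Φ y = z := Φ.right_inv (hUt hz)
    -- the bracket of two such fields lies in `X × 0`, and by torsion-freeness in the distribution
    let V : K → X × K → X × K := fun w q => (A q w, w)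
    have hV : ∀ w, HasFDerivAt (V w) (((fderiv ℝ A z).flip w).prod 0) z := by
      intro w
      refine HasFDerivAt.prodMk ?_ (hasFDerivAt_const w z)
      refine ((hAd z hz).hasFDerivAt.clm_apply (hasFDerivAt_const w z)).congr_fderiv ?_
      ext u <;> simp
    have hVd : ∀ w, DifferentiableAt ℝ (V w) (Φ y) := fun w => by
      rw [hΦy]; exact (hV w).differentiableAt
    have hYd : ∀ w, MDiffAt (T% (Φ.pull (V w))) y := fun w => mdifferentiableAt_pull hys (hVd w)
    have hYD : ∀ w, ∀ᶠ q in 𝓝 y, Φ.pull (V w) q ∈ D q := by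
      intro w
      have h1 : ∀ᶠ q in 𝓝 y, Φ q ∈ U :=
        (contMDiffAt hys).continuousAt.eventually (hU.mem_nhds (by rw [hΦy]; exact hz))
      filter_upwards [h1, eventually_source hys] with q hq hqs
      have h2 : ∀ m, m = q → (∀ w : TangentSpace I m, w ∈ D m ↔
          (Φ.coframe m w).1 = A (Φ q) (Φ.coframe m w).2) → Φ.pull (V w) q ∈ D q := by
        rintro m rfl h3
        rw [h3, pull, coframe_frame hqs]
      exact h2 _ (Φ.left_inv hqs) (hAD _ hq)
    have hpush : ∀ w, fderiv ℝ (Φ.push (Φ.pull (V w))) z = ((fderiv ℝ A z).flip w).prod 0 := by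
      intro w
      have h1 : Φ.push (Φ.pull (V w)) =ᶠ[𝓝 z] V w := by
        filter_upwards [eventually_target (hUt hz)] with q hq
        rw [push_pull hq]
      rw [h1.fderiv_eq, (hV w).fderiv]
    have hco : ∀ w, Φ.coframe y (Φ.pull (V w) y) = (A z w, w) := by
      intro w
      rw [pull, coframe_frame hys, hΦy]
    have hmem : ∀ w w', cov (Φ.pull (V w)) y (Φ.pull (V w') y) ∈ D y := fun w w' =>
      hpres _ y (mem_univ y) _ (hYd w) (hYD w)
    have h1 := (D y).sub_mem (hmem w₂ w₁) (hmem w₁ w₂)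
    rw [htor _ _ y (mem_univ y) (hYd w₁) (hYd w₂), hAD z hz, coframe_mlieBracket hys (hYd w₁)
      (hYd w₂), hΦy, hpush, hpush, hco, hco] at h1
    have h2 : fderiv ℝ A z (A z w₁, w₁) w₂ - fderiv ℝ A z (A z w₂, w₂) w₁ = A z (0 - 0) := h1
    rw [sub_zero, map_zero] at h2
    exact sub_eq_zero.1 h2
  obtain ⟨f, U', hU'U, hU', hxU', hf, hker⟩ := exists_frobenius hU hA hxU hint
  refine ⟨f, U', hU', hxU', hU'U.trans hUt, hf, fun q hq w => ?_⟩
  rw [hker q hq, hAD q (hU'U hq)]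

end Graph

/-- Two complementary parallel distributions of a torsion-free connection are the tangent
distributions of the factors of a local product decomposition. -/
theorem exists_isSplit_of_isRadiallyParallel [I.Boundaryless]
    {cov : LocalConnection I M}
    (htor : ∀ (Y Z : (x : M) → TangentSpace I x), ∀ x ∈ (univ : Set M),
      MDiffAt (T% Y) x → MDiffAt (T% Z) x →
        cov Z x (Y x) - cov Y x (Z x) = VectorField.mlieBracket I Y Z x)
    {D₁ D₂ : (x : M) → Submodule ℝ (TangentSpace I x)}
    (h₁ : PreservesOn cov D₁ univ) (h₂ : PreservesOn cov D₂ univ)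
    (x : M) (hc : IsCompl (D₁ x) (D₂ x)) (n₁ n₂ : ℕ)
    (hn₁ : Module.finrank ℝ (D₁ x) = n₁) (hn₂ : Module.finrank ℝ (D₂ x) = n₂)
    (hrad : ∀ Φ : SmoothChart I M (EuclideanSpace ℝ (Fin n₁) × EuclideanSpace ℝ (Fin n₂)),
      x ∈ Φ.source → ∃ P r, IsRadialTransport (Φ.christoffel cov) (Φ x) P r ∧
        Φ.IsRadiallyParallel x P r D₂)
    (hrad' : ∀ Φ : SmoothChart I M (EuclideanSpace ℝ (Fin n₂) × EuclideanSpace ℝ (Fin n₁)),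
      x ∈ Φ.source → ∃ P r, IsRadialTransport (Φ.christoffel cov) (Φ x) P r ∧
        Φ.IsRadiallyParallel x P r D₁) :
    ∃ Φ : SmoothChart I M (EuclideanSpace ℝ (Fin n₁) × EuclideanSpace ℝ (Fin n₂)),
      x ∈ Φ.source ∧ Φ.IsSplit D₁ D₂ := by
  set Φ₀ := atPoint I x
  have hx₀ : x ∈ Φ₀.source := mem_source_atPoint x
  have : FiniteDimensional ℝ (TangentSpace I x) := inferInstanceAs (FiniteDimensional ℝ E)
  -- linear coordinates in which `D₁` and `D₂` are the two factors at `x`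
  let L₁ : D₁ x ≃ₗ[ℝ] EuclideanSpace ℝ (Fin n₁) :=
    LinearEquiv.ofFinrankEq _ _ (by rw [hn₁, finrank_euclideanSpace_fin])
  let L₂ : D₂ x ≃ₗ[ℝ] EuclideanSpace ℝ (Fin n₂) :=
    LinearEquiv.ofFinrankEq _ _ (by rw [hn₂, finrank_euclideanSpace_fin])
  let L₀ : TangentSpace I x ≃ₗ[ℝ] EuclideanSpace ℝ (Fin n₁) × EuclideanSpace ℝ (Fin n₂) :=
    (Submodule.prodEquivOfIsCompl _ _ hc).symm.trans (L₁.prodCongr L₂)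
  have hL1 : ∀ u, (L₀ u).2 = 0 ↔ u ∈ D₁ x := by
    intro u
    rw [← Submodule.prodEquivOfIsCompl_symm_apply_snd_eq_zero _ _ hc]
    exact L₂.map_eq_zero_iff
  have hL2 : ∀ u, (L₀ u).1 = 0 ↔ u ∈ D₂ x := by
    intro u
    rw [← Submodule.prodEquivOfIsCompl_symm_apply_fst_eq_zero _ _ hc]
    exact L₁.map_eq_zero_iff
  let L : E ≃L[ℝ] EuclideanSpace ℝ (Fin n₁) × EuclideanSpace ℝ (Fin n₂) :=
    ((equivAt hx₀).toLinearEquiv.symm.trans L₀).toContinuousLinearEquiv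
  have hL : ∀ u, L (Φ₀.coframe x u) = L₀ u := by
    intro u
    exact congrArg L₀ ((equivAt hx₀).symm_apply_apply u)
  let Φ := Φ₀.transLinear L
  have hx : x ∈ Φ.source := mem_source_transLinear.2 hx₀
  let σ := ContinuousLinearEquiv.prodComm ℝ (EuclideanSpace ℝ (Fin n₁)) (EuclideanSpace ℝ (Fin n₂))
  let Φ' := Φ.transLinear σ
  have hx' : x ∈ Φ'.source := mem_source_transLinear.2 hx
  have hco : ∀ u, Φ.coframe x u = L₀ u := fun u => by rw [coframe_transLinear hx₀, hL]
  obtain ⟨P, r, hP, hPr⟩ := hrad Φ hx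
  obtain ⟨P', r', hP', hPr'⟩ := hrad' Φ' hx'
  obtain ⟨f₁, U₁, hU₁, hxU₁, hU₁t, hf₁, hker₁⟩ := exists_first_integral htor h₂ hx hP hPr
    (fun u => by rw [hco, hL2])
  obtain ⟨f₂, U₂, hU₂, hxU₂, hU₂t, hf₂, hker₂⟩ := exists_first_integral htor h₁ hx' hP' hPr'
    (fun u => by
      rw [coframe_transLinear hx, hco]
      exact (hL1 u).symm)
  let U := U₁ ∩ σ ⁻¹' U₂
  have hU : IsOpen U := hU₁.inter (hU₂.preimage σ.continuous)
  have hxU : Φ x ∈ U := ⟨hxU₁, hxU₂⟩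
  let f : EuclideanSpace ℝ (Fin n₁) × EuclideanSpace ℝ (Fin n₂) →
      EuclideanSpace ℝ (Fin n₁) × EuclideanSpace ℝ (Fin n₂) := fun q => (f₁ q, f₂ (σ q))
  have hf : ContDiffOn ℝ ∞ f U :=
    (hf₁.mono inter_subset_left).prodMk (hf₂.comp σ.contDiff.contDiffOn fun q hq => hq.2)
  have hfd : ∀ q ∈ U, ∀ a, fderiv ℝ f q a = (fderiv ℝ f₁ q a, fderiv ℝ f₂ (σ q) (σ a)) := by
    intro q hq a
    have h3 : HasFDerivAt f₁ (fderiv ℝ f₁ q) q :=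
      ((hf₁.contDiffAt (hU₁.mem_nhds hq.1)).differentiableAt (by simp)).hasFDerivAt
    have h4 : HasFDerivAt f₂ (fderiv ℝ f₂ (σ q)) (σ q) :=
      ((hf₂.contDiffAt (hU₂.mem_nhds hq.2)).differentiableAt (by simp)).hasFDerivAt
    have h5 : HasFDerivAt f _ q := h3.prodMk (h4.comp q σ.hasFDerivAt)
    rw [h5.fderiv]
    rfl
  have hmem : ∀ y ∈ Φ.source, Φ y ∈ U → ∀ v : TangentSpace I y,
      (v ∈ D₁ y ↔ (fderiv ℝ f (Φ y) (Φ.coframe y v)).2 = 0) ∧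
      (v ∈ D₂ y ↔ (fderiv ℝ f (Φ y) (Φ.coframe y v)).1 = 0) := by
    intro y hy hyU v
    rw [hfd _ hyU]
    constructor
    · have h3 : Φ' y = σ (Φ y) := rfl
      have h4 : ∀ m, m = y → (∀ w : TangentSpace I m, w ∈ D₁ m ↔
          fderiv ℝ f₂ (σ (Φ y)) (Φ'.coframe m w) = 0) →
          (v ∈ D₁ y ↔ fderiv ℝ f₂ (σ (Φ y)) (σ (Φ.coframe y v)) = 0) := by
        rintro m rfl h5
        rw [h5, coframe_transLinear hy]
      exact h4 _ (Φ'.left_inv (mem_source_transLinear.2 hy)) (hker₂ (σ (Φ y)) hyU.2)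
    · have h4 : ∀ m, m = y → (∀ w : TangentSpace I m, w ∈ D₂ m ↔
          fderiv ℝ f₁ (Φ y) (Φ.coframe m w) = 0) →
          (v ∈ D₂ y ↔ fderiv ℝ f₁ (Φ y) (Φ.coframe y v) = 0) := by
        rintro m rfl h5
        rw [h5]
      exact h4 _ (Φ.left_inv hy) (hker₁ (Φ y) hyU.1)
  have hinj : Function.Injective (fderiv ℝ f (Φ x)) := by
    rw [injective_iff_map_eq_zero]
    intro a ha
    have h3 := hmem x hx hxU (Φ.frame x a)
    rw [coframe_frame hx, ha] at h3
    have h4 : Φ.frame x a ∈ D₁ x ⊓ D₂ x := ⟨h3.1.2 rfl, h3.2.2 rfl⟩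
    rw [hc.inf_eq_bot, Submodule.mem_bot] at h4
    rw [← coframe_frame hx a, h4, map_zero]
  let f' : (EuclideanSpace ℝ (Fin n₁) × EuclideanSpace ℝ (Fin n₂)) ≃L[ℝ]
      (EuclideanSpace ℝ (Fin n₁) × EuclideanSpace ℝ (Fin n₂)) :=
    (LinearEquiv.ofInjectiveEndo (fderiv ℝ f (Φ x)).toLinearMap hinj).toContinuousLinearEquiv
  have hf' : HasFDerivAt f (f' : EuclideanSpace ℝ (Fin n₁) × EuclideanSpace ℝ (Fin n₂) →L[ℝ]
      EuclideanSpace ℝ (Fin n₁) × EuclideanSpace ℝ (Fin n₂)) (Φ x) := by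
    have h3 := ((hf.contDiffAt (hU.mem_nhds hxU)).differentiableAt (by simp)).hasFDerivAt
    exact h3
  obtain ⟨e, hxe, heU, hef, hesymm⟩ := exists_smooth_localInverse hU hf hxU f' hf'
  have heq : ⇑e = f := funext hef
  have he : ContDiffOn ℝ ∞ e e.source := by rw [heq]; exact hf.mono heU
  refine ⟨Φ.transDiffeo e he hesymm, mem_source_transDiffeo.2 ⟨hx, hxe⟩, ?_, ?_⟩
  · intro y hy v
    obtain ⟨h3, h4⟩ := mem_source_transDiffeo.1 hy
    rw [coframe_transDiffeo hy, heq]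
    exact (hmem y h3 (heU h4) v).1
  · intro y hy v
    obtain ⟨h3, h4⟩ := mem_source_transDiffeo.1 hy
    rw [coframe_transDiffeo hy, heq]
    exact (hmem y h3 (heU h4) v).2

end Integration

/-! ### Conformal products from split charts -/

section Neighborhoods

variable {E : Type*} [NormedAddCommGroup E] [NormedSpace ℝ E] [FiniteDimensional ℝ E]
  {H : Type*} [TopologicalSpace H] {I : ModelWithCorners ℝ E H}
  {M : Type*} [TopologicalSpace M] [ChartedSpace H M] [IsManifold I ∞ M]
  {F : Type*} [NormedAddCommGroup F] [NormedSpace ℝ F] [FiniteDimensional ℝ F]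
  {X : Type*} [NormedAddCommGroup X] [NormedSpace ℝ X] [FiniteDimensional ℝ X]
  {E₁ : Type*} [NormedAddCommGroup E₁] [NormedSpace ℝ E₁] [FiniteDimensional ℝ E₁]
  {E₂ : Type*} [NormedAddCommGroup E₂] [NormedSpace ℝ E₂] [FiniteDimensional ℝ E₂]

open SmoothChart

/-- Along a segment on which the vectors of a subspace are parallel, the restriction of a conformal
metric to this subspace changes only by a factor. -/
lemma exists_ratio_of_parallel {G : F → F →L[ℝ] F →L[ℝ] ℝ} (hG : ∀ p, IsScalarProduct (G p))
    (hGd : Differentiable ℝ G) {Γ : F → F →L[ℝ] F →L[ℝ] F} {θ : F → F →L[ℝ] ℝ}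
    (hθ : ∀ p v a b, fderiv ℝ G p v a b =
      G p (Γ p a v) b + G p a (Γ p b v) - 2 * θ p v * G p a b)
    [Nontrivial X] {ι : X →L[ℝ] F} (hι : Function.Injective ι) {p u : F}
    (hΓ : ∀ (t : ℝ) (a : X), Γ (p + t • u) (ι a) u = 0) :
    ∃ r : ℝ, 0 < r ∧ ∀ a b, G (p + u) (ι a) (ι b) = r * G p (ι a) (ι b) := by
  obtain ⟨e, he⟩ := exists_ne (0 : X)
  have he' : ι e ≠ 0 := fun h => he (hι (h.trans (map_zero ι).symm))
  have hpos : ∀ q, 0 < G q (ι e) (ι e) := fun q => (hG q).pos _ he'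
  refine ⟨G (p + u) (ι e) (ι e) / G p (ι e) (ι e), div_pos (hpos _) (hpos _), fun a b => ?_⟩
  let f : X → X → ℝ → ℝ := fun a b t => G (p + t • u) (ι a) (ι b)
  have hf : ∀ a b, ∀ t ∈ Icc (0 : ℝ) 1, HasDerivAt (f a b) (-2 * θ (p + t • u) u * f a b t) t := by
    intro a b t _
    have h1 : HasDerivAt (fun t : ℝ => p + t • u) u t := by
      simpa using ((hasDerivAt_id t).smul_const u).const_add p
    have h2 : HasDerivAt (fun t : ℝ => G (p + t • u)) (fderiv ℝ G (p + t • u) u) t :=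
      HasFDerivAt.comp_hasDerivAt (f := fun t : ℝ => p + t • u) t (hGd _).hasFDerivAt h1
    refine ((h2.clm_apply (hasDerivAt_const t (ι a))).clm_apply
      (hasDerivAt_const t (ι b))).congr_deriv ?_
    rw [map_zero, map_zero, add_zero, add_zero, hθ, hΓ, hΓ, map_zero, map_zero, zero_apply]
    simp only [f]
    ring
  have h := mul_eq_mul_of_hasDerivAt (hf a b) (hf e e) fun t _ => (hpos _).ne'
  simp only [f, one_smul, zero_smul, add_zero] at h
  rw [div_mul_eq_mul_div, eq_div_iff (hpos p).ne', h, mul_comm]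

/-- On a finite-dimensional space the unit ball of a scalar product is bounded, by compactness of
the unit sphere of the norm. -/
lemma IsScalarProduct.isVonNBounded {G : F →L[ℝ] F →L[ℝ] ℝ} (hG : IsScalarProduct G) :
    Bornology.IsVonNBounded ℝ {v : F | G v v < 1} := by
  rw [NormedSpace.isVonNBounded_iff, isBounded_iff_forall_norm_le]
  rcases subsingleton_or_nontrivial F with h | h
  · exact ⟨0, fun v _ => by rw [Subsingleton.elim v 0, norm_zero]⟩
  have hcont : Continuous fun v => G v v := G.continuous.clm_apply continuous_id
  obtain ⟨e, he, hmin⟩ := (isCompact_sphere (0 : F) 1).exists_isMinOn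
    (NormedSpace.sphere_nonempty.2 zero_le_one) hcont.continuousOn
  have he0 : e ≠ 0 := fun h => by simp [h] at he
  have hm := hG.pos e he0
  refine ⟨√(G e e)⁻¹, fun v hv => ?_⟩
  rcases eq_or_ne v 0 with rfl | hv0
  · rw [norm_zero]; exact Real.sqrt_nonneg _
  have hv1 := norm_pos_iff.2 hv0
  have h1 : ‖v‖⁻¹ • v ∈ Metric.sphere (0 : F) 1 := by
    rw [mem_sphere_zero_iff_norm, norm_smul, norm_inv, norm_norm, inv_mul_cancel₀ hv1.ne']
  have h2 : G e e ≤ G (‖v‖⁻¹ • v) (‖v‖⁻¹ • v) := hmin h1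
  rw [map_smul, map_smul, smul_apply, smul_eq_mul, smul_eq_mul] at h2
  refine Real.le_sqrt_of_sq_le ?_
  rw [le_inv_comm₀ (by positivity) hm]
  refine h2.trans ?_
  have hv2 : G v v ≤ 1 := le_of_lt hv
  calc ‖v‖⁻¹ * (‖v‖⁻¹ * G v v) ≤ ‖v‖⁻¹ * (‖v‖⁻¹ * 1) := by gcongr
    _ = (‖v‖ ^ 2)⁻¹ := by field_simp

/-- The Riemannian metric on a vector space given by a smooth family of scalar products. -/
def metricOfScalarProduct (K : F → F →L[ℝ] F →L[ℝ] ℝ) (hK : ∀ p, IsScalarProduct (K p))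
    (hs : ContDiff ℝ ∞ K) : Metric 𝓘(ℝ, F) F where
  inner p := K p
  symm p := (hK p).symm
  pos p := (hK p).pos
  isVonNBounded p := (hK p).isVonNBounded
  contMDiff := by
    intro x
    -- the family is given the type of a section, to which the lemmas on bundles apply
    have key : ∀ k : (p : F) → TangentSpace 𝓘(ℝ, F) p →L[ℝ] TangentSpace 𝓘(ℝ, F) p →L[ℝ] ℝ,
        (∀ p (v w : F), k p v w = K p v w) →
        ContMDiffAt 𝓘(ℝ, F) (𝓘(ℝ, F).prod 𝓘(ℝ, F →L[ℝ] F →L[ℝ] ℝ)) ∞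
          (fun p => TotalSpace.mk' (F →L[ℝ] F →L[ℝ] ℝ) p (k p)) x := by
      intro k hk
      rw [contMDiffAt_section]
      convert! hs.contMDiff.contMDiffAt (x := x) using 1
      funext p
      ext v w
      rw [← hk p v w]
      rw [hom_trivializationAt_apply, ContinuousLinearMap.inCoordinates]
      simp only [ContinuousLinearMap.comp_apply, Trivialization.continuousLinearMapAt_apply]
      rw [Trivialization.coe_linearMapAt_of_mem _ (by
        simp [hom_trivializationAt_baseSet]
        exact mem_univ p)]
      simp [hom_trivializationAt_apply, ContinuousLinearMap.inCoordinates]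
      rfl
    exact key K fun _ _ _ => rfl

namespace SmoothChart

lemma mfderiv_clm_comp {Φ : SmoothChart I M F} {y : M} (hy : y ∈ Φ.source) (q : F →L[ℝ] X)
    (v : TangentSpace I y) :
    mfderiv I 𝓘(ℝ, X) (fun y => q (Φ y)) y v = q (Φ.coframe y v) := by
  have h1 : HasMFDerivAt I 𝓘(ℝ, F) Φ y (mfderiv I 𝓘(ℝ, F) Φ y) :=
    ((contMDiffAt hy).mdifferentiableAt (by simp)).hasMFDerivAt
  exact DFunLike.congr_fun (q.hasMFDerivAt.comp y h1).mfderiv v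

/-- A linear projection, in a chart, is a conformal submersion if the restriction of the metric to
an orthogonal complement of its kernel is a multiple of a metric of the base. -/
lemma isConformalSubmersionOn {Φ : SmoothChart I M F} {c : ConformalStructure I M}
    {g : Metric I M} (hg : c.HasMetric g) {k : Metric 𝓘(ℝ, X) X} {c' : ConformalStructure 𝓘(ℝ, X) X}
    (hk : c'.HasMetric k) {q : F →L[ℝ] X} {ι : X →L[ℝ] F} (hq : ∀ a, q (ι a) = a)
    (horth : ∀ p ∈ Φ.target, ∀ a b, q b = 0 → Φ.metric g p (ι a) b = 0)
    (hgk : ∀ p ∈ Φ.target, ∃ r : ℝ, 0 < r ∧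
      ∀ a b : X, k.inner (q p) a b = r * Φ.metric g p (ι a) (ι b)) :
    IsConformalSubmersionOn c c' (fun y => q (Φ y)) Φ.source := by
  refine ⟨q.contMDiff.comp_contMDiffOn Φ.smooth, fun y hy => ⟨fun a => ?_, ?_⟩⟩
  · refine ⟨Φ.frame y (ι a), ?_⟩
    rw [mfderiv_clm_comp hy, coframe_frame hy]
    exact hq a
  intro g' k' hg' hk'
  obtain ⟨f, -, hf, hfg⟩ : (conformalSetoid I M).r g g' := Quotient.exact (hg.trans hg'.symm)
  obtain ⟨f', -, hf', hfk⟩ : (conformalSetoid 𝓘(ℝ, X) X).r k k' :=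
    Quotient.exact (hk.trans hk'.symm)
  have hp := Φ.map_source hy
  obtain ⟨r, hr, hgk⟩ := hgk (Φ y) hp
  -- in the chart, vectors orthogonal to the kernel lie in the image of `ι`
  have key : ∀ v : TangentSpace I y, (∀ u ∈ kerD I 𝓘(ℝ, X) (fun y => q (Φ y)) y,
      c.Orthogonal y v u) → Φ.coframe y v = ι (q (Φ.coframe y v)) := by
    intro v hv
    set d := Φ.coframe y v - ι (q (Φ.coframe y v)) with hd
    have hqd : q d = 0 := by rw [hd, map_sub, hq, sub_self]
    have h1 : Φ.frame y d ∈ kerD I 𝓘(ℝ, X) (fun y => q (Φ y)) y := by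
      refine LinearMap.mem_ker.2 ?_
      refine (mfderiv_clm_comp hy q _).trans ?_
      rw [coframe_frame hy, hqd]
      rfl
    have h2 := hv _ h1 g hg
    rw [← metric_coframe g hy, coframe_frame hy] at h2
    have h3 : Φ.coframe y v = d + ι (q (Φ.coframe y v)) := by rw [hd, sub_add_cancel]
    rw [h3, map_add, add_apply, horth _ hp _ _ hqd, add_zero] at h2
    exact sub_eq_zero.1 ((isScalarProduct_metric g hp).eq_zero h2)
  refine ⟨f' (q (Φ y)) * r * (f y)⁻¹, by have := hf y; have := hf' (q (Φ y)); positivity, ?_⟩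
  intro v w hv hw
  rw [hfk, hfg, mfderiv_clm_comp hy, mfderiv_clm_comp hy]
  have h1 := hgk (q (Φ.coframe y v)) (q (Φ.coframe y w))
  rw [← key v hv, ← key w hw, metric_coframe g hy] at h1
  have h2 := (hf y).ne'
  have h3 : k.inner (q (Φ y)) (q (Φ.coframe y v)) (q (Φ.coframe y w)) = r * g.inner y v w := h1
  refine (congrArg _ h3).trans ?_
  field_simp

variable {Φ : SmoothChart I M (E₁ × E₂)} {D₁ D₂ : (x : M) → Submodule ℝ (TangentSpace I x)}

lemma contMDiffOn_prod (Φ : SmoothChart I M (E₁ × E₂)) :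
    ContMDiffOn I (𝓘(ℝ, E₁).prod 𝓘(ℝ, E₂)) ∞ Φ Φ.source :=
  (contDiff_fst.contMDiff.comp_contMDiffOn Φ.smooth).prodMk
    (contDiff_snd.contMDiff.comp_contMDiffOn Φ.smooth)

lemma contMDiffOn_prod_symm (Φ : SmoothChart I M (E₁ × E₂)) :
    ContMDiffOn (𝓘(ℝ, E₁).prod 𝓘(ℝ, E₂)) I ∞ Φ.inv Φ.target :=
  Φ.smooth_symm.comp (contMDiff_fst.prodMk_space contMDiff_snd).contMDiffOn fun _ hp => hp

lemma IsSplit.kerD_snd (hs : Φ.IsSplit D₁ D₂) {y : M} (hy : y ∈ Φ.source) :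
    kerD I 𝓘(ℝ, E₂) (fun y => (Φ y).2) y = D₁ y := by
  ext v
  rw [hs.mem₁ y hy]
  exact Eq.congr_left (mfderiv_clm_comp hy (ContinuousLinearMap.snd ℝ E₁ E₂) v)

lemma IsSplit.kerD_fst (hs : Φ.IsSplit D₁ D₂) {y : M} (hy : y ∈ Φ.source) :
    kerD I 𝓘(ℝ, E₁) (fun y => (Φ y).1) y = D₂ y := by
  ext v
  rw [hs.mem₂ y hy]
  exact Eq.congr_left (mfderiv_clm_comp hy (ContinuousLinearMap.fst ℝ E₁ E₂) v)

/-- A ball, as a chart onto the whole vector space. -/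
def ballChart {V : Type*} [NormedAddCommGroup V] [InnerProductSpace ℝ V] (c : V) {r : ℝ}
    (hr : 0 < r) : SmoothChart 𝓘(ℝ, V) V V where
  toOpenPartialHomeomorph := (OpenPartialHomeomorph.univBall c r).symm
  smooth := by
    rw [OpenPartialHomeomorph.symm_source, OpenPartialHomeomorph.univBall_target c hr]
    exact OpenPartialHomeomorph.contDiffOn_univBall_symm.contMDiffOn
  smooth_symm := OpenPartialHomeomorph.contDiff_univBall.contMDiff.contMDiffOn

/-- A split chart can be replaced by one which is onto. -/
lemma IsSplit.exists_target_eq_univ {V₁ : Type*} [NormedAddCommGroup V₁] [InnerProductSpace ℝ V₁]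
    [FiniteDimensional ℝ V₁] {V₂ : Type*} [NormedAddCommGroup V₂] [InnerProductSpace ℝ V₂]
    [FiniteDimensional ℝ V₂] {Φ : SmoothChart I M (V₁ × V₂)}
    (hs : Φ.IsSplit D₁ D₂) {x : M} (hx : x ∈ Φ.source) :
    ∃ Ψ : SmoothChart I M (V₁ × V₂), x ∈ Ψ.source ∧ Ψ.target = univ ∧ Ψ.IsSplit D₁ D₂ := by
  obtain ⟨r, hr, hball⟩ := Metric.isOpen_iff.1 Φ.open_target _ (Φ.map_source hx)
  let Ψ := prodChart Φ.toOpenPartialHomeomorph Φ.contMDiffOn_prod Φ.contMDiffOn_prod_symm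
    (ballChart (Φ x).1 hr) (ballChart (Φ x).2 hr)
  have hsub : ∀ y ∈ Ψ.source, y ∈ Φ.source := fun y hy => (mem_source_prodChart.1 hy).1
  refine ⟨Ψ, mem_source_prodChart.2 ⟨hx, ?_, ?_⟩, ?_, isSplit_prodChart.congr
    (fun y hy => hs.kerD_snd (hsub y hy)) fun y hy => hs.kerD_fst (hsub y hy)⟩
  · exact (OpenPartialHomeomorph.univBall_target (Φ x).1 hr).superset (Metric.mem_ball_self hr)
  · exact (OpenPartialHomeomorph.univBall_target (Φ x).2 hr).superset (Metric.mem_ball_self hr)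
  · refine eq_univ_of_forall fun p => ⟨⟨?_, ?_⟩, ?_⟩
    · exact (OpenPartialHomeomorph.univBall_source (Φ x).1 r).superset (mem_univ _)
    · exact (OpenPartialHomeomorph.univBall_source (Φ x).2 r).superset (mem_univ _)
    · have h1 : OpenPartialHomeomorph.univBall (Φ x).1 r p.1 ∈ Metric.ball (Φ x).1 r := by
        rw [← OpenPartialHomeomorph.univBall_target (Φ x).1 hr]
        apply OpenPartialHomeomorph.map_source
        rw [OpenPartialHomeomorph.univBall_source]; exact mem_univ _
      have h2 : OpenPartialHomeomorph.univBall (Φ x).2 r p.2 ∈ Metric.ball (Φ x).2 r := by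
        rw [← OpenPartialHomeomorph.univBall_target (Φ x).2 hr]
        apply OpenPartialHomeomorph.map_source
        rw [OpenPartialHomeomorph.univBall_source]; exact mem_univ _
      apply hball
      rw [← Prod.mk.eta (p := Φ x), ← ball_prod_same]
      exact ⟨h1, h2⟩

end SmoothChart

/-- A Weyl structure that preserves two orthogonal distributions, which are the tangent
distributions of the factors in a local product decomposition, makes this decomposition
a conformal product. -/
theorem SmoothChart.IsSplit.nonempty_conformalProductNeighborhood [T2Space M]
    {c : ConformalStructure I M} {W : WeylStructure c} {g : Metric I M} (hg : c.HasMetric g)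
    {D₁ D₂ : (x : M) → Submodule ℝ (TangentSpace I x)} (hW : W.PreservesSplitting D₁ D₂)
    (horth : ∀ x, ∀ u ∈ D₁ x, ∀ v ∈ D₂ x, g.inner x u v = 0) {n₁ n₂ : ℕ} (hn₁ : 0 < n₁)
    (hn₂ : 0 < n₂) {Φ : SmoothChart I M (EuclideanSpace ℝ (Fin n₁) × EuclideanSpace ℝ (Fin n₂))}
    (hs : Φ.IsSplit D₁ D₂) {x : M} (hx : x ∈ Φ.source) :
    Nonempty (ConformalProductNeighborhood c D₁ D₂ x) := by
  obtain ⟨Ψ, hxΨ, htar, hΨ⟩ := hs.exists_target_eq_univ hx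
  have : Nonempty (Fin n₁) := ⟨⟨0, hn₁⟩⟩
  have : Nonempty (Fin n₂) := ⟨⟨0, hn₂⟩⟩
  set X₁ := EuclideanSpace ℝ (Fin n₁)
  set X₂ := EuclideanSpace ℝ (Fin n₂)
  have ht : ∀ p, p ∈ Ψ.target := fun p => htar ▸ mem_univ p
  set G := Ψ.metric g with hGdef
  have hG : ∀ p, IsScalarProduct (G p) := fun p => isScalarProduct_metric g (ht p)
  have hGs : ContDiff ℝ ∞ G := contDiffOn_univ.1 (htar ▸ contDiffOn_metric g)
  set Γ := Ψ.christoffel W.nabla.toFun with hΓdef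
  have hweyl := W.isWeylOn hg
  obtain ⟨θ, hθ⟩ := fderiv_metric (Φ := Ψ) hweyl
  have hθ' : ∀ p v a b, fderiv ℝ G p v a b =
      G p (Γ p a v) b + G p a (Γ p b v) - 2 * θ p v * G p a b := by
    intro p v a b
    have h1 := hθ (Ψ.inv p) (Ψ.map_target (ht p)) univ_mem v a b
    rwa [show Ψ (Ψ.inv p) = p from Ψ.right_inv (ht p)] at h1
  have hΓsymm : ∀ p a b, Γ p a b = Γ p b a := fun p a b =>
    christoffel_symm hweyl.isCov hweyl.torsion_free (ht p) univ_mem a b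
  have hblock : ∀ p, IsBlock (Γ p) := by
    intro p
    have h1 := hΨ.isBlock hweyl.isCov (preservesOn_univ_iff.2 hW.1) (preservesOn_univ_iff.2 hW.2)
      univ_mem (Ψ.map_target (ht p))
    rwa [show Ψ (Ψ.inv p) = p from Ψ.right_inv (ht p)] at h1
  have hortho : ∀ p a b, G p (a, 0) (0, b) = 0 := by
    intro p a b
    have hp := Ψ.map_target (ht p)
    have h1 : ∀ u, Ψ.coframe (Ψ.inv p) (Ψ.frame (Ψ.inv p) u) = u := coframe_frame hp
    exact horth _ _ ((hΨ.mem₁ _ hp _).2 (congrArg Prod.snd (h1 (a, 0)))) _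
      ((hΨ.mem₂ _ hp _).2 (congrArg Prod.fst (h1 (0, b))))
  -- the metrics on the factors are the restrictions to the axes
  let i₁ := ContinuousLinearMap.inl ℝ X₁ X₂
  let i₂ := ContinuousLinearMap.inr ℝ X₁ X₂
  let K₁ : X₁ → X₁ →L[ℝ] X₁ →L[ℝ] ℝ := fun a =>
    ContinuousLinearMap.precomp ℝ i₁ ∘L G (a, 0) ∘L i₁
  let K₂ : X₂ → X₂ →L[ℝ] X₂ →L[ℝ] ℝ := fun b =>
    ContinuousLinearMap.precomp ℝ i₂ ∘L G (0, b) ∘L i₂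
  have hK₁ : ∀ p, IsScalarProduct (K₁ p) := fun p =>
    ⟨fun a b => (hG _).symm _ _, fun a ha => (hG _).pos _ fun h => ha (congrArg Prod.fst h)⟩
  have hK₂ : ∀ p, IsScalarProduct (K₂ p) := fun p =>
    ⟨fun a b => (hG _).symm _ _, fun a ha => (hG _).pos _ fun h => ha (congrArg Prod.snd h)⟩
  have hs₁ : ContDiff ℝ ∞ K₁ := contDiff_const.clm_comp
    ((hGs.comp (contDiff_id.prodMk contDiff_const)).clm_comp contDiff_const)
  have hs₂ : ContDiff ℝ ∞ K₂ := contDiff_const.clm_comp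
    ((hGs.comp (contDiff_const.prodMk contDiff_id)).clm_comp contDiff_const)
  let k₁ := metricOfScalarProduct K₁ hK₁ hs₁
  let k₂ := metricOfScalarProduct K₂ hK₂ hs₂
  have hr₁ : ∀ p : X₁ × X₂, ∃ r : ℝ, 0 < r ∧
      ∀ a b : X₁, k₁.inner p.1 a b = r * G p (i₁ a) (i₁ b) := by
    intro p
    obtain ⟨r, hr, h⟩ := exists_ratio_of_parallel hG (hGs.differentiable (by simp)) hθ'
      (ι := i₁) (p := p) (u := (0, -p.2)) (fun a b h => congrArg Prod.fst h)
      (fun t a => (hblock _).mixed_eq_zero (hΓsymm _) a _)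
    refine ⟨r, hr, fun a b => ?_⟩
    rw [← h, show p + (0, -p.2) = (p.1, 0) by ext <;> simp]
    rfl
  have hr₂ : ∀ p : X₁ × X₂, ∃ r : ℝ, 0 < r ∧
      ∀ a b : X₂, k₂.inner p.2 a b = r * G p (i₂ a) (i₂ b) := by
    intro p
    obtain ⟨r, hr, h⟩ := exists_ratio_of_parallel hG (hGs.differentiable (by simp)) hθ'
      (ι := i₂) (p := p) (u := (-p.1, 0)) (fun a b h => congrArg Prod.snd h)
      (fun t a => (hΓsymm _ _ _).trans ((hblock _).mixed_eq_zero (hΓsymm _) _ a))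
    refine ⟨r, hr, fun a b => ?_⟩
    rw [← h, show p + (-p.1, 0) = (0, p.2) by ext <;> simp]
    rfl
  exact ⟨{
    n₁ := n₁
    n₂ := n₂
    n₁_pos := hn₁
    n₂_pos := hn₂
    M₁ := X₁
    M₂ := X₂
    c₁ := Quotient.mk _ k₁
    c₂ := Quotient.mk _ k₂
    Φ := Ψ.toOpenPartialHomeomorph
    mem_source := hxΨ
    target_eq := htar
    smooth := Ψ.contMDiffOn_prod
    smooth_symm := by
      rw [← contMDiffOn_univ, ← htar]
      exact Ψ.contMDiffOn_prod_symm
    conformal₁ := isConformalSubmersionOn (k := k₁) hg rfl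
      (q := ContinuousLinearMap.fst ℝ X₁ X₂) (ι := i₁) (fun _ => rfl)
      (fun p _ a b hb => by
        have h1 : b = (0, b.2) := Prod.ext hb rfl
        rw [h1]
        exact hortho p a b.2) (fun p _ => hr₁ p)
    conformal₂ := isConformalSubmersionOn (k := k₂) hg rfl
      (q := ContinuousLinearMap.snd ℝ X₁ X₂) (ι := i₂) (fun _ => rfl)
      (fun p _ a b hb => by
        have h1 : b = (b.1, 0) := Prod.ext rfl hb
        rw [h1]
        exact ((hG p).symm _ _).trans (hortho p b.1 a)) (fun p _ => hr₂ p)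
    orthogonal := by
      intro y hy v hv w hw g' hg'
      rw [hΨ.kerD_fst hy] at hv
      rw [hΨ.kerD_snd hy] at hw
      obtain ⟨f, -, -, hfg⟩ : (conformalSetoid I M).r g g' := Quotient.exact (hg.trans hg'.symm)
      rw [hfg, g.symm, horth y w hw v hv, mul_zero]
    ker₂_eq := fun y hy => hΨ.kerD_snd hy
    ker₁_eq := fun y hy => hΨ.kerD_fst hy }⟩

end Neighborhoods

/-! ### The correspondence -/

section Correspondence

variable {E : Type*} [NormedAddCommGroup E] [NormedSpace ℝ E] [FiniteDimensional ℝ E]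
  {H : Type*} [TopologicalSpace H] {I : ModelWithCorners ℝ E H}
  {M : Type*} [TopologicalSpace M] [ChartedSpace H M] [IsManifold I ∞ M]
  {c : ConformalStructure I M}

open SmoothChart

lemma isCompl_orthogonalDistribution (g : Metric I M)
    (D : (x : M) → Submodule ℝ (TangentSpace I x)) (x : M) :
    IsCompl (D x) (orthogonalDistribution g D x) := by
  have : FiniteDimensional ℝ (TangentSpace I x) := inferInstanceAs (FiniteDimensional ℝ E)
  let B : LinearMap.BilinForm ℝ (TangentSpace I x) :=
    LinearMap.mk₂ ℝ (fun v w => g.inner x v w) (fun _ _ _ => by rw [map_add, add_apply])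
      (fun _ _ _ => by rw [map_smul, smul_apply]) (fun _ _ _ => map_add _ _ _)
      (fun _ _ _ => map_smul _ _ _)
  have hB : B.IsRefl := fun v w h => (g.symm x w v).trans h
  have h : B.orthogonal (D x) = orthogonalDistribution g D x := rfl
  rw [← h, LinearMap.BilinForm.isCompl_orthogonal_iff_disjoint hB, h, Submodule.disjoint_def]
  intro v hv hv'
  by_contra h0
  exact (g.pos x v h0).ne' (hv' v hv)

/-- A distribution which is complementary and orthogonal to `D` is the orthogonal complement. -/
lemma eq_orthogonalDistribution {g : Metric I M} {D D' : (x : M) → Submodule ℝ (TangentSpace I x)}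
    {x : M} (hc : D x ⊔ D' x = ⊤) (h : ∀ u ∈ D x, ∀ v ∈ D' x, g.inner x u v = 0) :
    D' x = orthogonalDistribution g D x := by
  refine le_antisymm (fun v hv u hu => h u hu v hv) fun v hv => ?_
  obtain ⟨a, ha, b, hb, rfl⟩ := Submodule.mem_sup.1 (hc ▸ Submodule.mem_top : v ∈ D x ⊔ D' x)
  have h1 := hv a ha
  rw [map_add, h a ha b hb, add_zero] at h1
  have h2 : a = 0 := by
    by_contra h0
    exact (g.pos x a h0).ne' h1
  rwa [h2, zero_add]

lemma SmoothChart.IsSplit.sup_eq_top {E₁ : Type*} [NormedAddCommGroup E₁] [NormedSpace ℝ E₁]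
    {E₂ : Type*} [NormedAddCommGroup E₂] [NormedSpace ℝ E₂] {Φ : SmoothChart I M (E₁ × E₂)}
    {D₁ D₂ : (x : M) → Submodule ℝ (TangentSpace I x)} (hs : Φ.IsSplit D₁ D₂) {x : M}
    (hx : x ∈ Φ.source) : D₁ x ⊔ D₂ x = ⊤ := by
  refine eq_top_iff.2 fun v _ => Submodule.mem_sup.2 ⟨Φ.frame x ((Φ.coframe x v).1, 0), ?_,
    Φ.frame x (0, (Φ.coframe x v).2), ?_, ?_⟩
  · rw [hs.mem₁ x hx, coframe_frame hx]
  · rw [hs.mem₂ x hx, coframe_frame hx]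
  · rw [← map_add, Prod.mk_add_mk, add_zero, zero_add, Prod.mk.eta, frame_coframe hx]

lemma SmoothChart.IsSplit.inner_eq_zero {E₁ : Type*} [NormedAddCommGroup E₁] [NormedSpace ℝ E₁]
    [FiniteDimensional ℝ E₁] {E₂ : Type*} [NormedAddCommGroup E₂] [NormedSpace ℝ E₂]
    [FiniteDimensional ℝ E₂] {Φ : SmoothChart I M (E₁ × E₂)}
    {D₁ D₂ : (x : M) → Submodule ℝ (TangentSpace I x)} (hs : Φ.IsSplit D₁ D₂) {g : Metric I M}
    (hg : IsConformalBlock (Φ.metric g) Φ.target) {x : M} (hx : x ∈ Φ.source)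
    {u v : TangentSpace I x} (hu : u ∈ D₁ x) (hv : v ∈ D₂ x) : g.inner x u v = 0 := by
  rw [hs.mem₁ x hx] at hu
  rw [hs.mem₂ x hx] at hv
  rw [← metric_coframe g hx]
  have h1 := hg.orthogonal _ (Φ.map_source hx) (Φ.coframe x u).1 (Φ.coframe x v).2
  rwa [show ((Φ.coframe x u).1, 0) = Φ.coframe x u from Prod.ext rfl hu.symm,
    show (0, (Φ.coframe x v).2) = Φ.coframe x v from Prod.ext hv.symm rfl] at h1

/-- A distribution which is preserved by the holonomy of a Weyl structure and its orthogonal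
complement form a local conformal product structure. -/
theorem exists_localConformalProductStructure [I.Boundaryless] [T2Space M]
    {W : WeylStructure c} {g : Metric I M} (hg : c.HasMetric g)
    {D : (x : M) → Submodule ℝ (TangentSpace I x)}
    (hD : ∀ (y z : M) (B : TangentSpace I y ≃ₗ[ℝ] TangentSpace I z),
        IsParallelTransport W.nabla y z B → ∀ v, B v ∈ D z ↔ v ∈ D y)
    (hbot : ∀ x, D x ≠ ⊥) (htop : ∀ x, D x ≠ ⊤) :
    W.PreservesSplitting D (orthogonalDistribution g D) ∧
      ∀ x, Nonempty (ConformalProductNeighborhood c D (orthogonalDistribution g D) x) := by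
  set D' := orthogonalDistribution g D with hD'
  have hW : W.PreservesSplitting D D' := by
    constructor
    all_goals
      refine preservesDistribution_of_isRadiallyParallel W.smooth fun x => ?_
      obtain ⟨P, r, hP, -, h1, h2⟩ :=
        exists_isRadiallyParallel hg hD (atPoint I x) (mem_source_atPoint x)
    · exact ⟨_, P, r, mem_source_atPoint x, hP, h1⟩
    · exact ⟨_, P, r, mem_source_atPoint x, hP, h2⟩
  refine ⟨hW, fun x => ?_⟩
  have : FiniteDimensional ℝ (TangentSpace I x) := inferInstanceAs (FiniteDimensional ℝ E)
  have hc := isCompl_orthogonalDistribution g D x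
  have hn₁ : 0 < Module.finrank ℝ (D x) :=
    Nat.pos_of_ne_zero fun h => hbot x (Submodule.finrank_eq_zero.1 h)
  have hn₂ : 0 < Module.finrank ℝ (D' x) := by
    refine Nat.pos_of_ne_zero fun h => htop x ?_
    have h1 := hc.sup_eq_top
    rwa [← hD', Submodule.finrank_eq_zero.1 h, sup_bot_eq] at h1
  have hweyl := W.isWeylOn hg
  obtain ⟨Φ, hx, hs⟩ := exists_isSplit_of_isRadiallyParallel (cov := W.nabla.toFun)
    hweyl.torsion_free (preservesOn_univ_iff.2 hW.1) (preservesOn_univ_iff.2 hW.2) x hc _ _ rfl rfl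
    (fun Φ hx => by
      obtain ⟨P, r, hP, -, -, h2⟩ := exists_isRadiallyParallel hg hD Φ hx
      exact ⟨P, r, hP, h2⟩)
    (fun Φ hx => by
      obtain ⟨P, r, hP, -, h1, -⟩ := exists_isRadiallyParallel hg hD Φ hx
      exact ⟨P, r, hP, h1⟩)
  exact hs.nonempty_conformalProductNeighborhood hg hW (fun y u hu v hv => hv u hu) hn₁ hn₂ hx

namespace LocalConformalProductStructure

variable (P : LocalConformalProductStructure c)

/-- The adapted Weyl structure exists and is unique. -/
theorem existsUnique_adapted :
    ∃! W : WeylStructure c, W.PreservesSplitting P.D₁ P.D₂ := by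
  obtain ⟨g, hg⟩ := Quotient.exists_rep c
  refine ConformalProducts.existsUnique_adapted hg fun x => ?_
  obtain ⟨N⟩ := P.isLocalProduct x
  have : Nonempty (Fin N.n₁) := ⟨⟨0, N.n₁_pos⟩⟩
  have : Nonempty (Fin N.n₂) := ⟨⟨0, N.n₂_pos⟩⟩
  obtain ⟨Φ, hx, hs, hb⟩ := N.exists_split_chart hg
  exact hs.hasAdaptedConnectionNear hb hx

lemma isLocallyParallel [T2Space M] {W : WeylStructure c} (hW : W.PreservesSplitting P.D₁ P.D₂) :
    IsLocallyParallel W.nabla P.D₁ := by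
  obtain ⟨g, hg⟩ := Quotient.exists_rep c
  intro x
  obtain ⟨N⟩ := P.isLocalProduct x
  obtain ⟨Φ, hx, hs, -⟩ := N.exists_split_chart hg
  exact ⟨Φ.source, Φ.open_source.mem_nhds hx, fun Y hY hpar c r hsub s hs' t ht h =>
    hs.parallel_mem W.smooth hW.1 hW.2 hY hpar hsub hs' ht h⟩

lemma ne_bot (x : M) : P.D₁ x ≠ ⊥ := by
  obtain ⟨g, hg⟩ := Quotient.exists_rep c
  obtain ⟨N⟩ := P.isLocalProduct x
  have : Nonempty (Fin N.n₁) := ⟨⟨0, N.n₁_pos⟩⟩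
  obtain ⟨Φ, hx, hs, -⟩ := N.exists_split_chart hg
  exact hs.ne_bot hx

lemma ne_top (x : M) : P.D₁ x ≠ ⊤ := by
  obtain ⟨g, hg⟩ := Quotient.exists_rep c
  obtain ⟨N⟩ := P.isLocalProduct x
  have : Nonempty (Fin N.n₂) := ⟨⟨0, N.n₂_pos⟩⟩
  obtain ⟨Φ, hx, hs, -⟩ := N.exists_split_chart hg
  exact hs.ne_top hx

lemma isReducingSubspace [T2Space M] {W : WeylStructure c} (hW : W.PreservesSplitting P.D₁ P.D₂)
    (x : M) : IsReducingSubspace W.nabla x (P.D₁ x) :=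
  ⟨P.ne_bot x, P.ne_top x, fun _ hA => (P.isLocallyParallel hW).holonomy_mem hA⟩

/-- In a local conformal product structure, the second distribution is the orthogonal complement of
the first one. -/
lemma D₂_eq {g : Metric I M} (hg : c.HasMetric g) (x : M) :
    P.D₂ x = orthogonalDistribution g P.D₁ x := by
  obtain ⟨N⟩ := P.isLocalProduct x
  obtain ⟨Φ, hx, hs, hb⟩ := N.exists_split_chart hg
  exact eq_orthogonalDistribution (hs.sup_eq_top hx) fun u hu v hv => hs.inner_eq_zero hb hx hu hv

end LocalConformalProductStructure

/-- A reducing subspace extends to a local conformal product structure. -/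
theorem IsReducingSubspace.exists_localConformalProductStructure [I.Boundaryless] [T2Space M]
    [ConnectedSpace M] {W : WeylStructure c} {x₀ : M} {V : Submodule ℝ (TangentSpace I x₀)}
    (hV : IsReducingSubspace W.nabla x₀ V) :
    ∃ P : LocalConformalProductStructure c, W.PreservesSplitting P.D₁ P.D₂ ∧ P.D₁ x₀ = V := by
  obtain ⟨g, hg⟩ := Quotient.exists_rep c
  obtain ⟨D, hD₀, hD⟩ := exists_parallel_distribution W.smooth hV.2.2
  have hbot : ∀ x, D x ≠ ⊥ := by
    intro x h
    obtain ⟨A, hA, -⟩ := exists_parallelTransport W.smooth x₀ x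
    refine hV.1 (eq_bot_iff.2 fun v hv => ?_)
    rw [← hD₀, ← hD _ _ _ hA, h, Submodule.mem_bot] at hv
    exact (Submodule.mem_bot ℝ).2 (A.map_eq_zero_iff.1 hv)
  have htop : ∀ x, D x ≠ ⊤ := by
    intro x h
    obtain ⟨A, hA, -⟩ := exists_parallelTransport W.smooth x₀ x
    refine hV.2.1 (eq_top_iff.2 fun v _ => ?_)
    rw [← hD₀, ← hD _ _ _ hA, h]
    exact Submodule.mem_top
  obtain ⟨hW, hN⟩ := ConformalProducts.exists_localConformalProductStructure hg hD hbot htop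
  exact ⟨⟨D, _, hN⟩, hW, hD₀⟩

/-- On a connected manifold, a local conformal product structure is determined by an adapted Weyl
structure and its first distribution at one point. -/
lemma LocalConformalProductStructure.eq_of_apply_eq [I.Boundaryless] [T2Space M] [ConnectedSpace M]
    {P P' : LocalConformalProductStructure c} {W : WeylStructure c}
    (hP : W.PreservesSplitting P.D₁ P.D₂) (hP' : W.PreservesSplitting P'.D₁ P'.D₂) {x₀ : M}
    (h : P.D₁ x₀ = P'.D₁ x₀) : P = P' := by
  obtain ⟨g, hg⟩ := Quotient.exists_rep c
  have key : ∀ {P P' : LocalConformalProductStructure c}, W.PreservesSplitting P.D₁ P.D₂ →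
      W.PreservesSplitting P'.D₁ P'.D₂ → P.D₁ x₀ = P'.D₁ x₀ → ∀ x, P.D₁ x ≤ P'.D₁ x := by
    intro P P' hP hP' h x v hv
    obtain ⟨A, hA, hA'⟩ := exists_parallelTransport W.smooth x₀ x
    have h1 := hA'.mem (P.isLocallyParallel hP) v hv
    rw [h] at h1
    have h2 := hA.mem (P'.isLocallyParallel hP') _ h1
    rwa [A.apply_symm_apply] at h2
  have h₁ : P.D₁ = P'.D₁ := funext fun x => le_antisymm (key hP hP' h x) (key hP' hP h.symm x)
  refine LocalConformalProductStructure.ext h₁ (funext fun x => ?_)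
  rw [P.D₂_eq hg, P'.D₂_eq hg, h₁]

/-- The correspondence between Weyl structures with a reducing subspace and local conformal product
structures. -/
theorem exists_equiv_localConformalProductStructure [I.Boundaryless] [T2Space M] [ConnectedSpace M]
    (c : ConformalStructure I M) (x₀ : M) :
    ∃ F : {p : WeylStructure c × Submodule ℝ (TangentSpace I x₀) //
          IsReducingSubspace p.1.nabla x₀ p.2} ≃ LocalConformalProductStructure c,
      ∀ p, p.1.1.PreservesSplitting (F p).D₁ (F p).D₂ ∧ (F p).D₁ x₀ = p.1.2 := by
  choose F hF hF₀ using fun p : {p : WeylStructure c × Submodule ℝ (TangentSpace I x₀) //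
    IsReducingSubspace p.1.nabla x₀ p.2} => p.2.exists_localConformalProductStructure
  refine ⟨Equiv.ofBijective F ⟨fun p q h => ?_, fun P => ?_⟩, fun p => ⟨hF p, hF₀ p⟩⟩
  · have h1 : p.1.1 = q.1.1 := (F p).existsUnique_adapted.unique (hF p) (h ▸ hF q)
    have h2 : p.1.2 = q.1.2 := by rw [← hF₀ p, ← hF₀ q, h]
    exact Subtype.ext (Prod.ext h1 h2)
  · obtain ⟨W, hW, -⟩ := P.existsUnique_adapted
    let p : {p : WeylStructure c × Submodule ℝ (TangentSpace I x₀) //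
      IsReducingSubspace p.1.nabla x₀ p.2} := ⟨(W, P.D₁ x₀), P.isReducingSubspace hW x₀⟩
    exact ⟨p, LocalConformalProductStructure.eq_of_apply_eq (hF p) hW (hF₀ p)⟩

end Correspondence

/-! ### Conformal products -/

section Product

variable {E₁ : Type*} [NormedAddCommGroup E₁] [NormedSpace ℝ E₁] [FiniteDimensional ℝ E₁]
  {H₁ : Type*} [TopologicalSpace H₁] {I₁ : ModelWithCorners ℝ E₁ H₁}
  {M₁ : Type*} [TopologicalSpace M₁] [ChartedSpace H₁ M₁] [IsManifold I₁ ∞ M₁]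
  {E₂ : Type*} [NormedAddCommGroup E₂] [NormedSpace ℝ E₂] [FiniteDimensional ℝ E₂]
  {H₂ : Type*} [TopologicalSpace H₂] {I₂ : ModelWithCorners ℝ E₂ H₂}
  {M₂ : Type*} [TopologicalSpace M₂] [ChartedSpace H₂ M₂] [IsManifold I₂ ∞ M₂]
  {c₁ : ConformalStructure I₁ M₁} {c₂ : ConformalStructure I₂ M₂}
  {c : ConformalStructure (I₁.prod I₂) (M₁ × M₂)}

open SmoothChart

lemma IsConformalProduct.exists_split_chart [I₁.Boundaryless] [I₂.Boundaryless]
    (h : IsConformalProduct c₁ c₂ c) {g : Metric (I₁.prod I₂) (M₁ × M₂)} (hg : c.HasMetric g)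
    (x : M₁ × M₂) :
    ∃ Φ : SmoothChart (I₁.prod I₂) (M₁ × M₂) (E₁ × E₂), x ∈ Φ.source ∧
      Φ.IsSplit (kerD (I₁.prod I₂) I₂ (Prod.snd : M₁ × M₂ → M₂))
        (kerD (I₁.prod I₂) I₁ (Prod.fst : M₁ × M₂ → M₁)) ∧
      IsConformalBlock (Φ.metric g) Φ.target := by
  obtain ⟨Φ, hx, -, hs, hb⟩ := ConformalProducts.exists_split_chart
    (Ψ := OpenPartialHomeomorph.refl (M₁ × M₂)) (I := I₁.prod I₂) contMDiffOn_id contMDiffOn_id hg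
    h.1 h.2.1 (fun y _ => h.2.2 y) (mem_univ x)
  exact ⟨Φ, hx, hs, hb⟩

/-- A conformal product has a unique adapted Weyl structure, and the latter has reducible
holonomy. -/
theorem IsConformalProduct.exists_adapted [I₁.Boundaryless] [I₂.Boundaryless] [T2Space M₁]
    [T2Space M₂] [Nontrivial E₁] [Nontrivial E₂] (h : IsConformalProduct c₁ c₂ c) :
    ∃ W : WeylStructure c,
      (∀ W' : WeylStructure c, W'.PreservesSplitting
          (kerD (I₁.prod I₂) I₂ (Prod.snd : M₁ × M₂ → M₂))
          (kerD (I₁.prod I₂) I₁ (Prod.fst : M₁ × M₂ → M₁)) ↔ W' = W) ∧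
      ∀ x : M₁ × M₂, HasReducibleHolonomyAt W.nabla x := by
  obtain ⟨g, hg⟩ := Quotient.exists_rep c
  obtain ⟨W, hW, huniq⟩ := existsUnique_adapted hg fun x => by
    obtain ⟨Φ, hx, hs, hb⟩ := h.exists_split_chart hg x
    exact hs.hasAdaptedConnectionNear hb hx
  refine ⟨W, fun W' => ⟨huniq W', by rintro rfl; exact hW⟩, fun x => ⟨_, ?_, ?_, fun A hA =>
    IsLocallyParallel.holonomy_mem (D := kerD (I₁.prod I₂) I₂ (Prod.snd : M₁ × M₂ → M₂)) ?_ hA⟩⟩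
  · obtain ⟨Φ, hx, hs, hb⟩ := h.exists_split_chart hg x
    exact hs.ne_bot hx
  · obtain ⟨Φ, hx, hs, hb⟩ := h.exists_split_chart hg x
    exact hs.ne_top hx
  · intro y
    obtain ⟨Φ, hy, hs, -⟩ := h.exists_split_chart hg y
    exact ⟨Φ.source, Φ.open_source.mem_nhds hy, fun Y hY hpar c r hsub s hs' t ht h =>
      hs.parallel_mem W.smooth hW.1 hW.2 hY hpar hsub hs' ht h⟩

end Product

end ConformalProducts

end

end Development

theorem mainTheorem2 :
    -- a connected conformal manifold `(M, c)`, with base point `x₀` for the holonomy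
    (∀ {E : Type*} [NormedAddCommGroup E] [NormedSpace ℝ E] [FiniteDimensional ℝ E]
      {H : Type*} [TopologicalSpace H] (I : ModelWithCorners ℝ E H) [I.Boundaryless]
      {M : Type*} [TopologicalSpace M] [ChartedSpace H M] [IsManifold I ∞ M]
      [T2Space M] [SecondCountableTopology M] [ConnectedSpace M]
      (c : ConformalProducts.ConformalStructure I M) (x₀ : M),
      -- `(M, c)` is a local conformal product iff it carries a Weyl structure of reducible holonomy
      (Nonempty (ConformalProducts.LocalConformalProductStructure c) ↔
        ∃ W : ConformalProducts.WeylStructure c,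
          ConformalProducts.HasReducibleHolonomyAt W.nabla x₀) ∧
      -- each local conformal product structure has a unique adapted Weyl structure
      (∀ P : ConformalProducts.LocalConformalProductStructure c,
        ∃! W : ConformalProducts.WeylStructure c, W.PreservesSplitting P.D₁ P.D₂) ∧
      -- one-to-one correspondence
      (∃ F : {p : ConformalProducts.WeylStructure c × Submodule ℝ (TangentSpace I x₀) //
            ConformalProducts.IsReducingSubspace p.1.nabla x₀ p.2} ≃
          ConformalProducts.LocalConformalProductStructure c,
        ∀ p, p.1.1.PreservesSplitting (F p).D₁ (F p).D₂ ∧ (F p).D₁ x₀ = p.1.2)) ∧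
    -- a conformal product structure `c` on `M₁ × M₂`
    (∀ {E₁ : Type*} [NormedAddCommGroup E₁] [NormedSpace ℝ E₁] [FiniteDimensional ℝ E₁]
      {H₁ : Type*} [TopologicalSpace H₁] (I₁ : ModelWithCorners ℝ E₁ H₁) [I₁.Boundaryless]
      {M₁ : Type*} [TopologicalSpace M₁] [ChartedSpace H₁ M₁] [IsManifold I₁ ∞ M₁]
      [T2Space M₁] [SecondCountableTopology M₁]
      {E₂ : Type*} [NormedAddCommGroup E₂] [NormedSpace ℝ E₂] [FiniteDimensional ℝ E₂]
      {H₂ : Type*} [TopologicalSpace H₂] (I₂ : ModelWithCorners ℝ E₂ H₂) [I₂.Boundaryless]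
      {M₂ : Type*} [TopologicalSpace M₂] [ChartedSpace H₂ M₂] [IsManifold I₂ ∞ M₂]
      [T2Space M₂] [SecondCountableTopology M₂]
      (_ : 0 < Module.finrank ℝ E₁) (_ : 0 < Module.finrank ℝ E₂)
      (c₁ : ConformalProducts.ConformalStructure I₁ M₁)
      (c₂ : ConformalProducts.ConformalStructure I₂ M₂)
      (c : ConformalProducts.ConformalStructure (I₁.prod I₂) (M₁ × M₂))
      (_ : ConformalProducts.IsConformalProduct c₁ c₂ c),
      -- it has a unique adapted Weyl structure, and the latter has reducible holonomy
      ∃ W : ConformalProducts.WeylStructure c,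
        (∀ W' : ConformalProducts.WeylStructure c, W'.PreservesSplitting
            (ConformalProducts.kerD (I₁.prod I₂) I₂ (Prod.snd : M₁ × M₂ → M₂))
            (ConformalProducts.kerD (I₁.prod I₂) I₁ (Prod.fst : M₁ × M₂ → M₁)) ↔ W' = W) ∧
        ∀ x : M₁ × M₂, ConformalProducts.HasReducibleHolonomyAt W.nabla x) := by
  refine ⟨?_, ?_⟩
  · intro E _ _ _ H _ I _ M _ _ _ _ _ _ c x₀
    refine ⟨⟨?_, ?_⟩, fun P => P.existsUnique_adapted,
      ConformalProducts.exists_equiv_localConformalProductStructure c x₀⟩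
    · rintro ⟨P⟩
      obtain ⟨W, hW, -⟩ := P.existsUnique_adapted
      exact ⟨W, P.D₁ x₀, P.isReducingSubspace hW x₀⟩
    · rintro ⟨W, V, hV⟩
      obtain ⟨P, -, -⟩ := hV.exists_localConformalProductStructure
      exact ⟨P⟩
  · intro E₁ _ _ _ H₁ _ I₁ _ M₁ _ _ _ _ _ E₂ _ _ _ H₂ _ I₂ _ M₂ _ _ _ _ _ h₁ h₂ c₁ c₂ c h
    have : Nontrivial E₁ := Module.finrank_pos_iff.1 h₁
    have : Nontrivial E₂ := Module.finrank_pos_iff.1 h₂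
    exact h.exists_adapted
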